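/- **Setting.** Let $A\in\mathbb R^{m\times n}$ with $\operatorname{rk}A=m$, $b\in\mathbb R^m$, $c\in\mathbb R^n$, $W=\ker A$, and consider $\min\langle c,x\rangle,\ Ax=b,\ x\ge 0$ and $\max\langle b,y\rangle,\ A^\top y+s=c,\ s\ge 0$. Let $\mathcal P_{++}=\{x>0: Ax=b\}$, $\mathcal D_{++}=\{s>0:\exists y,\ A^\top y+s=c\}$. Products, quotients and powers of vectors are coordinate-wise, $\|\cdot\|$ is Euclidean. For $z=(x,s)$ put $\overline\mu(z)=\langle x,s\rangle/n$ and $$\mathcal N^2(\beta)=\{z\in\mathcal P_{++}\times\mathcal D_{++}:\ \|xs/\overline\mu(z)-\mathbf 1\|\le\beta\},\qquad \overline{\mathcal N}^2(\beta)=\operatorname{cl}\mathcal N^2(\beta).$$ For $\mu>0$, $z^{\rm cp}(\mu)=(x^{\rm cp}(\mu),s^{\rm cp}(\mu))\in\mathcal P_{++}\times\mathcal D_{++}$ is the central path point, $x^{\rm cp}_i(\mu)s^{\rm cp}_i(\mu)=\mu$ for all $i$, and $z^{\rm cp}(0)=\lim_{\mu\searrow0}z^{\rm cp}(\mu)$.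 For $0\le\mu_1\le\mu_0$ the segment $\mathrm{CP}[\mu_1,\mu_0]=\{z^{\rm cp}(\mu):\mu_1\le\mu\le\mu_0\}$ is $\gamma$-polarized with partition $B\cup N=[n]$ if for all $\mu\in[\mu_1,\mu_0]$: $x^{\rm cp}_i(\mu)\ge\gamma x_i^{\rm cp}(\mu_0)$ for $i\in B$ and $s^{\rm cp}_i(\mu)\ge\gamma s_i^{\rm cp}(\mu_0)$ for $i\in N$. **Algorithm (IPM with subspace LLS).** Fix $\beta\in(0,1/6]$ and $\tau=\beta/(16\sqrt n)$. For a subspace $X\subseteq\mathbb R^n$ and $I\subseteq[n]$, let $\pi_I$ be the coordinate projection, $\Pi$ orthogonal projection, $L_I^X(v)=\arg\min\{\|w\|:w\in X,\ w_I=\Pi_{\pi_I(X)}(v)\}$ and $\ell_I^X(v)=L_I^X(v)_{[n]\setminus I}$. While $\langle x,s\rangle>0$, one iteration at $z=(x,s)$ does the following, with $\mu=\overline\mu(z)$, $\xi=(xs/\mu)^{1/2}$, $\hat x=x\xi^{-1}$, $\hat s=s\xi^{-1}$. 1. Compute the affine scaling direction $\Delta^{\rm a}=(\Delta x^{\rm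 a},\Delta s^{\rm a})\in W\times W^\perp$, $s\Delta x^{\rm a}+x\Delta s^{\rm a}=-xs$, and choose any $\alpha^{\rm a}$ with $$\max\{\beta/\sqrt n,\ 1-\|\Delta x^{\rm a}\Delta s^{\rm a}\|/(\beta\mu)\}\ \le\ \alpha^{\rm a}\ \le\ \sup\{\alpha\in[0,1]: z+\alpha'\Delta^{\rm a}\in\mathcal N^2(2\beta)\ \forall\alpha'\in[0,\alpha]\}.$$ 2. Let $\tilde B=\{i:|\Delta x_i^{\rm a}/x_i|<|\Delta s_i^{\rm a}/s_i|\}$, $\tilde N=[n]\setminus\tilde B$. 3. For $(I,X)=(\tilde N,\hat x^{-1}W)$ and $(I,X)=(\tilde B,\hat s^{-1}W^\perp)$ let $M=\ell_I^X$, and let $V$ be an output of Approx-SVD on $M$. That is, start with $V$ the $|I|\times|I|$ identity matrix, and for $i=1,\dots,|I|$: replace the columns of $V$ by pairwise orthogonal ones with the same leading spans; replace the columns from the $i$-th on by pairwise $M$-orthogonal ones ($\langle Mv,Mv'\rangle=0$) with the same leading spans; swap a column among these that minimizes $\|Mv\|/\|v\|$ into position $i$. Let $j$ be the largest index with $\|MV_j\|/\|V_j\|\le\tau/n$,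 and intersect $\operatorname{im}(V_{\le j})$ ($\{0\}$ if there is no such $j$) with $\pi_I(X)$. This gives subspaces $\mathcal V\subseteq\mathbb R^{\tilde N}$ and $\mathcal U\subseteq\mathbb R^{\tilde B}$ respectively. 4. Let $\Delta x^\ell=\hat x\,L_{\tilde N}^{\hat x^{-1}W}(-\Pi_{\mathcal V}(\xi_{\tilde N}))$ and $\Delta s^\ell=\hat s\,L_{\tilde B}^{\hat s^{-1}W^\perp}(-\Pi_{\mathcal U}(\xi_{\tilde B}))$ (if $\tilde N=\emptyset$ take $(0,\Delta s^{\rm a})$, if $\tilde B=\emptyset$ take $(\Delta x^{\rm a},0)$). If $\|\Delta x^\ell\Delta s^\ell\|\le\beta\mu/4$ let $\alpha^\ell=\max\{0,\,1-\tfrac4\beta\|(x+\Delta x^\ell)(s+\Delta s^\ell)\|/\mu\}$, otherwise $\alpha^\ell=0$. 5. Let $z^+=z+\alpha^{\rm a}\Delta^{\rm a}$ if $\alpha^{\rm a}>\alpha^\ell$ and $z^+=z+\alpha^\ell\Delta^\ell$ otherwise. If $\overline\mu(z^+)=0$, the next iterate is $z^+$; if $\overline\mu(z^+)>0$, it is $z^++\Delta^{\rm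 c}$, where $\Delta^{\rm c}=(\Delta x^{\rm c},\Delta s^{\rm c})\in W\times W^\perp$ solves $s^+\Delta x^{\rm c}+x^+\Delta s^{\rm c}=\overline\mu(z^+)\mathbf 1-x^+s^+$. **Theorem.** For every constant $\beta\in(0,1/6]$ there is a constant $C>0$ (depending only on $\beta$) such that the following holds for every such linear program. Let $\gamma\in(0,1]$ with $n/\gamma\ge 2$ (automatic if $n\ge2$), let $T\in\mathbb N$ and $0\le\mu^{(T)}<\mu^{(T-1)}<\dots<\mu^{(0)}$, and suppose that for $1\le i\le T$ the segment $\mathrm{CP}[\mu^{(i)},\mu^{(i-1)}]$ is $\gamma$-polarized with partition $B^{(i)}\cup N^{(i)}=[n]$, where $N^{(0)}=\emptyset$ and $N^{(i)}\ne N^{(i-1)}$ for $1\le i\le T$. Then every execution of the algorithm from any $z^{(0)}\in\mathcal N^2(\beta)$ with $\overline\mu(z^{(0)})\le\mu^{(0)}$ is well defined and finds, within at most $$C\,\sqrt n\,\log(n/\gamma)\sum_{i=1}^T\bigl|N^{(i)}\,\Delta\,N^{(i-1)}\bigr|$$ iterations, a point $z$ with $\overline\mu(z)\le\mu^{(T)}$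 such that $z\in\overline{\mathcal N}^2(\beta)$, or $z\in\overline{\mathcal N}^2(2\beta)$ is an optimal primal-dual solution, i.e. $\overline\mu(z)=0$. -/

import Mathlib

open scoped Matrix Topology

noncomputable section

namespace SubspaceIPM

/-! ## Vectors, coordinate projections, rescalings -/

/-- Vectors of `ℝⁿ` with the Euclidean norm. -/
abbrev Vec (n : ℕ) := EuclideanSpace ℝ (Fin n)

/-- Vectors of `ℝ^I` for an index set `I ⊆ [n]`, with the Euclidean norm. -/
abbrev VecOn {n : ℕ} (I : Finset (Fin n)) := EuclideanSpace ℝ I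

/-- Primal-dual pairs `z = (x, s)`. -/
abbrev State (n : ℕ) := Vec n × Vec n

/-- The Hadamard product `x y`. -/
def had {n : ℕ} (x y : Vec n) : Vec n := WithLp.toLp 2 fun i => x i * y i

/-- The all-ones vector. -/
def ones (n : ℕ) : Vec n := WithLp.toLp 2 fun _ => 1

/-- The coordinate-wise inverse `x⁻¹`. -/
def vinv {n : ℕ} (x : Vec n) : Vec n := WithLp.toLp 2 fun i => (x i)⁻¹

/-- The linear map `w ↦ y w`. -/
def scale {n : ℕ} (y : Vec n) : Vec n →ₗ[ℝ] Vec n where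
  toFun w := had y w
  map_add' u v := by ext i; simp [had, mul_add]
  map_smul' r u := by ext i; simp [had]; ring

/-- The rescaled subspace `y W = {y w : w ∈ W}`. -/
def scaled {n : ℕ} (y : Vec n) (W : Submodule ℝ (Vec n)) : Submodule ℝ (Vec n) :=
  W.map (scale y)

/-- The coordinate projection `π_I : ℝⁿ → ℝ^I`. -/
def proj {n : ℕ} (I : Finset (Fin n)) : Vec n →ₗ[ℝ] VecOn I where
  toFun x := WithLp.toLp 2 fun i => x i
  map_add' u v := by ext i; simp
  map_smul' r u := by ext i; simp

/-- The subspace `π_I(W)` of `ℝ^I`. -/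
def projSub {n : ℕ} (I : Finset (Fin n)) (W : Submodule ℝ (Vec n)) : Submodule ℝ (VecOn I) :=
  W.map (proj I)

/-! ## Linear programs, neighbourhoods, the central path -/

/-- The data of the primal-dual pair
`min ⟨c,x⟩, A x = b, x ≥ 0` and `max ⟨b,y⟩, Aᵀ y + s = c, s ≥ 0`. -/
structure LP (m n : ℕ) where
  A : Matrix (Fin m) (Fin n) ℝ
  b : Fin m → ℝ
  c : Fin n → ℝ

/-- The normalized duality gap `⟨x, s⟩ / n`. -/
def gap {n : ℕ} (z : State n) : ℝ := (∑ i, z.1 i * z.2 i) / n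

namespace LP

variable {m n : ℕ} (P : LP m n)

/-- `W = ker A`. -/
def W : Submodule ℝ (Vec n) := LinearMap.ker (Matrix.toEuclideanLin P.A)

/-- Strictly feasible primal points. -/
def primalInt : Set (Vec n) := {x | P.A *ᵥ x.ofLp = P.b ∧ ∀ i, 0 < x i}

/-- Strictly feasible dual slacks. -/
def dualInt : Set (Vec n) := {s | (∃ y, P.Aᵀ *ᵥ y + s.ofLp = P.c) ∧ ∀ i, 0 < s i}

/-- The `ℓ₂`-neighbourhood `𝒩²(β)` of the central path. -/
def nbhd (β : ℝ) : Set (State n) :=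
  {z | z.1 ∈ P.primalInt ∧ z.2 ∈ P.dualInt ∧ ‖(gap z)⁻¹ • had z.1 z.2 - ones n‖ ≤ β}

/-- The defining equations of the central path point with parameter `μ > 0`. -/
def IsCentral (μ : ℝ) (z : State n) : Prop :=
  z.1 ∈ P.primalInt ∧ z.2 ∈ P.dualInt ∧ ∀ i, z.1 i * z.2 i = μ

/-- The central path point with parameter `μ > 0`: the (unique) solution of the defining
equations. -/
def cpPos (μ : ℝ) : State n := Classical.epsilon (P.IsCentral μ)

/-- The central path point with parameter `μ ≥ 0`; at `μ = 0` it is the limit for `μ ↘ 0`. -/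
def cp (μ : ℝ) : State n := if 0 < μ then P.cpPos μ else Filter.limUnder (𝓝[>] (0 : ℝ)) P.cpPos

/-- The segment `CP[μ₁, μ₀]` is `γ`-polarized with polarizing partition `(Nᶜ, N)`. -/
def IsPolarized (γ μ₁ μ₀ : ℝ) (N : Finset (Fin n)) : Prop :=
  ∀ μ ∈ Set.Icc μ₁ μ₀,
    (∀ i ∈ Nᶜ, γ * (P.cp μ₀).1 i ≤ (P.cp μ).1 i) ∧
    (∀ i ∈ N, γ * (P.cp μ₀).2 i ≤ (P.cp μ).2 i)

/-- `Δ = (Δx, Δs)` solves `Δx ∈ W`, `Δs ∈ W^⊥`, `s Δx + x Δs = ν μ 𝟏 - x s`, with `μ` the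
normalized gap of `z = (x, s)`. For `ν = 0` this is the affine scaling direction, for `ν = 1` the
centrality (corrector) direction. -/
def IsNewtonDir (ν : ℝ) (z Δ : State n) : Prop :=
  Δ.1 ∈ P.W ∧ Δ.2 ∈ P.Wᗮ ∧
    had z.2 Δ.1 + had z.1 Δ.2 = (ν * gap z) • ones n - had z.1 z.2

end LP

/-! ## The local scaling -/

/-- `ξ(z) = x^{1/2} s^{1/2} / μ(z)^{1/2}`. -/
def xi {n : ℕ} (z : State n) : Vec n :=
  WithLp.toLp 2 fun i => √(z.1 i) * √(z.2 i) / √(gap z)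

/-- `x̂ = x ξ⁻¹`. -/
def xhat {n : ℕ} (z : State n) : Vec n := had z.1 (vinv (xi z))

/-- `ŝ = s ξ⁻¹`. -/
def shat {n : ℕ} (z : State n) : Vec n := had z.2 (vinv (xi z))

/-! ## Lifting maps -/

/-- `w` is a minimum-norm point of `{w ∈ W : w_I = Π_{π_I(W)}(v)}`. -/
def IsMinNormLift {n : ℕ} (W : Submodule ℝ (Vec n)) (I : Finset (Fin n)) (v : VecOn I)
    (w : Vec n) : Prop :=
  (w ∈ W ∧ proj I w = (projSub I W).starProjection v) ∧
    ∀ w' ∈ W, proj I w' = (projSub I W).starProjection v → ‖w‖ ≤ ‖w'‖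

/-- The lifting map `L_I^W : ℝ^I → W`; the minimizer exists and is unique. -/
def liftFull {n : ℕ} (W : Submodule ℝ (Vec n)) (I : Finset (Fin n)) (v : VecOn I) : Vec n :=
  Classical.epsilon (IsMinNormLift W I v)

/-- The lifting map `ℓ_I^W : ℝ^I → ℝ^J`, `J = [n] ∖ I`. -/
def lift {n : ℕ} (W : Submodule ℝ (Vec n)) (I : Finset (Fin n)) (v : VecOn I) : VecOn Iᶜ :=
  proj Iᶜ (liftFull W I v)

/-! ## Approximate singular value decomposition -/

section ApproxSVD

variable {k : ℕ} {F G : Type*} [NormedAddCommGroup F] [InnerProductSpace ℝ F]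
  [NormedAddCommGroup G] [InnerProductSpace ℝ G]

/-- The columns of `V'` from the `i`-th on are a possible output of `Orthogonalize` for the map `M`
and the columns of `V` from the `i`-th on: leading spans agree and the columns are `M`-orthogonal.
The columns before the `i`-th are unchanged. Indices start at `0`. -/
def IsOrthogonalization (M : F → G) (i : ℕ) (V V' : Fin k → F) : Prop :=
  (∀ j : Fin k, (j : ℕ) < i → V' j = V j) ∧
  (∀ j : Fin k, i ≤ (j : ℕ) →
    Submodule.span ℝ (V' '' {l | i ≤ (l : ℕ) ∧ l ≤ j}) =
      Submodule.span ℝ (V '' {l | i ≤ (l : ℕ) ∧ l ≤ j})) ∧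
  (∀ j l : Fin k, i ≤ (j : ℕ) → i ≤ (l : ℕ) → j ≠ l → inner ℝ (M (V' j)) (M (V' l)) = 0)

/-- Round `i` of Approx-SVD turns the columns `V` into `V'`: orthogonalize all columns, make the
columns from the `i`-th on `M`-orthogonal, swap the column among these that minimizes
`‖M v‖ / ‖v‖` into position `i`. -/
def ApproxSVDRound (M : F → G) (i : Fin k) (V V' : Fin k → F) : Prop :=
  ∃ (V₁ V₂ : Fin k → F) (c : Fin k),
    IsOrthogonalization (id : F → F) 0 V V₁ ∧
    IsOrthogonalization M i V₁ V₂ ∧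
    i ≤ c ∧ (∀ j, i ≤ j → ‖M (V₂ c)‖ / ‖V₂ c‖ ≤ ‖M (V₂ j)‖ / ‖V₂ j‖) ∧
    V' = V₂ ∘ Equiv.swap i c

/-- `V` is a possible output of Approx-SVD for `M`, started at the columns `V₀`. -/
def IsApproxSVDFrom (M : F → G) (V₀ V : Fin k → F) : Prop :=
  ∃ S : ℕ → Fin k → F, S 0 = V₀ ∧
    (∀ i : Fin k, ApproxSVDRound M i (S i) (S (i + 1))) ∧ V = S k

/-- `im(V_{≤ i})` for the largest index `i` with `‖M(V_i)‖ / ‖V_i‖ ≤ t` (the zero space if there is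
no such index). -/
def cheapSpan (M : F → G) (V : Fin k → F) (t : ℝ) : Submodule ℝ F :=
  Submodule.span ℝ {v | ∃ l j : Fin k, l ≤ j ∧ ‖M (V j)‖ / ‖V j‖ ≤ t ∧ v = V l}

end ApproxSVD

/-- The columns of the identity matrix of `ℝ^I`. -/
def idCols {n : ℕ} (I : Finset (Fin n)) : Fin I.card → VecOn I := fun j =>
  EuclideanSpace.single (I.orderIsoOfFin rfl j) 1

/-- `V` is a possible output of Approx-SVD for a map `M` on `ℝ^I`. -/
def IsApproxSVD {n : ℕ} {I J : Finset (Fin n)} (M : VecOn I → VecOn J)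
    (V : Fin I.card → VecOn I) : Prop :=
  IsApproxSVDFrom M (idCols I) V

/-! ## The algorithm -/

/-- The threshold `τ = β / (16 √n)`. -/
def tau (β : ℝ) (n : ℕ) : ℝ := β / (16 * √n)

/-- The part `Ñ` of the associated partition: the complement of
`B̃ = {i : |Δxᵢ / xᵢ| < |Δsᵢ / sᵢ|}`, where `Δ` is the affine scaling direction at `z`. -/
def assocN {n : ℕ} (z Δ : State n) : Finset (Fin n) :=
  {i | ¬ |Δ.1 i / z.1 i| < |Δ.2 i / z.2 i|}

/-- The subspace `V` (primal) or `U` (dual) of the algorithm: the cheap span of the columns `V`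
for the lifting map `ℓ_I^{W}` at threshold `τ / n`, intersected with `π_I(W)`. Here `W` is the
rescaled subspace. -/
def cheapSub {n : ℕ} (β : ℝ) (W : Submodule ℝ (Vec n)) (I : Finset (Fin n))
    (V : Fin I.card → VecOn I) : Submodule ℝ (VecOn I) :=
  cheapSpan (lift W I) V (tau β n / n) ⊓ projSub I W

/-- The vector `δ = L_I^W(δ_I)` with `δ_I = argmin_{δ ∈ V} ‖ξ_I + δ‖ = - Π_V(ξ_I)`; since
`V ⊆ π_I(W)`, its coordinates are `δ_I` on `I` and `ℓ_I^W(δ_I)` off `I`. -/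
def llsDelta {n : ℕ} (W : Submodule ℝ (Vec n)) (I : Finset (Fin n)) (V : Submodule ℝ (VecOn I))
    (ξ : Vec n) : Vec n :=
  liftFull W I (-(V.starProjection (proj I ξ)))

/-- The length of the step along the direction `Δ` that the general step-length estimate
guarantees: if `‖Δx Δs‖ ≤ β μ / 4` it is `1 - 4 κ / β`, with `κ = ‖(x + Δx)(s + Δs)‖ / μ`, provided
that this is nonnegative; otherwise the estimate guarantees nothing and the length is `0`. -/
def llsStepLength {n : ℕ} (β : ℝ) (z Δ : State n) : ℝ :=
  if ‖had Δ.1 Δ.2‖ ≤ β * gap z / 4 then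
    max 0 (1 - 4 * (‖had (z.1 + Δ.1) (z.2 + Δ.2)‖ / gap z) / β)
  else 0

namespace LP

variable {m n : ℕ} (P : LP m n)

/-- `x̂⁻¹ W`. -/
def primalLocal (z : State n) : Submodule ℝ (Vec n) := scaled (vinv (xhat z)) P.W

/-- `ŝ⁻¹ W^⊥`. -/
def dualLocal (z : State n) : Submodule ℝ (Vec n) := scaled (vinv (shat z)) P.Wᗮ

/-- The subspace LLS direction at `z` for the partition `(Nᶜ, N)` and the subspaces `V ⊆ ℝ^N`,
`U ⊆ ℝ^{Nᶜ}`; `Δa` is the affine scaling direction at `z`, used if one part is empty. -/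
def llsDir (z Δa : State n) (N : Finset (Fin n)) (V : Submodule ℝ (VecOn N))
    (U : Submodule ℝ (VecOn Nᶜ)) : State n :=
  if N = ∅ then (0, Δa.2)
  else if Nᶜ = ∅ then (Δa.1, 0)
  else (had (xhat z) (llsDelta (P.primalLocal z) N V (xi z)),
    had (shat z) (llsDelta (P.dualLocal z) Nᶜ U (xi z)))

/-- `α` is an admissible step-length for the affine scaling direction `Δ` at `z`: it is at least the
guaranteed value `max {β/√n, 1 - ‖Δx Δs‖ / (β μ)}`, and at most the supremum of those `α ∈ [0, 1]`
for which the whole segment from `z` to `z + α Δ` lies in `𝒩²(2β)`. -/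
def IsAffineStepLength (β : ℝ) (z Δ : State n) (α : ℝ) : Prop :=
  max (β / √n) (1 - ‖had Δ.1 Δ.2‖ / (β * gap z)) ≤ α ∧ α ≤ 1 ∧
    ∀ α' ∈ Set.Ico 0 α, z + α' • Δ ∈ P.nbhd (2 * β)

/-- One iteration of the interior point method with subspace LLS steps turns `z` into `z'`.
An iteration is performed only if the duality gap of `z` is positive. The relation leaves open the
admissible affine step-length, the way `Orthogonalize` is implemented, and how ties are
broken in Approx-SVD. -/
def Step (β : ℝ) (z z' : State n) : Prop :=
  0 < gap z ∧
  ∃ (Δa : State n) (αa : ℝ), P.IsNewtonDir 0 z Δa ∧ P.IsAffineStepLength β z Δa αa ∧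
  ∃ (V : Fin (assocN z Δa).card → VecOn (assocN z Δa))
    (U : Fin (assocN z Δa)ᶜ.card → VecOn (assocN z Δa)ᶜ),
    IsApproxSVD (lift (P.primalLocal z) (assocN z Δa)) V ∧
    IsApproxSVD (lift (P.dualLocal z) (assocN z Δa)ᶜ) U ∧
  ∃ Δl : State n,
    Δl = P.llsDir z Δa (assocN z Δa)
      (cheapSub β (P.primalLocal z) (assocN z Δa) V)
      (cheapSub β (P.dualLocal z) (assocN z Δa)ᶜ U) ∧
  ∃ zp : State n,
    zp = (if llsStepLength β z Δl < αa then z + αa • Δa else z + llsStepLength β z Δl • Δl) ∧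
    ((0 < gap zp ∧ ∃ Δc, P.IsNewtonDir 1 zp Δc ∧ z' = zp + Δc) ∨ (¬ 0 < gap zp ∧ z' = zp))

end LP

/-- Every execution of the iteration `step` from a state reaches a state satisfying `goal`
within `K` iterations (and never gets stuck before). -/
def ReachesWithin {α : Type*} (step : α → α → Prop) (goal : α → Prop) : ℕ → α → Prop
  | 0, z => goal z
  | K + 1, z => goal z ∨
      ((∃ z', step z z') ∧ ∀ z', step z z' → ReachesWithin step goal K z')

end SubspaceIPM

end

open SubspaceIPM

/-! In the local coordinates given by `xhat z` and `shat z`, the primal and dual direction spaces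
become orthogonal complements. The quantity that governs progress is the cost of lifting: how large
the coordinates outside `N` must be when a vector of the projection to `N` is lifted to the rescaled
space, and dually for the complement of `N`.

On a polarized segment, near monotonicity (`LP.mul_le_gap_add_gap`) and polarization force the
primal scaling off `N` and the dual scaling on `N` to stay constant up to `distortion n γ`. Since
the two scalings multiply to the gap, the remaining parts shrink like the gap. Hence the singular
values of both lifting maps shrink in proportion to the gap, up to the squared distortion, so
expensive directions become cheap along a segment. The count of expensive directions `eCount` is
defined by a min-max dimension condition rather than by singular values. This makes it stable under
rescaling (`eCount_scaled_le`) and under a change of the partition (`eCount_le_add_card_symmDiff`).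

An output of Approx-SVD reflects the singular value structure up to polynomial factors
(`IsApproxSVDFrom.isSVDOutput`). If the count does not drop between the thresholds `tau β n / n ^ 2`
and `n * r`, every direction off the cheap subspace has cost of order at least `r`. Comparison with
the move to the central path point of parameter `max μ₁ (gap z / r)` then shows that the cheap
subspace contains a direction with tiny residual (`llsDelta_spec`, `exists_primal_target`,
`exists_dual_target`). Such a direction is close to the affine scaling direction, so the algorithm
detects the polarizing partition by itself (`assocN_eq`), and one iteration brings the gap down to
that parameter up to a polynomial factor (`gap_le_of_stable`).

Taking the first dyadic `r` at which the count does drop gives `progress`: far from the end of the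
segment, an iteration either comes near the end or reduces the gap so much that an expensive
direction is about to become cheap. A block of order `√n * log (n / γ)` further iterations, each
with the guaranteed decrease, absorbs all polynomial factors. A block is thus charged to an
expensive direction that becomes cheap, or to a change of segment. For the empty `N` nothing is
expensive, and a change of the partition creates at most twice the size of the symmetric difference.
The accounting is the induction `reachesWithin_goal`. -/

noncomputable section

namespace SubspaceIPM

/-! ### Approximate singular value decompositions of an abstract linear map. -/

section SVD

variable {k : ℕ} {F G : Type*} [NormedAddCommGroup F] [InnerProductSpace ℝ F]
  [NormedAddCommGroup G] [InnerProductSpace ℝ G]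

/-- The span of the columns with index less than `j`. -/
def flag (V : Fin k → F) (j : ℕ) : Submodule ℝ F :=
  Submodule.span ℝ (V '' {l | (l : ℕ) < j})

/-- The span of the columns with index at least `j`. -/
def coflag (V : Fin k → F) (j : ℕ) : Submodule ℝ F :=
  Submodule.span ℝ (V '' {l | j ≤ (l : ℕ)})

lemma flag_mono (V : Fin k → F) {i j : ℕ} (h : i ≤ j) : flag V i ≤ flag V j :=
  Submodule.span_mono (Set.image_mono fun _ hl => lt_of_lt_of_le hl h)

lemma mem_flag (V : Fin k → F) {l : Fin k} {j : ℕ} (h : (l : ℕ) < j) : V l ∈ flag V j :=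
  Submodule.subset_span ⟨l, h, rfl⟩

lemma mem_coflag (V : Fin k → F) {l : Fin k} {j : ℕ} (h : j ≤ (l : ℕ)) : V l ∈ coflag V j :=
  Submodule.subset_span ⟨l, h, rfl⟩

lemma flag_eq_span_range (V : Fin k → F) {j : ℕ} (h : k ≤ j) :
    flag V j = Submodule.span ℝ (Set.range V) := by
  unfold flag
  rw [← Set.image_univ]
  congr 2
  ext l
  simpa using lt_of_lt_of_le l.2 h

lemma flag_sup_coflag (V : Fin k → F) (j : ℕ) :
    flag V j ⊔ coflag V j = Submodule.span ℝ (Set.range V) := by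
  unfold flag coflag
  rw [← Submodule.span_union, ← Set.image_union, ← Set.image_univ]
  congr 2
  ext l
  simpa using lt_or_ge (l : ℕ) j

lemma flag_succ (V : Fin k → F) (j : Fin k) :
    flag V (j + 1) = flag V j ⊔ Submodule.span ℝ {V j} := by
  unfold flag
  rw [← Submodule.span_union, ← Set.image_singleton, ← Set.image_union]
  congr 2
  ext l
  simp only [Set.mem_ofPred_eq, Set.mem_union, Set.mem_singleton_iff, Fin.ext_iff]
  omega

lemma flag_congr {V V' : Fin k → F} {j : ℕ} (h : ∀ l : Fin k, (l : ℕ) < j → V' l = V l) :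
    flag V' j = flag V j := by
  unfold flag
  congr 1
  exact Set.image_congr fun l hl => h l hl

lemma inner_flag_eq_zero {V : Fin k → F} {j : ℕ} {u v : F} (hu : u ∈ flag V j)
    (h : ∀ l : Fin k, (l : ℕ) < j → inner ℝ (V l) v = 0) : inner ℝ u v = 0 := by
  have : flag V j ≤ (Submodule.span ℝ {v})ᗮ := by
    refine Submodule.span_le.2 ?_
    rintro _ ⟨l, hl, rfl⟩
    rw [SetLike.mem_coe, Submodule.mem_orthogonal_singleton_iff_inner_left]
    exact h l hl
  exact (Submodule.mem_orthogonal_singleton_iff_inner_left).1 (this hu)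

lemma inner_coflag_eq_zero {V : Fin k → F} {j : ℕ} {u v : F} (hu : u ∈ coflag V j)
    (h : ∀ l : Fin k, j ≤ (l : ℕ) → inner ℝ (V l) v = 0) : inner ℝ u v = 0 := by
  have : coflag V j ≤ (Submodule.span ℝ {v})ᗮ := by
    refine Submodule.span_le.2 ?_
    rintro _ ⟨l, hl, rfl⟩
    rw [SetLike.mem_coe, Submodule.mem_orthogonal_singleton_iff_inner_left]
    exact h l hl
  exact (Submodule.mem_orthogonal_singleton_iff_inner_left).1 (this hu)

lemma IsOrthogonalization.flag_eq {M : F → G} {V V' : Fin k → F}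
    (h : IsOrthogonalization M 0 V V') (j : ℕ) (hj : j ≤ k) : flag V' j = flag V j := by
  rcases Nat.eq_zero_or_pos j with rfl | hj0
  · simp [flag]
  · have := h.2.1 ⟨j - 1, by omega⟩ (by simp)
    have e : {l : Fin k | 0 ≤ (l : ℕ) ∧ l ≤ ⟨j - 1, by omega⟩} = {l : Fin k | (l : ℕ) < j} := by
      ext l
      simp only [Set.mem_ofPred_eq, Fin.le_def]
      omega
    rw [e] at this
    exact this

lemma IsOrthogonalization.coflag_eq {M : F → G} {i : ℕ} {V V' : Fin k → F}
    (h : IsOrthogonalization M i V V') : coflag V' i = coflag V i := by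
  rcases lt_or_ge i k with hi | hi
  · have := h.2.1 ⟨k - 1, by omega⟩ (by simp; omega)
    have e : {l : Fin k | i ≤ (l : ℕ) ∧ l ≤ ⟨k - 1, by omega⟩} = {l : Fin k | i ≤ (l : ℕ)} := by
      ext l
      simp only [Set.mem_ofPred_eq, Fin.le_def]
      omega
    rw [e] at this
    exact this
  · have e : {l : Fin k | i ≤ (l : ℕ)} = ∅ := by
      ext l
      simp only [Set.mem_ofPred_eq, Set.mem_empty_iff_false, iff_false]
      omega
    simp [coflag, e]

lemma IsOrthogonalization.span_range {M : F → G} {i : ℕ} {V V' : Fin k → F}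
    (h : IsOrthogonalization M i V V') :
    Submodule.span ℝ (Set.range V') = Submodule.span ℝ (Set.range V) := by
  rw [← flag_sup_coflag V' i, ← flag_sup_coflag V i, h.coflag_eq, flag_congr h.1]

lemma ne_zero_of_span_eq_top [FiniteDimensional ℝ F] (hk : Module.finrank ℝ F = k)
    {V : Fin k → F} (h : Submodule.span ℝ (Set.range V) = ⊤) (j : Fin k) : V j ≠ 0 :=
  (linearIndependent_of_top_le_span_of_card_eq_finrank h.ge (by simp [hk])).ne_zero j

lemma finrank_flag [FiniteDimensional ℝ F] (hk : Module.finrank ℝ F = k)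
    {V : Fin k → F} (h : Submodule.span ℝ (Set.range V) = ⊤) {j : ℕ} (hj : j ≤ k) :
    Module.finrank ℝ (flag V j) = j := by
  have hli : LinearIndependent ℝ V :=
    linearIndependent_of_top_le_span_of_card_eq_finrank h.ge (by simp [hk])
  have hcast : flag V j = Submodule.span ℝ (Set.range (V ∘ Fin.castLE hj)) := by
    unfold flag
    congr 1
    ext x
    constructor
    · rintro ⟨l, hl, rfl⟩
      exact ⟨⟨l, hl⟩, rfl⟩
    · rintro ⟨l, rfl⟩
      exact ⟨Fin.castLE hj l, l.2, rfl⟩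
  rw [hcast, finrank_span_eq_card (hli.comp _ (Fin.castLE_injective hj))]
  simp

/-- A family that is orthogonal for the semi-inner product `⟨M u, M v⟩` and on which
`ρ ‖v‖ ≤ ‖M v‖`: the inequality persists on the span up to the square root of the number of
vectors. -/
lemma ratio_le_of_orthogonal (M : F →ₗ[ℝ] G) (s : Finset (Fin k)) (V : Fin k → F) (a : Fin k → ℝ)
    (ρ : ℝ) (hρ : 0 ≤ ρ) (hV : ∀ j ∈ s, ρ * ‖V j‖ ≤ ‖M (V j)‖)
    (horth : ∀ j ∈ s, ∀ l ∈ s, j ≠ l → inner ℝ (M (V j)) (M (V l)) = 0) :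
    ρ * ‖∑ j ∈ s, a j • V j‖ ≤ √k * ‖M (∑ j ∈ s, a j • V j)‖ := by
  have h1 : ‖M (∑ j ∈ s, a j • V j)‖ ^ 2 = ∑ j ∈ s, (|a j| * ‖M (V j)‖) ^ 2 := by
    rw [map_sum, ← real_inner_self_eq_norm_sq, sum_inner]
    refine Finset.sum_congr rfl fun j hj => ?_
    rw [inner_sum, Finset.sum_eq_single j]
    · rw [map_smul, inner_smul_left, inner_smul_right, real_inner_self_eq_norm_sq, mul_pow, sq_abs]
      simp
      ring
    · intro l hl hlj
      rw [map_smul, map_smul, inner_smul_left, inner_smul_right, horth j hj l hl hlj.symm]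
      simp
    · exact fun h => absurd hj h
  have h2 : ρ * ‖∑ j ∈ s, a j • V j‖ ≤ ∑ j ∈ s, |a j| * ‖M (V j)‖ := by
    calc ρ * ‖∑ j ∈ s, a j • V j‖ ≤ ρ * ∑ j ∈ s, ‖a j • V j‖ := by
          gcongr
          exact norm_sum_le _ _
      _ = ∑ j ∈ s, |a j| * (ρ * ‖V j‖) := by
          rw [Finset.mul_sum]
          refine Finset.sum_congr rfl fun j _ => ?_
          rw [norm_smul, Real.norm_eq_abs]
          ring
      _ ≤ _ := Finset.sum_le_sum fun j hj => mul_le_mul_of_nonneg_left (hV j hj) (abs_nonneg _)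
  -- Cauchy-Schwarz over at most `k` terms; this is where the factor `√k` comes from.
  have h3 : (∑ j ∈ s, |a j| * ‖M (V j)‖) ^ 2 ≤ k * ‖M (∑ j ∈ s, a j • V j)‖ ^ 2 := by
    rw [h1]
    refine (sq_sum_le_card_mul_sum_sq).trans ?_
    refine mul_le_mul_of_nonneg_right ?_ (Finset.sum_nonneg fun j _ => sq_nonneg _)
    have := s.card_le_univ
    simp only [Fintype.card_fin] at this
    exact_mod_cast this
  refine h2.trans ?_
  refine Real.le_sqrt_of_sq_le h3 |>.trans_eq ?_
  rw [Real.sqrt_mul (by positivity), Real.sqrt_sq (norm_nonneg _)]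

lemma exists_sum_of_mem_span_image {V : Fin k → F} {s : Finset (Fin k)} {v : F}
    (hv : v ∈ Submodule.span ℝ (V '' (s : Set (Fin k)))) :
    ∃ a : Fin k → ℝ, v = ∑ j ∈ s, a j • V j := by
  classical
  rw [Submodule.mem_span_image_finset_iff_exists_fun] at hv
  obtain ⟨c, hc⟩ := hv
  refine ⟨fun j => if h : j ∈ s then c ⟨j, h⟩ else 0, ?_⟩
  rw [← hc, ← Finset.sum_coe_sort s]
  exact Finset.sum_congr rfl fun j _ => by simp

lemma exists_sum_of_mem_coflag {V : Fin k → F} {i : ℕ} {v : F} (hv : v ∈ coflag V i) :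
    ∃ a : Fin k → ℝ, v = ∑ j ∈ Finset.univ.filter (fun j : Fin k => i ≤ (j : ℕ)), a j • V j := by
  have : coflag V i = Submodule.span ℝ
      (V '' ((Finset.univ.filter (fun j : Fin k => i ≤ (j : ℕ)) : Finset (Fin k)) : Set (Fin k))) := by
    simp [coflag]
  rw [this] at hv
  exact exists_sum_of_mem_span_image hv

/-- After the full orthogonalization, the columns from `i` on span the orthogonal complement of the
first `i` columns, and `M`-orthogonalizing and swapping them stays inside this complement. The
selected column has the least ratio of an `M`-orthogonal basis of the complement, hence the least
ratio on the whole complement up to `√k`. -/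
lemma ApproxSVDRound.spec [FiniteDimensional ℝ F] (hk : Module.finrank ℝ F = k) (M : F →ₗ[ℝ] G)
    {i : Fin k} {V V' : Fin k → F} (h : ApproxSVDRound M i V V')
    (hV : Submodule.span ℝ (Set.range V) = ⊤) :
    Submodule.span ℝ (Set.range V') = ⊤ ∧
    (∀ j : ℕ, j ≤ i → flag V' j = flag V j) ∧
    (∀ u ∈ flag V i, inner ℝ u (V' i) = 0) ∧
    (∀ v, (∀ u ∈ flag V i, inner ℝ u v = 0) → ‖M (V' i)‖ / ‖V' i‖ * ‖v‖ ≤ √k * ‖M v‖) ∧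
    (∀ j l, j < i → l < i → j ≠ l → inner ℝ (V' j) (V' l) = 0) := by
  obtain ⟨V₁, V₂, c, h1, h2, hic, hmin, rfl⟩ := h
  have hs1 : Submodule.span ℝ (Set.range V₁) = ⊤ := h1.span_range.trans hV
  have hs2 : Submodule.span ℝ (Set.range V₂) = ⊤ := h2.span_range.trans hs1
  have hlow : ∀ j : Fin k, j < i → (V₂ ∘ Equiv.swap i c) j = V₁ j := by
    intro j hj
    rw [Function.comp_apply, Equiv.swap_apply_of_ne_of_ne hj.ne (hj.trans_le hic).ne]
    exact h2.1 j hj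
  have hi : (V₂ ∘ Equiv.swap i c) i = V₂ c := by simp
  have hflag1 : ∀ j : ℕ, j ≤ i → flag V₁ j = flag V j := fun j hj =>
    h1.flag_eq j (hj.trans i.2.le)
  have horth1 : ∀ u ∈ flag V₁ i, ∀ w ∈ coflag V₁ i, inner ℝ u w = 0 := by
    intro u hu w hw
    refine inner_flag_eq_zero hu fun l hl => ?_
    rw [real_inner_comm]
    refine inner_coflag_eq_zero hw fun l' hl' => ?_
    have := h1.2.2 l' l (Nat.zero_le _) (Nat.zero_le _) (by
      intro e
      rw [e] at hl'
      exact absurd hl (not_lt.2 hl'))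
    simpa using this
  refine ⟨?_, ?_, ?_, ?_, ?_⟩
  · rw [Set.range_comp, (Equiv.swap i c).surjective.range_eq, Set.image_univ, hs2]
  · intro j hj
    rw [← hflag1 j hj]
    exact flag_congr fun l hl => hlow l (Fin.lt_def.2 (hl.trans_le hj))
  · intro u hu
    rw [hi]
    rw [← hflag1 i le_rfl] at hu
    refine horth1 u hu _ ?_
    rw [← h2.coflag_eq]
    exact mem_coflag _ hic
  · intro v hv
    rw [hi]
    rw [← hflag1 i le_rfl] at hv
    -- The component of `v` in the first span is orthogonal to itself, hence zero.
    have hv2 : v ∈ coflag V₂ i := by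
      rw [h2.coflag_eq]
      have : v ∈ flag V₁ i ⊔ coflag V₁ i := by
        rw [flag_sup_coflag, hs1]
        trivial
      obtain ⟨f, hf, w, hw, rfl⟩ := Submodule.mem_sup.1 this
      have : inner ℝ f f = 0 := by
        have := hv f hf
        rwa [inner_add_right, horth1 f hf w hw, add_zero] at this
      rw [inner_self_eq_zero.1 this, zero_add]
      exact hw
    obtain ⟨a, rfl⟩ := exists_sum_of_mem_coflag hv2
    refine ratio_le_of_orthogonal M _ V₂ a _ (by positivity) ?_ ?_
    · intro j hj
      have hj' : i ≤ j := (Finset.mem_filter.1 hj).2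
      have := hmin j hj'
      rwa [← le_div_iff₀ (norm_pos_iff.2 (ne_zero_of_span_eq_top hk hs2 j))]
    · intro j hj l hl hjl
      exact h2.2.2 j l (Finset.mem_filter.1 hj).2 (Finset.mem_filter.1 hl).2 hjl
  · intro j l hj hl hjl
    rw [hlow j hj, hlow l hl]
    simpa using h1.2.2 j l (Nat.zero_le _) (Nat.zero_le _) hjl

/-- The two properties of an output of Approx-SVD that the analysis uses. -/
structure IsSVDOutput (M : F →ₗ[ℝ] G) (V : Fin k → F) : Prop where
  span_eq_top : Submodule.span ℝ (Set.range V) = ⊤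
  orthogonal : ∀ j l, j ≠ l → inner ℝ (V j) (V l) = 0
  ratio_le : ∀ (j : Fin k) (v : F), (∀ l < j, inner ℝ (V l) v = 0) →
    ‖M (V j)‖ / ‖V j‖ * ‖v‖ ≤ √k * ‖M v‖

/-- Later rounds change the column chosen in round `j`, but they keep the leading spans. Both the
chosen and the final column lie in the span of the first `j + 1` columns, orthogonally to the first
`j`, so they are proportional. The ratio is invariant under scaling. -/
lemma IsApproxSVDFrom.isSVDOutput [FiniteDimensional ℝ F] (hk : Module.finrank ℝ F = k)
    (M : F →ₗ[ℝ] G) {V₀ V : Fin k → F} (hV₀ : Submodule.span ℝ (Set.range V₀) = ⊤)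
    (h : IsApproxSVDFrom M V₀ V) : IsSVDOutput M V := by
  obtain ⟨S, rfl, hS, rfl⟩ := h
  have hspan : ∀ m ≤ k, Submodule.span ℝ (Set.range (S m)) = ⊤ := by
    intro m
    induction m with
    | zero => exact fun _ => hV₀
    | succ m ih =>
      intro hm
      exact ((hS ⟨m, hm⟩).spec hk M (ih (by omega))).1
  have hspec := fun i : Fin k => (hS i).spec hk M (hspan i i.2.le)
  have hflag : ∀ m j : ℕ, j ≤ m → m ≤ k → flag (S m) j = flag (S j) j := by
    intro m j hjm
    induction m, hjm using Nat.le_induction with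
    | base => exact fun _ => rfl
    | succ m hjm ih =>
      intro hm
      rw [← ih (by omega)]
      exact (hspec ⟨m, hm⟩).2.1 j hjm
  have horth : ∀ j l, j ≠ l → inner ℝ (S k j) (S k l) = 0 := by
    -- The last round orthogonalizes everything first; only the last column is then touched, and it
    -- stays orthogonal to the others.
    have key : ∀ j l : Fin k, j < l → inner ℝ (S k j) (S k l) = 0 := by
      intro j l hjl
      obtain ⟨k', rfl⟩ : ∃ k', k = k' + 1 := ⟨k - 1, by have := j.2; omega⟩
      obtain ⟨_, hfl, h3, _, h5⟩ := hspec (Fin.last k')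
      simp only [Fin.val_last] at hfl h3 h5
      rcases eq_or_ne l (Fin.last k') with rfl | hl
      · refine h3 _ ?_
        rw [← hfl k' le_rfl]
        exact mem_flag _ (by simpa [Fin.lt_def] using hjl)
      · have hl' := lt_of_le_of_ne (Fin.le_last l) hl
        exact h5 j l (hjl.trans hl') hl' hjl.ne
    intro j l hjl
    rcases lt_or_gt_of_ne hjl with h | h
    · exact key j l h
    · rw [real_inner_comm]
      exact key l j h
  refine ⟨hspan k le_rfl, horth, ?_⟩
  intro j v hv
  obtain ⟨-, -, h3, h4, -⟩ := hspec j
  set a := S (j + 1) j with ha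
  have ha0 : a ≠ 0 := ne_zero_of_span_eq_top hk (hspan (j + 1) j.2) j
  have hmem : a ∈ flag (S k) (j + 1) := by
    rw [hflag k (j + 1) j.2 le_rfl]
    exact mem_flag _ (Nat.lt_succ_self _)
  have hfj : flag (S k) j = flag (S j) j := hflag k j j.2.le le_rfl
  rw [← hfj] at h3 h4
  rw [flag_succ] at hmem
  obtain ⟨f, hf, w, hw, hfw⟩ := Submodule.mem_sup.1 hmem
  obtain ⟨r, rfl⟩ := Submodule.mem_span_singleton.1 hw
  have hf0 : f = 0 := by
    have e1 := h3 f hf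
    have e2 : inner ℝ f (S k j) = 0 := inner_flag_eq_zero hf fun l hl => horth l j (by
      rintro rfl
      exact lt_irrefl _ hl)
    rw [← hfw, inner_add_right, inner_smul_right, e2, mul_zero, add_zero] at e1
    exact inner_self_eq_zero.1 e1
  rw [hf0, zero_add] at hfw
  have hr : r ≠ 0 := by
    rintro rfl
    rw [zero_smul] at hfw
    exact ha0 hfw.symm
  have hratio : ‖M a‖ / ‖a‖ = ‖M (S k j)‖ / ‖S k j‖ := by
    rw [← hfw, map_smul, norm_smul, norm_smul, mul_div_mul_left _ _ (norm_ne_zero_iff.2 hr)]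
  rw [← hratio]
  exact h4 v fun u hu => inner_flag_eq_zero hu fun l hl => hv l hl

/-! ### Existence of an output -/

lemma exists_isOrthogonalization (M : F →ₗ[ℝ] G) (i : ℕ) (V : Fin k → F) :
    ∃ V', IsOrthogonalization M i V V' := by
  suffices H : ∀ p ≤ k, ∃ V' : Fin k → F, (∀ j : Fin k, (j : ℕ) < i ∨ p ≤ j → V' j = V j) ∧
      (∀ j : Fin k, i ≤ (j : ℕ) → (j : ℕ) < p →
        Submodule.span ℝ (V' '' {l | i ≤ (l : ℕ) ∧ l ≤ j}) =
          Submodule.span ℝ (V '' {l | i ≤ (l : ℕ) ∧ l ≤ j})) ∧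
      (∀ j l : Fin k, i ≤ (j : ℕ) → j < l → (l : ℕ) < p →
        inner ℝ (M (V' j)) (M (V' l)) = 0) by
    obtain ⟨V', h1, h2, h3⟩ := H k le_rfl
    refine ⟨V', fun j hj => h1 j (Or.inl hj), fun j hj => h2 j hj j.2, fun j l hj hl hjl => ?_⟩
    rcases lt_or_gt_of_ne hjl with h | h
    · exact h3 j l hj h l.2
    · rw [real_inner_comm]
      exact h3 l j hl h j.2
  intro p
  induction p with
  | zero => exact fun _ => ⟨V, by simp, by simp, by simp⟩
  | succ p ih =>
    intro hp
    obtain ⟨V', h1, h2, h3⟩ := ih (by omega)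
    rcases lt_or_ge p i with hpi | hpi
    · refine ⟨V', fun j hj => ?_, fun j hj hj' => ?_, fun j l hj hjl hl => ?_⟩
      · rcases hj with hj | hj
        · exact h1 j (Or.inl hj)
        · exact h1 j (Or.inr (by omega))
      · omega
      · have : (j : ℕ) < l := hjl
        omega
    set P : Fin k := ⟨p, hp⟩ with hP
    set s : Finset (Fin k) := Finset.univ.filter fun l : Fin k => i ≤ (l : ℕ) ∧ (l : ℕ) < p with hs
    -- Gram-Schmidt for the semi-inner product induced by `M`. If `M (V' l) = 0`, the quotient has
    -- the default value `0`, and nothing needs to be subtracted.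
    set w : F := V P - ∑ l ∈ s, (inner ℝ (M (V' l)) (M (V P)) / ‖M (V' l)‖ ^ 2) • V' l with hw
    have hup : ∀ j : Fin k, (j : ℕ) ≠ p → Function.update V' P w j = V' j := fun j hj =>
      Function.update_of_ne (fun e => hj (by rw [e])) _ _
    have hupP : Function.update V' P w P = w := Function.update_self _ _ _
    have hsub : ∀ j : Fin k, (j : ℕ) < p →
        Function.update V' P w '' {l | i ≤ (l : ℕ) ∧ l ≤ j} = V' '' {l | i ≤ (l : ℕ) ∧ l ≤ j} := by
      intro j hj
      refine Set.image_congr fun l hl => hup l ?_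
      have : (l : ℕ) ≤ j := hl.2
      omega
    refine ⟨Function.update V' P w, ?_, ?_, ?_⟩
    · intro j hj
      rw [hup j (by omega)]
      exact h1 j (by omega)
    · intro j hj hjp
      rcases lt_or_eq_of_le (Nat.lt_succ_iff.1 hjp) with hlt | heq
      · rw [hsub j hlt]
        exact h2 j hj hlt
      · have hjP : j = P := Fin.ext heq
        subst hjP
        have hset : {l : Fin k | i ≤ (l : ℕ) ∧ l ≤ P} =
            {l : Fin k | i ≤ (l : ℕ) ∧ (l : ℕ) < p} ∪ {P} := by
          ext l
          simp only [Set.mem_ofPred_eq, Set.mem_union, Set.mem_singleton_iff, Fin.ext_iff,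
            Fin.le_def, hP]
          omega
        have hA : Submodule.span ℝ (V' '' {l : Fin k | i ≤ (l : ℕ) ∧ (l : ℕ) < p}) =
            Submodule.span ℝ (V '' {l : Fin k | i ≤ (l : ℕ) ∧ (l : ℕ) < p}) := by
          rcases eq_or_lt_of_le hpi with e | hlt
          · have : {l : Fin k | i ≤ (l : ℕ) ∧ (l : ℕ) < p} = ∅ := by
              ext l
              simp only [Set.mem_ofPred_eq, Set.mem_empty_iff_false, iff_false]
              omega
            rw [this]
            simp
          · have := h2 ⟨p - 1, by omega⟩ (by simp; omega) (by simp; omega)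
            have e : {l : Fin k | i ≤ (l : ℕ) ∧ l ≤ ⟨p - 1, by omega⟩} =
                {l : Fin k | i ≤ (l : ℕ) ∧ (l : ℕ) < p} := by
              ext l
              simp only [Set.mem_ofPred_eq, Fin.le_def]
              omega
            rwa [e] at this
        have hB : Function.update V' P w '' {l : Fin k | i ≤ (l : ℕ) ∧ (l : ℕ) < p} =
            V' '' {l : Fin k | i ≤ (l : ℕ) ∧ (l : ℕ) < p} :=
          Set.image_congr fun l hl => hup l (by have := hl.2; omega)
        rw [hset, Set.image_union, Set.image_union, Submodule.span_union, Submodule.span_union,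
          Set.image_singleton, Set.image_singleton, hupP, hB, ← hA]
        have hsum : ∑ l ∈ s, (inner ℝ (M (V' l)) (M (V P)) / ‖M (V' l)‖ ^ 2) • V' l ∈
            Submodule.span ℝ (V' '' {l : Fin k | i ≤ (l : ℕ) ∧ (l : ℕ) < p}) := by
          refine Submodule.sum_mem _ fun l hl => Submodule.smul_mem _ _ (Submodule.subset_span ?_)
          exact ⟨l, (Finset.mem_filter.1 hl).2, rfl⟩
        refine le_antisymm (sup_le le_sup_left ?_) (sup_le le_sup_left ?_)
        · rw [Submodule.span_singleton_le_iff_mem, hw]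
          exact Submodule.sub_mem _ (Submodule.mem_sup_right (Submodule.mem_span_singleton_self _))
            (Submodule.mem_sup_left hsum)
        · rw [Submodule.span_singleton_le_iff_mem]
          have : V P = w + ∑ l ∈ s, (inner ℝ (M (V' l)) (M (V P)) / ‖M (V' l)‖ ^ 2) • V' l := by
            rw [hw]
            abel
          rw [this]
          exact Submodule.add_mem _ (Submodule.mem_sup_right (Submodule.mem_span_singleton_self _))
            (Submodule.mem_sup_left hsum)
    · intro j l hj hjl hl
      have hjl' : (j : ℕ) < l := hjl
      rw [hup j (by omega)]
      rcases lt_or_eq_of_le (Nat.lt_succ_iff.1 hl) with hlt | heq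
      · rw [hup l (by omega)]
        exact h3 j l hj hjl hlt
      · have hlP : l = P := Fin.ext heq
        subst hlP
        rw [hupP, hw, map_sub, map_sum, inner_sub_right, inner_sum, Finset.sum_eq_single j]
        · rw [map_smul, inner_smul_right, real_inner_self_eq_norm_sq]
          rcases eq_or_ne (M (V' j)) 0 with h0 | h0
          · simp [h0]
          · rw [div_mul_cancel₀ _ (pow_ne_zero 2 (norm_ne_zero_iff.2 h0)), sub_self]
        · intro l' hl' hne
          have hl'' := (Finset.mem_filter.1 hl').2
          rw [map_smul, inner_smul_right]
          have : inner ℝ (M (V' j)) (M (V' l')) = 0 := by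
            rcases lt_or_gt_of_ne hne with h | h
            · rw [real_inner_comm]
              exact h3 l' j hl''.1 h (by omega)
            · exact h3 j l' hj h hl''.2
          rw [this, mul_zero]
        · intro hn
          exact absurd (Finset.mem_filter.2 ⟨Finset.mem_univ _, hj, by omega⟩) hn

lemma exists_approxSVDRound (M : F →ₗ[ℝ] G) (i : Fin k) (V : Fin k → F) :
    ∃ V', ApproxSVDRound M i V V' := by
  obtain ⟨V₁, h1⟩ := exists_isOrthogonalization (LinearMap.id : F →ₗ[ℝ] F) 0 V
  obtain ⟨V₂, h2⟩ := exists_isOrthogonalization M i V₁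
  obtain ⟨c, hc, hmin⟩ := Finset.exists_min_image (Finset.Ici i)
    (fun j => ‖M (V₂ j)‖ / ‖V₂ j‖) ⟨i, Finset.mem_Ici.2 le_rfl⟩
  exact ⟨_, V₁, V₂, c, h1, h2, Finset.mem_Ici.1 hc, fun j hj => hmin j (Finset.mem_Ici.2 hj), rfl⟩

lemma exists_isApproxSVDFrom (M : F →ₗ[ℝ] G) (V₀ : Fin k → F) :
    ∃ V, IsApproxSVDFrom M V₀ V := by
  choose f hf using exists_approxSVDRound (k := k) M
  refine ⟨_, fun m => Nat.rec V₀ (fun m W => if h : m < k then f ⟨m, h⟩ W else W) m, rfl, ?_, rfl⟩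
  intro i
  simp only [i.2, dif_pos]
  exact hf i _

/-! ### The cheap span -/

-- The ratios need not increase with the index, so `d` is one past the last index with ratio at most
-- `t`. An earlier column is only known to have some cheap column at or after it.
omit [InnerProductSpace ℝ G] in
lemma cheapSpan_eq_flag (M : F → G) (V : Fin k → F) (t : ℝ) :
    ∃ d ≤ k, cheapSpan M V t = flag V d ∧ (∀ j : Fin k, d ≤ j → t < ‖M (V j)‖ / ‖V j‖) ∧
      ∀ l : Fin k, (l : ℕ) < d → ∃ j, l ≤ j ∧ ‖M (V j)‖ / ‖V j‖ ≤ t := by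
  classical
  by_cases hex : ∃ j : Fin k, ‖M (V j)‖ / ‖V j‖ ≤ t
  · obtain ⟨j, hj⟩ := hex
    obtain ⟨p, hp, hmax⟩ := Finset.exists_max_image
      (Finset.univ.filter fun j : Fin k => ‖M (V j)‖ / ‖V j‖ ≤ t) id ⟨j, by simpa using hj⟩
    simp only [Finset.mem_filter, Finset.mem_univ, true_and, id] at hp hmax
    refine ⟨p + 1, p.2, ?_, ?_, ?_⟩
    · unfold cheapSpan flag
      congr 1
      ext v
      constructor
      · rintro ⟨l, j, hlj, hj, rfl⟩
        exact ⟨l, Nat.lt_succ_of_le (Fin.le_def.1 (hlj.trans (hmax j hj))), rfl⟩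
      · rintro ⟨l, hl, rfl⟩
        exact ⟨l, p, Fin.le_def.2 (Nat.lt_succ_iff.1 hl), hp, rfl⟩
    · intro j hj
      by_contra hcon
      have := Fin.le_def.1 (hmax j (not_lt.1 hcon))
      omega
    · intro l hl
      exact ⟨p, Fin.le_def.2 (Nat.lt_succ_iff.1 hl), hp⟩
  · push Not at hex
    refine ⟨0, Nat.zero_le _, ?_, fun j _ => hex j, by simp⟩
    have : {v | ∃ l j : Fin k, l ≤ j ∧ ‖M (V j)‖ / ‖V j‖ ≤ t ∧ v = V l} = ∅ := by
      ext v
      simp only [Set.mem_ofPred_eq, Set.mem_empty_iff_false, iff_false]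
      rintro ⟨l, j, -, hj, -⟩
      exact absurd hj (not_le.2 (hex j))
    simp [cheapSpan, flag, this]

lemma mem_orthogonal_flag {V : Fin k → F} {j : Fin k} {v : F} (hv : v ∈ (flag V j)ᗮ) :
    ∀ l < j, inner ℝ (V l) v = 0 := fun l hl =>
  (Submodule.mem_orthogonal _ v).1 hv (V l) (mem_flag V hl)

variable [FiniteDimensional ℝ F]

/-- The later column is itself a competitor for the minimum at position `l`. -/
lemma IsSVDOutput.ratio_mono {M : F →ₗ[ℝ] G} {V : Fin k → F} (h : IsSVDOutput M V)
    (hk : Module.finrank ℝ F = k) {l j : Fin k} (hlj : l ≤ j) :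
    ‖M (V l)‖ / ‖V l‖ ≤ √k * (‖M (V j)‖ / ‖V j‖) := by
  have h0 := norm_pos_iff.2 (ne_zero_of_span_eq_top hk h.span_eq_top j)
  have := h.ratio_le l (V j) fun l' hl' => h.orthogonal l' j (hl'.trans_le hlj).ne
  rw [← mul_div_assoc, le_div_iff₀ h0]
  exact this

/-- One factor `√k` comes from the approximate monotonicity of the ratios, the other from
Cauchy-Schwarz for the orthogonal columns. -/
lemma IsSVDOutput.norm_map_le {M : F →ₗ[ℝ] G} {V : Fin k → F} (h : IsSVDOutput M V)
    (hk : Module.finrank ℝ F = k) {d : ℕ} {t : ℝ} (ht : 0 ≤ t)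
    (hd : ∀ l : Fin k, (l : ℕ) < d → ∃ j, l ≤ j ∧ ‖M (V j)‖ / ‖V j‖ ≤ t) {v : F}
    (hv : v ∈ flag V d) : ‖M v‖ ≤ k * t * ‖v‖ := by
  set s := Finset.univ.filter (fun j : Fin k => (j : ℕ) < d) with hs
  have : flag V d = Submodule.span ℝ (V '' (s : Set (Fin k))) := by simp [flag, hs]
  rw [this] at hv
  obtain ⟨a, rfl⟩ := exists_sum_of_mem_span_image hv
  have hb : ∀ j ∈ s, ‖M (V j)‖ ≤ √k * t * ‖V j‖ := by
    intro l hl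
    obtain ⟨j, hlj, hj⟩ := hd l (Finset.mem_filter.1 hl).2
    rw [← div_le_iff₀ (norm_pos_iff.2 (ne_zero_of_span_eq_top hk h.span_eq_top l))]
    exact (h.ratio_mono hk hlj).trans (by gcongr)
  have h1 := ratio_le_of_orthogonal (LinearMap.id : F →ₗ[ℝ] F) s V (fun j => |a j|) 1 zero_le_one
    (by simp) (fun j _ l _ hjl => h.orthogonal j l hjl)
  have h2 : (∑ j ∈ s, |a j| * ‖V j‖) ≤ √k * ‖∑ j ∈ s, a j • V j‖ := by
    refine Real.le_sqrt_of_sq_le (y := k * ‖∑ j ∈ s, a j • V j‖ ^ 2) ?_ |>.trans_eq ?_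
    · have e : ‖∑ j ∈ s, a j • V j‖ ^ 2 = ∑ j ∈ s, (|a j| * ‖V j‖) ^ 2 := by
        rw [← real_inner_self_eq_norm_sq, sum_inner]
        refine Finset.sum_congr rfl fun j hj => ?_
        rw [inner_sum, Finset.sum_eq_single j]
        · rw [inner_smul_left, inner_smul_right, real_inner_self_eq_norm_sq, mul_pow, sq_abs]
          simp
          ring
        · intro l hl hlj
          rw [inner_smul_left, inner_smul_right, h.orthogonal j l hlj.symm]
          simp
        · exact fun h => absurd hj h
      rw [e]
      refine (sq_sum_le_card_mul_sum_sq).trans ?_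
      refine mul_le_mul_of_nonneg_right ?_ (Finset.sum_nonneg fun j _ => sq_nonneg _)
      have := s.card_le_univ
      simp only [Fintype.card_fin] at this
      exact_mod_cast this
    · rw [Real.sqrt_mul (by positivity), Real.sqrt_sq (norm_nonneg _)]
  calc ‖M (∑ j ∈ s, a j • V j)‖ ≤ ∑ j ∈ s, ‖a j • M (V j)‖ := by
        rw [map_sum]
        simp only [map_smul]
        exact norm_sum_le _ _
    _ ≤ ∑ j ∈ s, √k * t * (|a j| * ‖V j‖) := by
        refine Finset.sum_le_sum fun j hj => ?_
        rw [norm_smul, Real.norm_eq_abs]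
        calc |a j| * ‖M (V j)‖ ≤ |a j| * (√k * t * ‖V j‖) := by
              gcongr
              exact hb j hj
          _ = _ := by ring
    _ = √k * t * ∑ j ∈ s, |a j| * ‖V j‖ := by rw [Finset.mul_sum]
    _ ≤ √k * t * (√k * ‖∑ j ∈ s, a j • V j‖) := by gcongr
    _ = (√k * √k) * t * ‖∑ j ∈ s, a j • V j‖ := by ring
    _ = _ := by rw [Real.mul_self_sqrt (by positivity)]

lemma IsSVDOutput.norm_map_le_of_mem_cheapSpan {M : F →ₗ[ℝ] G} {V : Fin k → F}
    (h : IsSVDOutput M V) (hk : Module.finrank ℝ F = k) {t : ℝ} (ht : 0 ≤ t) {v : F}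
    (hv : v ∈ cheapSpan M V t) : ‖M v‖ ≤ k * t * ‖v‖ := by
  obtain ⟨d, hdk, hC, -, hd⟩ := cheapSpan_eq_flag M V t
  rw [hC] at hv
  exact h.norm_map_le hk ht hd hv

/-- Either everything is cheap, or the first ratio after the cheap columns separates the cheap span
from its complement. -/
lemma IsSVDOutput.cheapSpan_dichotomy {M : F →ₗ[ℝ] G} {V : Fin k → F}
    (h : IsSVDOutput M V) (hk : Module.finrank ℝ F = k) (t : ℝ) :
    cheapSpan M V t = ⊤ ∨ ∃ (ρ : ℝ) (E : Submodule ℝ F), t < ρ ∧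
      Module.finrank ℝ E = Module.finrank ℝ (cheapSpan M V t) + 1 ∧
      (∀ v ∈ E, ‖M v‖ ≤ k * ρ * ‖v‖) ∧
      ∀ v ∈ (cheapSpan M V t)ᗮ, ρ * ‖v‖ ≤ √k * ‖M v‖ := by
  obtain ⟨d, hdk, hC, hgt, hd⟩ := cheapSpan_eq_flag M V t
  rcases eq_or_lt_of_le hdk with rfl | hlt
  · left
    rw [hC, flag_eq_span_range _ le_rfl, h.span_eq_top]
  · right
    -- The first column after the cheap ones supplies `ρ`. Adding it to the cheap span keeps costs
    -- of order `ρ`, while everything orthogonal to the cheap span costs at least about `ρ`.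
    set p : Fin k := ⟨d, hlt⟩
    have hp := hgt p le_rfl
    refine ⟨‖M (V p)‖ / ‖V p‖, flag V (d + 1), hp, ?_, ?_, ?_⟩
    · rw [hC, finrank_flag hk h.span_eq_top hlt, finrank_flag hk h.span_eq_top hdk]
    · intro v hv
      refine h.norm_map_le hk (by positivity) (d := d + 1) ?_ hv
      intro l hl
      exact ⟨p, Fin.le_def.2 (Nat.lt_succ_iff.1 hl), le_rfl⟩
    · intro v hv
      rw [hC] at hv
      exact h.ratio_le p v (mem_orthogonal_flag (j := p) hv)

/-- Used to see that projecting to the cheap span does not leave `projSub I X`. As long as part of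
the kernel is missing from the leading span, a kernel vector orthogonal to that span forces the next
ratio to be exactly `0`, so the next column lies in the kernel and is cheap. -/
lemma IsSVDOutput.ker_le_cheapSpan {M : F →ₗ[ℝ] G} {V : Fin k → F}
    (h : IsSVDOutput M V) (hk : Module.finrank ℝ F = k) {t : ℝ} (ht : 0 ≤ t) :
    LinearMap.ker M ≤ cheapSpan M V t := by
  obtain ⟨d, hdk, hC, hgt, hd⟩ := cheapSpan_eq_flag M V t
  have hzero : ∀ j : ℕ, j ≤ k → ¬ LinearMap.ker M ≤ flag V j → flag V j ≤ LinearMap.ker M ∧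
      ∀ hj : j < k, ‖M (V ⟨j, hj⟩)‖ / ‖V ⟨j, hj⟩‖ = 0 := by
    intro j
    induction j with
    | zero =>
      intro _ hker
      refine ⟨by simp [flag], fun hj => ?_⟩
      obtain ⟨q, hq, hqf⟩ := SetLike.not_le_iff_exists.1 hker
      have hq0 : q ≠ 0 := by
        rintro rfl
        exact hqf (zero_mem _)
      have := h.ratio_le ⟨0, hj⟩ q (fun l hl => absurd hl (by simp [Fin.lt_def]))
      rw [LinearMap.mem_ker.1 hq, norm_zero, mul_zero] at this
      exact le_antisymm (nonpos_of_mul_nonpos_left this (norm_pos_iff.2 hq0)) (by positivity)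
    | succ j ih =>
      intro hjk hker
      have hker' : ¬ LinearMap.ker M ≤ flag V j := fun hcon =>
        hker (hcon.trans (flag_mono V (Nat.le_succ j)))
      obtain ⟨hle, hr⟩ := ih (by omega) hker'
      have hr' := hr hjk
      have hle' : flag V (j + 1) ≤ LinearMap.ker M := by
        rw [flag_succ V ⟨j, hjk⟩]
        refine sup_le hle ?_
        rw [Submodule.span_singleton_le_iff_mem, LinearMap.mem_ker]
        rw [div_eq_zero_iff] at hr'
        rcases hr' with e | e
        · exact norm_eq_zero.1 e
        · exact absurd (norm_eq_zero.1 e) (ne_zero_of_span_eq_top hk h.span_eq_top _)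
      refine ⟨hle', fun hj => ?_⟩
      obtain ⟨q, hq, hqf⟩ := SetLike.not_le_iff_exists.1 hker
      set f := (flag V (j + 1)).starProjection q with hf
      have hfm : f ∈ flag V (j + 1) := Submodule.starProjection_apply_mem _ _
      have hne : q - f ≠ 0 := by
        intro e
        rw [sub_eq_zero.1 e] at hqf
        exact hqf hfm
      have := h.ratio_le ⟨j + 1, hj⟩ (q - f) (mem_orthogonal_flag (j := ⟨j + 1, hj⟩)
        (Submodule.sub_starProjection_mem_orthogonal q))
      rw [map_sub, LinearMap.mem_ker.1 hq, LinearMap.mem_ker.1 (hle' hfm), sub_zero, norm_zero,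
        mul_zero] at this
      exact le_antisymm (nonpos_of_mul_nonpos_left this (norm_pos_iff.2 hne)) (by positivity)
  by_contra hcon
  rw [hC] at hcon
  obtain ⟨-, hr⟩ := hzero d hdk hcon
  rcases eq_or_lt_of_le hdk with rfl | hlt
  · rw [flag_eq_span_range _ le_rfl, h.span_eq_top] at hcon
    exact hcon le_top
  · have := hgt ⟨d, hlt⟩ le_rfl
    rw [hr hlt] at this
    exact absurd this (not_lt.2 ht)

end SVD

/-! ### Minimum-norm lifts between coordinate subspaces and the dimension count of their cost. -/

section Lifting

variable {n : ℕ}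

@[simp] lemma proj_apply (I : Finset (Fin n)) (w : Vec n) (i : I) : proj I w i = w i := rfl

lemma norm_proj_sq (I : Finset (Fin n)) (w : Vec n) : ‖proj I w‖ ^ 2 = ∑ i ∈ I, w i ^ 2 := by
  rw [EuclideanSpace.real_norm_sq_eq, ← Finset.sum_coe_sort I]
  rfl

lemma norm_sq_eq_proj (I : Finset (Fin n)) (w : Vec n) :
    ‖w‖ ^ 2 = ‖proj I w‖ ^ 2 + ‖proj Iᶜ w‖ ^ 2 := by
  rw [norm_proj_sq, norm_proj_sq, EuclideanSpace.real_norm_sq_eq, Finset.sum_add_sum_compl]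

lemma norm_proj_le (I : Finset (Fin n)) (w : Vec n) : ‖proj I w‖ ≤ ‖w‖ := by
  refine le_of_sq_le_sq ?_ (norm_nonneg _)
  rw [norm_sq_eq_proj I w]
  have := sq_nonneg ‖proj Iᶜ w‖
  linarith

lemma abs_apply_le_norm_proj {I : Finset (Fin n)} {i : Fin n} (hi : i ∈ I) (w : Vec n) :
    |w i| ≤ ‖proj I w‖ := by
  refine abs_le_of_sq_le_sq ?_ (norm_nonneg _)
  rw [norm_proj_sq]
  exact Finset.single_le_sum (f := fun i => w i ^ 2) (fun i _ => sq_nonneg _) hi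

lemma norm_proj_le_of_abs_le {I : Finset (Fin n)} {w w' : Vec n} {c : ℝ} (hc : 0 ≤ c)
    (h : ∀ i ∈ I, |w i| ≤ c * |w' i|) : ‖proj I w‖ ≤ c * ‖proj I w'‖ := by
  refine le_of_sq_le_sq ?_ (by positivity)
  rw [mul_pow, norm_proj_sq, norm_proj_sq, Finset.mul_sum]
  refine Finset.sum_le_sum fun i hi => ?_
  rw [← sq_abs (w i), ← sq_abs (w' i), ← mul_pow]
  exact pow_le_pow_left₀ (abs_nonneg _) (h i hi) 2

lemma norm_proj_le_sqrt {I : Finset (Fin n)} {w : Vec n} {c : ℝ} (hc : 0 ≤ c)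
    (h : ∀ i ∈ I, |w i| ≤ c) : ‖proj I w‖ ≤ √n * c := by
  refine le_of_sq_le_sq ?_ (by positivity)
  rw [mul_pow, Real.sq_sqrt (by positivity), norm_proj_sq]
  calc ∑ i ∈ I, w i ^ 2 ≤ ∑ _i ∈ I, c ^ 2 := Finset.sum_le_sum fun i hi => by
        rw [← sq_abs]
        exact pow_le_pow_left₀ (abs_nonneg _) (h i hi) 2
    _ = I.card * c ^ 2 := by simp
    _ ≤ n * c ^ 2 := by
        have := I.card_le_univ
        simp only [Fintype.card_fin] at this
        have h' : (I.card : ℝ) ≤ n := by exact_mod_cast this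
        gcongr

lemma norm_proj_compl_compl (I : Finset (Fin n)) (w : Vec n) : ‖proj Iᶜᶜ w‖ = ‖proj I w‖ := by
  rw [compl_compl]

lemma proj_mem_projSub {I : Finset (Fin n)} {X : Submodule ℝ (Vec n)} {w : Vec n} (h : w ∈ X) :
    proj I w ∈ projSub I X := Submodule.mem_map_of_mem h

/-- The minimum-norm lift: membership, the coordinates on `I`, and orthogonality to the vectors
that vanish on `I`. -/
lemma liftFull_spec (X : Submodule ℝ (Vec n)) (I : Finset (Fin n)) (v : VecOn I) :
    liftFull X I v ∈ X ∧ proj I (liftFull X I v) = (projSub I X).starProjection v ∧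
      ∀ u ∈ X, proj I u = 0 → inner ℝ (liftFull X I v) u = 0 := by
  -- The minimizer is any lift minus its projection to the vectors of `X` vanishing on `I`;
  -- Pythagoras gives minimality and uniqueness, which identifies the chosen value of `epsilon`.
  set K : Submodule ℝ (Vec n) := X ⊓ LinearMap.ker (proj I) with hK
  obtain ⟨w₀, hw₀, hpw₀⟩ := Submodule.mem_map.1
    (Submodule.starProjection_apply_mem (projSub I X) v)
  set w := w₀ - K.starProjection w₀ with hw
  have hKw : K.starProjection w₀ ∈ K := Submodule.starProjection_apply_mem _ _
  have hwX : w ∈ X := X.sub_mem hw₀ hKw.1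
  have hpw : proj I w = (projSub I X).starProjection v := by
    rw [hw, map_sub, LinearMap.mem_ker.1 hKw.2, sub_zero, hpw₀]
  have horth : ∀ u ∈ X, proj I u = 0 → inner ℝ w u = 0 := fun u hu hpu =>
    (Submodule.mem_orthogonal' K w).1 (Submodule.sub_starProjection_mem_orthogonal _) u ⟨hu, hpu⟩
  have hpyth : ∀ w' ∈ X, proj I w' = (projSub I X).starProjection v →
      ‖w'‖ ^ 2 = ‖w‖ ^ 2 + ‖w' - w‖ ^ 2 := by
    intro w' hw' hpw'
    have h0 := horth (w' - w) (X.sub_mem hw' hwX) (by rw [map_sub, hpw', hpw, sub_self])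
    have := norm_add_sq_real w (w' - w)
    rw [h0, add_sub_cancel] at this
    linarith
  have hmin : IsMinNormLift X I v w := by
    refine ⟨⟨hwX, hpw⟩, fun w' hw' hpw' => le_of_sq_le_sq ?_ (norm_nonneg _)⟩
    rw [hpyth w' hw' hpw']
    have := sq_nonneg ‖w' - w‖
    linarith
  have hL : IsMinNormLift X I v (liftFull X I v) := Classical.epsilon_spec ⟨w, hmin⟩
  have heq : liftFull X I v = w := by
    have h1 := hL.2 w hwX hpw
    have h2 := hpyth _ hL.1.1 hL.1.2
    have h3 : ‖liftFull X I v‖ ^ 2 ≤ ‖w‖ ^ 2 := pow_le_pow_left₀ (norm_nonneg _) h1 2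
    have h4 : ‖liftFull X I v - w‖ = 0 := by
      have := sq_nonneg ‖liftFull X I v - w‖
      exact pow_eq_zero_iff two_ne_zero |>.1 (by linarith)
    exact sub_eq_zero.1 (norm_eq_zero.1 h4)
  rw [heq]
  exact ⟨hwX, hpw, horth⟩

lemma eq_liftFull {X : Submodule ℝ (Vec n)} {I : Finset (Fin n)} {v : VecOn I} {w : Vec n}
    (hw : w ∈ X) (hp : proj I w = (projSub I X).starProjection v)
    (horth : ∀ u ∈ X, proj I u = 0 → inner ℝ w u = 0) : w = liftFull X I v := by
  obtain ⟨h1, h2, h3⟩ := liftFull_spec X I v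
  have hd : w - liftFull X I v ∈ X := X.sub_mem hw h1
  have hpd : proj I (w - liftFull X I v) = 0 := by rw [map_sub, hp, h2, sub_self]
  have : inner ℝ (w - liftFull X I v) (w - liftFull X I v) = 0 := by
    rw [inner_sub_left, horth _ hd hpd, h3 _ hd hpd, sub_zero]
  exact sub_eq_zero.1 (inner_self_eq_zero.1 this)

/-- The lifting map `L_I^X` as a linear map. -/
def liftFullLin (X : Submodule ℝ (Vec n)) (I : Finset (Fin n)) : VecOn I →ₗ[ℝ] Vec n where
  toFun := liftFull X I
  map_add' u v := by
    obtain ⟨h1, h2, h3⟩ := liftFull_spec X I u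
    obtain ⟨h1', h2', h3'⟩ := liftFull_spec X I v
    refine (eq_liftFull (X.add_mem h1 h1') (by rw [map_add, h2, h2', map_add]) ?_).symm
    intro w hw hpw
    rw [inner_add_left, h3 w hw hpw, h3' w hw hpw, add_zero]
  map_smul' r u := by
    obtain ⟨h1, h2, h3⟩ := liftFull_spec X I u
    refine (eq_liftFull (X.smul_mem r h1) (by rw [map_smul, h2]; simp) ?_).symm
    intro w hw hpw
    rw [inner_smul_left, h3 w hw hpw, mul_zero]

/-- The lifting map `ℓ_I^X` as a linear map. -/
def liftLin (X : Submodule ℝ (Vec n)) (I : Finset (Fin n)) : VecOn I →ₗ[ℝ] VecOn Iᶜ :=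
  proj Iᶜ ∘ₗ liftFullLin X I

lemma liftLin_apply (X : Submodule ℝ (Vec n)) (I : Finset (Fin n)) (v : VecOn I) :
    liftLin X I v = proj Iᶜ (liftFull X I v) := rfl

lemma proj_liftFull_of_mem {X : Submodule ℝ (Vec n)} {I : Finset (Fin n)} {v : VecOn I}
    (hv : v ∈ projSub I X) : proj I (liftFull X I v) = v := by
  rw [(liftFull_spec X I v).2.1, Submodule.starProjection_eq_self_iff.2 hv]

lemma norm_liftLin_proj_le {X : Submodule ℝ (Vec n)} {I : Finset (Fin n)} {w : Vec n}
    (hw : w ∈ X) : ‖liftLin X I (proj I w)‖ ≤ ‖proj Iᶜ w‖ := by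
  obtain ⟨h1, h2, h3⟩ := liftFull_spec X I (proj I w)
  rw [Submodule.starProjection_eq_self_iff.2 (proj_mem_projSub hw)] at h2
  rw [liftLin_apply]
  set L := liftFull X I (proj I w)
  have h0 := h3 (w - L) (X.sub_mem hw h1) (by rw [map_sub, h2, sub_self])
  have h4 := norm_add_sq_real L (w - L)
  rw [h0, add_sub_cancel, norm_sq_eq_proj I w, norm_sq_eq_proj I L, h2] at h4
  refine le_of_sq_le_sq ?_ (norm_nonneg _)
  have := sq_nonneg ‖w - L‖
  linarith

lemma liftLin_eq_zero_of_mem_orthogonal {X : Submodule ℝ (Vec n)} {I : Finset (Fin n)}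
    {v : VecOn I} (hv : v ∈ (projSub I X)ᗮ) : liftLin X I v = 0 := by
  have : (0 : Vec n) = liftFull X I v := by
    refine eq_liftFull X.zero_mem ?_ (by simp)
    rw [map_zero, (Submodule.starProjection_apply_eq_zero_iff (projSub I X)).2 hv]
  rw [liftLin_apply, ← this, map_zero]

/-! ### Counting expensive directions -/

/-- The number of directions of `π_I(X)` for which lifting is more expensive than `t`: the least
codimension in `π_I(X)` of the projection of a subspace of `X` on which the coordinates outside `I`
are bounded by `t` times the coordinates in `I`. -/
def eCount (X : Submodule ℝ (Vec n)) (I : Finset (Fin n)) (t : ℝ) : ℕ :=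
  sInf {e | ∃ Y ≤ X, (∀ w ∈ Y, ‖proj Iᶜ w‖ ≤ t * ‖proj I w‖) ∧
    Module.finrank ℝ (projSub I X) ≤ Module.finrank ℝ Y + e}

lemma eCount_le {X Y : Submodule ℝ (Vec n)} {I : Finset (Fin n)} {t : ℝ} {e : ℕ} (hY : Y ≤ X)
    (h : ∀ w ∈ Y, ‖proj Iᶜ w‖ ≤ t * ‖proj I w‖)
    (he : Module.finrank ℝ (projSub I X) ≤ Module.finrank ℝ Y + e) : eCount X I t ≤ e :=
  Nat.sInf_le ⟨Y, hY, h, he⟩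

lemma eCount_spec (X : Submodule ℝ (Vec n)) (I : Finset (Fin n)) (t : ℝ) :
    ∃ Y ≤ X, (∀ w ∈ Y, ‖proj Iᶜ w‖ ≤ t * ‖proj I w‖) ∧
      Module.finrank ℝ (projSub I X) ≤ Module.finrank ℝ Y + eCount X I t :=
  Nat.sInf_mem (s := {e | ∃ Y ≤ X, (∀ w ∈ Y, ‖proj Iᶜ w‖ ≤ t * ‖proj I w‖) ∧
    Module.finrank ℝ (projSub I X) ≤ Module.finrank ℝ Y + e})
    ⟨Module.finrank ℝ (projSub I X), ⊥, bot_le, by simp, by simp⟩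

lemma eCount_antitone (X : Submodule ℝ (Vec n)) (I : Finset (Fin n)) {t t' : ℝ} (h : t ≤ t') :
    eCount X I t' ≤ eCount X I t := by
  obtain ⟨Y, hY, hc, he⟩ := eCount_spec X I t
  exact eCount_le hY (fun w hw => (hc w hw).trans (by gcongr)) he

lemma eCount_empty (X : Submodule ℝ (Vec n)) (t : ℝ) : eCount X ∅ t = 0 := by
  refine Nat.le_zero.1 (eCount_le (Y := ⊥) bot_le (by simp) ?_)
  have := Submodule.finrank_le (projSub ∅ X)
  simpa using this

lemma finrank_projSub_add (X : Submodule ℝ (Vec n)) (I : Finset (Fin n)) :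
    Module.finrank ℝ (projSub I X) +
      Module.finrank ℝ (X ⊓ LinearMap.ker (proj I) : Submodule ℝ (Vec n)) =
      Module.finrank ℝ X := by
  have h := LinearMap.finrank_range_add_finrank_ker ((proj I).domRestrict X)
  rw [LinearMap.range_domRestrict, LinearMap.ker_domRestrict] at h
  have e : Module.finrank ℝ (Submodule.comap X.subtype (LinearMap.ker (proj I))) =
      Module.finrank ℝ (X ⊓ LinearMap.ker (proj I) : Submodule ℝ (Vec n)) := by
    rw [← Submodule.map_comap_subtype, LinearEquiv.finrank_eq (Submodule.equivMapOfInjective _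
      X.injective_subtype _)]
  rw [e] at h
  exact h

lemma eCount_univ (X : Submodule ℝ (Vec n)) {t : ℝ} (ht : 0 ≤ t) : eCount X Finset.univ t = 0 := by
  refine Nat.le_zero.1 (eCount_le (Y := X) le_rfl (fun w _ => ?_) ?_)
  · have : ‖proj (Finset.univ : Finset (Fin n))ᶜ w‖ = 0 := by
      rw [← pow_eq_zero_iff two_ne_zero, norm_proj_sq]
      simp
    rw [this]
    positivity
  · have := finrank_projSub_add X Finset.univ
    omega

lemma finrank_le_finrank_inf_ker_proj (Y : Submodule ℝ (Vec n)) (K : Finset (Fin n)) :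
    Module.finrank ℝ Y ≤
      Module.finrank ℝ (Y ⊓ LinearMap.ker (proj K) : Submodule ℝ (Vec n)) + K.card := by
  have h := finrank_projSub_add Y K
  have := Submodule.finrank_le (projSub K Y)
  simp only [finrank_euclideanSpace, Fintype.card_coe] at this
  omega

lemma mem_ker_proj {K : Finset (Fin n)} {w : Vec n} :
    w ∈ LinearMap.ker (proj K) ↔ ∀ i ∈ K, w i = 0 := by
  rw [LinearMap.mem_ker]
  constructor
  · intro h i hi
    have := congrArg (fun v : VecOn K => v ⟨i, hi⟩) h
    simpa using this
  · intro h
    ext i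
    simpa using h i i.2

/-- A vector of `X` vanishing on `I` vanishes on `J` after at most `(J \ I).card` further linear
conditions. -/
lemma finrank_projSub_le (X : Submodule ℝ (Vec n)) (I J : Finset (Fin n)) :
    Module.finrank ℝ (projSub J X) ≤ Module.finrank ℝ (projSub I X) + (J \ I).card := by
  have h1 := finrank_projSub_add X I
  have h2 := finrank_projSub_add X J
  have h3 := finrank_le_finrank_inf_ker_proj (X ⊓ LinearMap.ker (proj I)) (J \ I)
  have h4 : (X ⊓ LinearMap.ker (proj I)) ⊓ LinearMap.ker (proj (J \ I)) ≤
      X ⊓ LinearMap.ker (proj J) := by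
    rintro w ⟨⟨hw, hI⟩, hJ⟩
    refine ⟨hw, mem_ker_proj.2 fun i hi => ?_⟩
    by_cases hiI : i ∈ I
    · exact mem_ker_proj.1 hI i hiI
    · exact mem_ker_proj.1 hJ i (Finset.mem_sdiff.2 ⟨hi, hiI⟩)
  have h5 := Submodule.finrank_mono h4
  omega

/-- Changing the index set changes the number of expensive directions by at most the size of the
symmetric difference. -/
lemma eCount_le_add_card_symmDiff (X : Submodule ℝ (Vec n)) (I J : Finset (Fin n)) {t : ℝ}
    (ht : 0 ≤ t) : eCount X J t ≤ eCount X I t + (symmDiff J I).card := by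
  obtain ⟨Y, hY, hc, he⟩ := eCount_spec X I t
  -- Killing the coordinates that leave the index set costs `(I \ J).card` dimensions and keeps the
  -- cost inequality. The other part of the symmetric difference pays for the growth of the
  -- projected space.
  refine eCount_le (Y := Y ⊓ LinearMap.ker (proj (I \ J))) (inf_le_left.trans hY) ?_ ?_
  · rintro w ⟨hw, hk⟩
    have hk' := mem_ker_proj.1 hk
    have h1 : ‖proj Jᶜ w‖ ≤ ‖proj Iᶜ w‖ := by
      refine le_of_sq_le_sq ?_ (norm_nonneg _)
      rw [norm_proj_sq, norm_proj_sq]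
      calc ∑ i ∈ Jᶜ, w i ^ 2 = ∑ i ∈ Jᶜ \ (I \ J), w i ^ 2 := by
            refine (Finset.sum_subset Finset.sdiff_subset fun i _ hi' => ?_).symm
            have : i ∈ I \ J := by
              by_contra hcon
              simp_all
            rw [hk' i this]
            simp
        _ ≤ ∑ i ∈ Iᶜ, w i ^ 2 := by
            refine Finset.sum_le_sum_of_subset_of_nonneg ?_ fun i _ _ => sq_nonneg _
            intro i
            simp only [Finset.mem_sdiff, Finset.mem_compl]
            tauto
    have h2 : ‖proj I w‖ ≤ ‖proj J w‖ := by
      refine le_of_sq_le_sq ?_ (norm_nonneg _)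
      rw [norm_proj_sq, norm_proj_sq]
      calc ∑ i ∈ I, w i ^ 2 = ∑ i ∈ I ∩ J, w i ^ 2 := by
            refine (Finset.sum_subset Finset.inter_subset_left fun i hi hi' => ?_).symm
            have : i ∈ I \ J := by
              simp_all
            rw [hk' i this]
            simp
        _ ≤ _ := Finset.sum_le_sum_of_subset_of_nonneg Finset.inter_subset_right
            fun i _ _ => sq_nonneg _
    exact h1.trans ((hc w hw).trans (by gcongr))
  · have h1 := finrank_projSub_le X I J
    have h2 := finrank_le_finrank_inf_ker_proj Y (I \ J)
    have h3 : (symmDiff J I).card = (J \ I).card + (I \ J).card := by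
      rw [symmDiff_def, Finset.sup_eq_union, Finset.card_union_of_disjoint]
      exact disjoint_sdiff_sdiff
    omega

lemma scale_injective {a : Vec n} (ha : ∀ i, 0 < a i) : Function.Injective (scale a) := by
  intro u v h
  ext i
  have := congrArg (fun w : Vec n => w i) h
  simp only [scale, LinearMap.coe_mk, AddHom.coe_mk, had] at this
  exact mul_left_cancel₀ (ha i).ne' this

lemma scale_apply (a w : Vec n) (i : Fin n) : scale a w i = a i * w i := rfl

lemma finrank_projSub_scaled {a : Vec n} (ha : ∀ i, 0 < a i) (W : Submodule ℝ (Vec n))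
    (I : Finset (Fin n)) :
    Module.finrank ℝ (projSub I (scaled a W)) = Module.finrank ℝ (projSub I W) := by
  have h1 := finrank_projSub_add W I
  have h2 := finrank_projSub_add (scaled a W) I
  have h3 : Module.finrank ℝ (scaled a W) = Module.finrank ℝ W :=
    (LinearEquiv.finrank_eq (Submodule.equivMapOfInjective _ (scale_injective ha) W)).symm
  have h4 : scaled a W ⊓ LinearMap.ker (proj I) = (W ⊓ LinearMap.ker (proj I)).map (scale a) := by
    ext w
    constructor
    · rintro ⟨⟨u, hu, rfl⟩, hk⟩
      refine ⟨u, ⟨hu, mem_ker_proj.2 fun i hi => ?_⟩, rfl⟩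
      have := mem_ker_proj.1 hk i hi
      rw [scale_apply] at this
      exact (mul_eq_zero.1 this).resolve_left (ha i).ne'
    · rintro ⟨u, ⟨hu, hk⟩, rfl⟩
      refine ⟨⟨u, hu, rfl⟩, mem_ker_proj.2 fun i hi => ?_⟩
      rw [scale_apply, mem_ker_proj.1 hk i hi, mul_zero]
  have h5 : Module.finrank ℝ ((W ⊓ LinearMap.ker (proj I)).map (scale a)) =
      Module.finrank ℝ (W ⊓ LinearMap.ker (proj I) : Submodule ℝ (Vec n)) :=
    (LinearEquiv.finrank_eq (Submodule.equivMapOfInjective _ (scale_injective ha) _)).symm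
  rw [h4, h5] at h2
  omega

/-- Effect of a change of the scaling on the number of expensive directions. -/
lemma eCount_scaled_le {a a' : Vec n} (ha : ∀ i, 0 < a i) (ha' : ∀ i, 0 < a' i)
    (W : Submodule ℝ (Vec n)) (I : Finset (Fin n)) {c₁ c₂ t t' : ℝ} (hc₁ : 0 ≤ c₁) (hc₂ : 0 ≤ c₂)
    (ht : 0 ≤ t) (h₁ : ∀ i ∈ I, a' i ≤ c₁ * a i) (h₂ : ∀ i ∈ Iᶜ, a i ≤ c₂ * a' i)
    (ht' : c₁ * c₂ * t ≤ t') :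
    eCount (scaled (vinv a') W) I t' ≤ eCount (scaled (vinv a) W) I t := by
  have hv : ∀ i, 0 < vinv a i := fun i => inv_pos.2 (ha i)
  have hv' : ∀ i, 0 < vinv a' i := fun i => inv_pos.2 (ha' i)
  obtain ⟨Y, hY, hc, he⟩ := eCount_spec (scaled (vinv a) W) I t
  -- Multiplication by `a / a'` carries one rescaled space to the other; it changes the norm on each
  -- of the two coordinate blocks by a bounded factor.
  set σ : Vec n := had (vinv a') a with hσ
  have hσ0 : ∀ i, 0 < σ i := fun i => mul_pos (hv' i) (ha i)
  refine eCount_le (Y := Y.map (scale σ)) ?_ ?_ ?_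
  · rintro _ ⟨w, hw, rfl⟩
    obtain ⟨u, hu, rfl⟩ := hY hw
    refine ⟨u, hu, ?_⟩
    ext i
    simp only [scale_apply, hσ, had, vinv]
    have := (ha i).ne'
    field_simp
  · rintro _ ⟨w, hw, rfl⟩
    have h1 : ‖proj Iᶜ (scale σ w)‖ ≤ c₂ * ‖proj Iᶜ w‖ := by
      refine norm_proj_le_of_abs_le hc₂ fun i hi => ?_
      rw [scale_apply, abs_mul, abs_of_pos (hσ0 i)]
      gcongr
      have := h₂ i hi
      show (a' i)⁻¹ * a i ≤ c₂
      rw [inv_mul_le_iff₀ (ha' i)]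
      linarith
    have h2 : ‖proj I w‖ ≤ c₁ * ‖proj I (scale σ w)‖ := by
      refine norm_proj_le_of_abs_le hc₁ fun i hi => ?_
      rw [scale_apply, abs_mul, abs_of_pos (hσ0 i), ← mul_assoc]
      refine le_mul_of_one_le_left (abs_nonneg _) ?_
      show 1 ≤ c₁ * ((a' i)⁻¹ * a i)
      have := h₁ i hi
      have h' := ha' i
      rw [← mul_assoc, mul_comm c₁, mul_assoc, ← div_eq_inv_mul, one_le_div h']
      exact this
    calc ‖proj Iᶜ (scale σ w)‖ ≤ c₂ * (t * (c₁ * ‖proj I (scale σ w)‖)) := by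
          refine h1.trans ?_
          gcongr
          exact (hc w hw).trans (by gcongr)
      _ = (c₁ * c₂ * t) * ‖proj I (scale σ w)‖ := by ring
      _ ≤ _ := by gcongr
  · rw [finrank_projSub_scaled hv']
    rw [finrank_projSub_scaled hv] at he
    rwa [← LinearEquiv.finrank_eq (Submodule.equivMapOfInjective _ (scale_injective hσ0) Y)]

/-! ### Approximate singular value decompositions of the lifting map -/

/-- The space `Y` realizing the count, projected to `I`, together with `(projSub I X)ᗮ`, where
lifting is zero, has dimension at least `I.card - eCount X I t` and cost at most `t`. It meets `Cᗮ`
trivially because there the cost exceeds `t`, and dimensions can be compared. -/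
lemma card_le_finrank_add_eCount {X : Submodule ℝ (Vec n)} {I : Finset (Fin n)}
    {C : Submodule ℝ (VecOn I)} {ρ t : ℝ} (ht : 0 ≤ t) (hρ : √(I.card) * t < ρ)
    (hC : ∀ v ∈ Cᗮ, ρ * ‖v‖ ≤ √(I.card) * ‖liftLin X I v‖) :
    I.card ≤ Module.finrank ℝ C + eCount X I t := by
  obtain ⟨Y, hY, hc, he⟩ := eCount_spec X I t
  have hYk : Y ⊓ LinearMap.ker (proj I) = ⊥ := by
    rw [Submodule.eq_bot_iff]
    rintro w ⟨hw, hk⟩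
    have h1 := hc w hw
    rw [LinearMap.mem_ker.1 hk, norm_zero, mul_zero] at h1
    have h2 := norm_sq_eq_proj I w
    rw [LinearMap.mem_ker.1 hk, le_antisymm h1 (norm_nonneg _)] at h2
    simpa using h2
  have hYd : Module.finrank ℝ (projSub I Y) = Module.finrank ℝ Y := by
    have := finrank_projSub_add Y I
    rw [hYk, finrank_bot, add_zero] at this
    exact this
  have hYX : projSub I Y ≤ projSub I X := Submodule.map_mono hY
  set S := projSub I Y ⊔ (projSub I X)ᗮ with hS
  have hSd : Module.finrank ℝ S = Module.finrank ℝ Y + Module.finrank ℝ (projSub I X)ᗮ := by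
    have h := Submodule.finrank_sup_add_finrank_inf_eq (projSub I Y) (projSub I X)ᗮ
    have h0 : projSub I Y ⊓ (projSub I X)ᗮ = ⊥ :=
      le_bot_iff.1 ((inf_le_inf_right _ hYX).trans (Submodule.inf_orthogonal_eq_bot _).le)
    rw [h0, finrank_bot, add_zero, hYd] at h
    exact h
  have hSC : S ⊓ Cᗮ = ⊥ := by
    rw [Submodule.eq_bot_iff]
    rintro v ⟨hvS, hvC⟩
    obtain ⟨y, hy, p, hp, rfl⟩ := Submodule.mem_sup.1 hvS
    obtain ⟨w, hw, rfl⟩ := Submodule.mem_map.1 hy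
    have h1 := hC _ hvC
    rw [map_add, liftLin_eq_zero_of_mem_orthogonal hp, add_zero] at h1
    have h2 := (norm_liftLin_proj_le (I := I) (hY hw)).trans (hc w hw)
    have h3 : ‖proj I w‖ ≤ ‖proj I w + p‖ := by
      have h0 : inner ℝ (proj I w) p = 0 := (Submodule.mem_orthogonal _ p).1 hp _ (hYX hy)
      have := norm_add_sq_real (proj I w) p
      rw [h0] at this
      refine le_of_sq_le_sq ?_ (norm_nonneg _)
      have := sq_nonneg ‖p‖
      linarith
    have h4 : ρ * ‖proj I w + p‖ ≤ √(I.card) * t * ‖proj I w + p‖ := by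
      refine h1.trans ?_
      rw [mul_assoc]
      gcongr
      exact h2.trans (by gcongr)
    by_contra hne
    have := norm_pos_iff.2 hne
    exact absurd (le_of_mul_le_mul_right h4 this) (not_le.2 hρ)
  have h1 := Submodule.finrank_sup_add_finrank_inf_eq S Cᗮ
  rw [hSC, finrank_bot, add_zero] at h1
  have h2 := Submodule.finrank_le (S ⊔ Cᗮ)
  have h3 := Submodule.finrank_add_finrank_orthogonal C
  have h4 := Submodule.finrank_add_finrank_orthogonal (projSub I X)
  simp only [finrank_euclideanSpace, Fintype.card_coe] at h2 h3 h4
  omega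

/-- The converse estimate: lifting `E ⊓ projSub I X` gives a witness for `eCount`, and its
codimension in `projSub I X` is at most that of `E`. -/
lemma eCount_add_finrank_le {X : Submodule ℝ (Vec n)} {I : Finset (Fin n)}
    {E : Submodule ℝ (VecOn I)} {s : ℝ} (hE : ∀ v ∈ E, ‖liftLin X I v‖ ≤ s * ‖v‖) :
    eCount X I s + Module.finrank ℝ E ≤ I.card := by
  have hEle := Submodule.finrank_le E
  simp only [finrank_euclideanSpace, Fintype.card_coe] at hEle
  suffices eCount X I s ≤ I.card - Module.finrank ℝ E by omega
  set S := E ⊓ projSub I X with hS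
  refine eCount_le (Y := S.map (liftFullLin X I)) ?_ ?_ ?_
  · rintro _ ⟨v, _, rfl⟩
    exact (liftFull_spec X I v).1
  · rintro _ ⟨v, hv, rfl⟩
    have h1 : proj I (liftFullLin X I v) = v := proj_liftFull_of_mem hv.2
    rw [h1]
    exact hE v hv.1
  · have h1 : Module.finrank ℝ (S.map (liftFullLin X I)) = Module.finrank ℝ S := by
      have hinj : Function.Injective ((liftFullLin X I).domRestrict S) := by
        intro u v huv
        have := congrArg (proj I) huv
        simp only [LinearMap.domRestrict_apply] at this
        have hu : proj I (liftFullLin X I u) = u := proj_liftFull_of_mem u.2.2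
        have hv : proj I (liftFullLin X I v) = v := proj_liftFull_of_mem v.2.2
        rw [hu, hv] at this
        exact Subtype.ext this
      have := LinearMap.finrank_range_of_inj hinj
      rwa [LinearMap.range_domRestrict] at this
    have h2 := Submodule.finrank_sup_add_finrank_inf_eq E (projSub I X)
    have h3 := Submodule.finrank_le (E ⊔ projSub I X)
    simp only [finrank_euclideanSpace, Fintype.card_coe] at h3
    rw [← hS] at h2
    rw [h1]
    omega

lemma span_range_idCols (I : Finset (Fin n)) : Submodule.span ℝ (Set.range (idCols I)) = ⊤ := by
  have h := (EuclideanSpace.basisFun I ℝ).toBasis.span_eq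
  rw [← h]
  congr 1
  ext v
  constructor
  · rintro ⟨j, rfl⟩
    exact ⟨I.orderIsoOfFin rfl j, by simp [idCols]⟩
  · rintro ⟨i, rfl⟩
    exact ⟨(I.orderIsoOfFin rfl).symm i, by simp [idCols]⟩

lemma exists_isApproxSVD (X : Submodule ℝ (Vec n)) (I : Finset (Fin n)) :
    ∃ V, IsApproxSVD (lift X I) V :=
  exists_isApproxSVDFrom (liftLin X I) (idCols I)

lemma IsApproxSVD.isSVDOutput {X : Submodule ℝ (Vec n)} {I : Finset (Fin n)}
    {V : Fin I.card → VecOn I} (h : IsApproxSVD (lift X I) V) : IsSVDOutput (liftLin X I) V :=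
  IsApproxSVDFrom.isSVDOutput (by simp) (liftLin X I) (span_range_idCols I) h

/-- Either the cheap span is everything, or the complement of the cheap span is expensive and the
number of expensive directions drops at the corresponding threshold. -/
lemma eCount_drop {X : Submodule ℝ (Vec n)} {I : Finset (Fin n)}
    {V : Fin I.card → VecOn I} (h : IsApproxSVD (lift X I) V) {t₀ t : ℝ} (ht₀ : 0 ≤ t₀)
    (ht : √(I.card) * t₀ ≤ t) :
    cheapSpan (lift X I) V t = ⊤ ∨ ∃ ρ, t < ρ ∧
      eCount X I (I.card * ρ) + 1 ≤ eCount X I t₀ ∧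
      ∀ v ∈ (cheapSpan (lift X I) V t)ᗮ, ρ * ‖v‖ ≤ √(I.card) * ‖liftLin X I v‖ := by
  rcases h.isSVDOutput.cheapSpan_dichotomy (by simp) t with h1 | ⟨ρ, E, hρ, hd, hE, hC⟩
  · exact Or.inl h1
  · refine Or.inr ⟨ρ, hρ, ?_, hC⟩
    -- The count is at least the codimension of the cheap span at `t₀`, and at most that codimension
    -- minus one at `I.card * ρ`.
    have h1 := card_le_finrank_add_eCount ht₀ (ht.trans_lt hρ) hC
    have h2 := eCount_add_finrank_le hE
    omega

/-- The properties of the subspace layered least squares direction for one side. -/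
lemma llsDelta_spec {X : Submodule ℝ (Vec n)} {I : Finset (Fin n)}
    {V : Fin I.card → VecOn I} (h : IsApproxSVD (lift X I) V) {t : ℝ} (ht : 0 ≤ t) (ξ : Vec n) :
    llsDelta X I (cheapSpan (lift X I) V t ⊓ projSub I X) ξ ∈ X ∧
    ‖proj Iᶜ (llsDelta X I (cheapSpan (lift X I) V t ⊓ projSub I X) ξ)‖ ≤
      I.card * t * ‖proj I ξ‖ ∧
    ∀ (v : Vec n) (ε Γ r : ℝ), v ∈ X → ‖proj I (ξ + v)‖ ≤ ε → ‖proj Iᶜ v‖ ≤ Γ → 0 < r →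
      (cheapSpan (lift X I) V t = ⊤ ∨ ∀ v ∈ (cheapSpan (lift X I) V t)ᗮ,
        r * ‖v‖ ≤ √(I.card) * ‖liftLin X I v‖) →
      ‖proj I (ξ + llsDelta X I (cheapSpan (lift X I) V t ⊓ projSub I X) ξ)‖ ≤
        ε + √(I.card) * (Γ + I.card * t * (‖proj I ξ‖ + ε)) / r := by
  set C := cheapSpan (lift X I) V t with hC
  set S := C ⊓ projSub I X with hS
  set p := S.starProjection (proj I ξ) with hp
  have hpS : p ∈ S := Submodule.starProjection_apply_mem _ _
  have hCb : ∀ v ∈ C, ‖liftLin X I v‖ ≤ I.card * t * ‖v‖ := fun v hv =>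
    h.isSVDOutput.norm_map_le_of_mem_cheapSpan (by simp) ht hv
  have hδ : llsDelta X I S ξ = liftFull X I (-p) := rfl
  rw [hδ]
  refine ⟨(liftFull_spec X I _).1, ?_, ?_⟩
  · rw [← liftLin_apply, map_neg, norm_neg]
    refine (hCb p hpS.1).trans ?_
    gcongr
    exact Submodule.norm_starProjection_apply_le _ _
  · intro v ε Γ r hv hε hΓ hr hcase
    rw [map_add, proj_liftFull_of_mem ((projSub I X).neg_mem hpS.2), ← sub_eq_add_neg]
    -- The comparison vector `u` itself may not be cheap; it suffices to approximate it by an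
    -- element of `S`, since the LLS residual is minimal over `S`.
    set u : VecOn I := proj I (-v) with hu
    have huX : u ∈ projSub I X := proj_mem_projSub (X.neg_mem hv)
    have hΓ0 : 0 ≤ Γ := (norm_nonneg _).trans hΓ
    have hε0 : 0 ≤ ε := (norm_nonneg _).trans hε
    have hun : ‖u‖ ≤ ‖proj I ξ‖ + ε := by
      have : u = proj I ξ - proj I (ξ + v) := by
        rw [hu, ← map_sub]
        congr 1
        abel
      rw [this]
      exact (norm_sub_le _ _).trans (by gcongr)
    have hMu : ‖liftLin X I u‖ ≤ Γ := by
      refine (norm_liftLin_proj_le (X.neg_mem hv)).trans ?_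
      rw [map_neg, norm_neg]
      exact hΓ
    have hmin : ∀ p' ∈ S, ‖proj I ξ - p‖ ≤ ‖proj I ξ - p'‖ := by
      intro p' hp'
      rw [hp, Submodule.starProjection_minimal]
      exact ciInf_le ⟨0, by rintro _ ⟨x, rfl⟩; exact norm_nonneg _⟩ (⟨p', hp'⟩ : S)
    have hξu : ‖proj I ξ - u‖ ≤ ε := by
      have : proj I ξ - u = proj I (ξ + v) := by
        rw [hu, ← map_sub]
        congr 1
        abel
      rwa [this]
    suffices H : ∃ p' ∈ S, ‖u - p'‖ ≤ √(I.card) * (Γ + I.card * t * (‖proj I ξ‖ + ε)) / r by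
      obtain ⟨p', hp', hle⟩ := H
      refine (hmin p' hp').trans ?_
      calc ‖proj I ξ - p'‖ = ‖(proj I ξ - u) + (u - p')‖ := by congr 1; abel
        _ ≤ _ := (norm_add_le _ _).trans (add_le_add hξu hle)
    rcases hcase with htop | hexp
    · refine ⟨u, ⟨by rw [htop]; trivial, huX⟩, ?_⟩
      rw [sub_self, norm_zero]
      positivity
    · have hker : (projSub I X)ᗮ ≤ C := fun q hq =>
        h.isSVDOutput.ker_le_cheapSpan (by simp) ht
          (LinearMap.mem_ker.2 (liftLin_eq_zero_of_mem_orthogonal hq))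
      have hCo : Cᗮ ≤ projSub I X := by
        have := Submodule.orthogonal_le hker
        rwa [Submodule.orthogonal_orthogonal] at this
      set p' := C.starProjection u with hp'
      have hup : u - p' ∈ Cᗮ := Submodule.sub_starProjection_mem_orthogonal _
      have hp'C : p' ∈ C := Submodule.starProjection_apply_mem _ _
      have hp'X : p' ∈ projSub I X := by
        have := (projSub I X).sub_mem huX (hCo hup)
        rwa [sub_sub_cancel] at this
      refine ⟨p', ⟨hp'C, hp'X⟩, ?_⟩
      rw [le_div_iff₀ hr, mul_comm]
      refine (hexp _ hup).trans ?_
      gcongr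
      rw [map_sub]
      refine (norm_sub_le _ _).trans (add_le_add hMu ((hCb p' hp'C).trans ?_))
      gcongr
      exact (Submodule.norm_starProjection_apply_le _ _).trans hun

end Lifting

/-! ## Coordinate-wise algebra -/

section Hadamard

variable {n : ℕ}

@[simp] lemma had_apply (x y : Vec n) (i : Fin n) : had x y i = x i * y i := rfl

@[simp] lemma ones_apply (i : Fin n) : ones n i = 1 := rfl

@[simp] lemma vinv_apply (x : Vec n) (i : Fin n) : vinv x i = (x i)⁻¹ := rfl

lemma inner_eq_sum (x y : Vec n) : inner ℝ x y = ∑ i, x i * y i := by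
  rw [PiLp.inner_apply]
  exact Finset.sum_congr rfl fun i _ => by simp [mul_comm]

lemma abs_apply_le_norm (x : Vec n) (i : Fin n) : |x i| ≤ ‖x‖ := PiLp.norm_apply_le x i

lemma norm_had_le (x y : Vec n) : ‖had x y‖ ≤ ‖x‖ * ‖y‖ := by
  refine le_of_sq_le_sq ?_ (by positivity)
  rw [mul_pow, EuclideanSpace.real_norm_sq_eq, EuclideanSpace.real_norm_sq_eq x, Finset.sum_mul]
  refine Finset.sum_le_sum fun i _ => ?_
  rw [had_apply, mul_pow]
  gcongr ?_ * ?_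
  rw [← sq_abs]
  exact pow_le_pow_left₀ (abs_nonneg _) (abs_apply_le_norm y i) 2

lemma gap_mul (hn : 0 < n) (z : State n) : n * gap z = ∑ i, z.1 i * z.2 i := by
  unfold gap
  field_simp

lemma gap_mul_eq_inner (hn : 0 < n) (z : State n) : n * gap z = inner ℝ z.1 z.2 := by
  rw [gap_mul hn, inner_eq_sum]

lemma gap_pos (hn : 0 < n) {z : State n} (hx : ∀ i, 0 < z.1 i) (hs : ∀ i, 0 < z.2 i) :
    0 < gap z := by
  have : Nonempty (Fin n) := ⟨⟨0, hn⟩⟩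
  exact div_pos (Finset.sum_pos (fun i _ => mul_pos (hx i) (hs i)) Finset.univ_nonempty)
    (by exact_mod_cast hn)

lemma continuous_gap : Continuous (gap : State n → ℝ) := by
  unfold gap
  fun_prop

lemma continuous_had : Continuous fun z : State n => had z.1 z.2 := by
  unfold had
  fun_prop

lemma sqrt_mul_abs_gap_le (hn : 0 < n) (z : State n) : √n * |gap z| ≤ ‖had z.1 z.2‖ := by
  have h1 : (n * gap z) ^ 2 ≤ n * ‖had z.1 z.2‖ ^ 2 := by
    rw [gap_mul hn, EuclideanSpace.real_norm_sq_eq]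
    have := sq_sum_le_card_mul_sum_sq (s := Finset.univ) (f := fun i => z.1 i * z.2 i)
    simpa using this
  refine le_of_sq_le_sq ?_ (norm_nonneg _)
  rw [mul_pow, Real.sq_sqrt (by positivity), sq_abs]
  have hn' : (0 : ℝ) < n := by exact_mod_cast hn
  nlinarith

/-- The gap is the mean of the products, so subtracting it is an orthogonal projection. -/
lemma norm_had_sub_gap_le (hn : 0 < n) (z : State n) :
    ‖had z.1 z.2 - gap z • ones n‖ ≤ ‖had z.1 z.2‖ := by
  refine le_of_sq_le_sq ?_ (norm_nonneg _)
  have h1 : inner ℝ (had z.1 z.2) (gap z • ones n) = n * gap z ^ 2 := by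
    rw [inner_eq_sum]
    have : n * gap z ^ 2 = (∑ i, z.1 i * z.2 i) * gap z := by
      rw [← gap_mul hn]
      ring
    rw [this, Finset.sum_mul]
    simp
  have h2 : ‖gap z • ones n‖ ^ 2 = n * gap z ^ 2 := by
    rw [EuclideanSpace.real_norm_sq_eq]
    simp
  rw [norm_sub_sq_real, h1, h2]
  have : 0 ≤ n * gap z ^ 2 := by positivity
  linarith

/-- The product along a segment. -/
lemma had_add_smul (z Δ : State n) (α : ℝ) :
    had (z + α • Δ).1 (z + α • Δ).2 = (1 - α) • had z.1 z.2 +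
      α • had (z + Δ).1 (z + Δ).2 - (α * (1 - α)) • had Δ.1 Δ.2 := by
  ext i
  simp
  ring

lemma gap_add_smul (hn : 0 < n) {z Δ : State n} (h : inner ℝ Δ.1 Δ.2 = 0) (α : ℝ) :
    gap (z + α • Δ) = (1 - α) * gap z + α * gap (z + Δ) := by
  have hn' : (n : ℝ) ≠ 0 := by exact_mod_cast hn.ne'
  apply mul_left_cancel₀ hn'
  rw [mul_add, mul_left_comm, mul_left_comm (n : ℝ) α, gap_mul_eq_inner hn, gap_mul_eq_inner hn,
    gap_mul_eq_inner hn]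
  simp only [Prod.fst_add, Prod.snd_add, Prod.smul_fst, Prod.smul_snd, inner_add_left,
    inner_add_right, inner_smul_left, inner_smul_right, h]
  simp
  ring

end Hadamard

/-! ## Feasibility -/

namespace LP

variable {m n : ℕ} {P : LP m n}

lemma mem_W_iff (w : Vec n) : w ∈ P.W ↔ P.A *ᵥ w.ofLp = 0 := by
  unfold W
  rw [LinearMap.mem_ker]
  simp [Matrix.toLpLin_apply]

lemma mem_Worth_iff (v : Vec n) : v ∈ P.Wᗮ ↔ ∃ y, P.Aᵀ *ᵥ y = v.ofLp := by
  unfold W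
  rw [LinearMap.orthogonal_ker, ← Matrix.toEuclideanLin_conjTranspose_eq_adjoint,
    LinearMap.mem_range]
  constructor
  · rintro ⟨y, rfl⟩
    exact ⟨y.ofLp, by simp [Matrix.toLpLin_apply]⟩
  · rintro ⟨y, hy⟩
    refine ⟨WithLp.toLp 2 y, ?_⟩
    ext i
    simp [Matrix.toLpLin_apply, hy]

lemma mem_primalInt_iff {x₀ : Vec n} (h₀ : x₀ ∈ P.primalInt) (x : Vec n) :
    x ∈ P.primalInt ↔ x - x₀ ∈ P.W ∧ ∀ i, 0 < x i := by
  rw [mem_W_iff]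
  have : P.A *ᵥ (x - x₀).ofLp = P.A *ᵥ x.ofLp - P.b := by
    rw [WithLp.ofLp_sub, Matrix.mulVec_sub, h₀.1]
  rw [this, sub_eq_zero]
  rfl

lemma mem_dualInt_iff {s₀ : Vec n} (h₀ : s₀ ∈ P.dualInt) (s : Vec n) :
    s ∈ P.dualInt ↔ s - s₀ ∈ P.Wᗮ ∧ ∀ i, 0 < s i := by
  rw [mem_Worth_iff]
  obtain ⟨y₀, hy₀⟩ := h₀.1
  have : (∃ y, P.Aᵀ *ᵥ y + s.ofLp = P.c) ↔ ∃ y, P.Aᵀ *ᵥ y = (s - s₀).ofLp := by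
    constructor
    · rintro ⟨y, hy⟩
      refine ⟨y₀ - y, ?_⟩
      rw [Matrix.mulVec_sub, WithLp.ofLp_sub, sub_eq_sub_iff_add_eq_add, hy₀, add_comm, hy]
    · rintro ⟨y, hy⟩
      refine ⟨y₀ - y, ?_⟩
      rw [Matrix.mulVec_sub, hy, WithLp.ofLp_sub, ← hy₀]
      abel
  rw [← this]
  rfl

lemma pos_of_mem_nbhd {b : ℝ} {z : State n} (hz : z ∈ P.nbhd b) :
    (∀ i, 0 < z.1 i) ∧ ∀ i, 0 < z.2 i := ⟨hz.1.2, hz.2.1.2⟩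

lemma norm_le_iff_of_gap_pos {b : ℝ} {z : State n} (h : 0 < gap z) :
    ‖(gap z)⁻¹ • had z.1 z.2 - ones n‖ ≤ b ↔ ‖had z.1 z.2 - gap z • ones n‖ ≤ b * gap z := by
  have : had z.1 z.2 - gap z • ones n = gap z • ((gap z)⁻¹ • had z.1 z.2 - ones n) := by
    rw [smul_sub, smul_inv_smul₀ h.ne']
  rw [this, norm_smul, Real.norm_eq_abs, abs_of_pos h, mul_comm, mul_le_mul_iff_left₀ h]

lemma abs_mul_sub_gap_le {b : ℝ} {z : State n}
    (h : ‖had z.1 z.2 - gap z • ones n‖ ≤ b * gap z) (i : Fin n) :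
    |z.1 i * z.2 i - gap z| ≤ b * gap z := by
  have := (abs_apply_le_norm (had z.1 z.2 - gap z • ones n) i).trans h
  simpa using this

lemma inner_eq_zero_of_mem {Δ : State n} (h1 : Δ.1 ∈ P.W) (h2 : Δ.2 ∈ P.Wᗮ) :
    inner ℝ Δ.1 Δ.2 = 0 := (Submodule.mem_orthogonal _ _).1 h2 _ h1

/-- A feasible segment whose points all satisfy the centrality inequality with a positive gap stays
in the neighbourhood. -/
lemma segment_mem_nbhd {b b₀ : ℝ} (hb : b < 1) {z Δ : State n} (hz : z ∈ P.nbhd b₀)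
    (h1 : Δ.1 ∈ P.W) (h2 : Δ.2 ∈ P.Wᗮ) {α₀ : ℝ}
    (h : ∀ α ∈ Set.Ico 0 α₀, 0 < gap (z + α • Δ) ∧
      ‖had (z + α • Δ).1 (z + α • Δ).2 - gap (z + α • Δ) • ones n‖ ≤ b * gap (z + α • Δ)) :
    ∀ α ∈ Set.Ico 0 α₀, z + α • Δ ∈ P.nbhd b := by
  intro α hα
  have hprod : ∀ t ∈ Set.Icc 0 α, ∀ i, 0 < (z + t • Δ).1 i * (z + t • Δ).2 i := by
    intro t ht i
    obtain ⟨h3, h4⟩ := h t ⟨ht.1, ht.2.trans_lt hα.2⟩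
    have := (abs_le.1 (abs_mul_sub_gap_le h4 i)).1
    nlinarith
  -- Centrality keeps every product positive along the segment, so by the intermediate value theorem
  -- no coordinate can cross zero.
  have hcross : ∀ a d : ℝ, 0 < a → (∀ t ∈ Set.Icc 0 α, a + t * d ≠ 0) → 0 < a + α * d := by
    intro a d ha hne
    by_contra hcon
    have hc : ContinuousOn (fun t : ℝ => a + t * d) (Set.Icc 0 α) := by fun_prop
    obtain ⟨t, ht, ht0⟩ := intermediate_value_Icc' hα.1 hc
      (show (0 : ℝ) ∈ Set.Icc (a + α * d) (a + 0 * d) from ⟨not_lt.1 hcon, by simpa using ha.le⟩)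
    exact hne t ht ht0
  obtain ⟨hx, hs⟩ := pos_of_mem_nbhd hz
  refine ⟨?_, ?_, (norm_le_iff_of_gap_pos (h α hα).1).2 (h α hα).2⟩
  · rw [mem_primalInt_iff hz.1]
    refine ⟨?_, fun i => ?_⟩
    · have : (z + α • Δ).1 - z.1 = α • Δ.1 := by simp
      rw [this]
      exact P.W.smul_mem _ h1
    · refine hcross (z.1 i) (Δ.1 i) (hx i) fun t ht h0 => ?_
      have := hprod t ht i
      have e : (z + t • Δ).1 i = z.1 i + t * Δ.1 i := by simp
      rw [e, h0, zero_mul] at this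
      exact lt_irrefl _ this
  · rw [mem_dualInt_iff hz.2.1]
    refine ⟨?_, fun i => ?_⟩
    · have : (z + α • Δ).2 - z.2 = α • Δ.2 := by simp
      rw [this]
      exact P.Wᗮ.smul_mem _ h2
    · refine hcross (z.2 i) (Δ.2 i) (hs i) fun t ht h0 => ?_
      have := hprod t ht i
      have e : (z + t • Δ).2 i = z.2 i + t * Δ.2 i := by simp
      rw [e, h0, mul_zero] at this
      exact lt_irrefl _ this

lemma mem_closure_of_segment {b α : ℝ} {z Δ : State n} (hα : 0 < α)
    (h : ∀ t ∈ Set.Ico 0 α, z + t • Δ ∈ P.nbhd b) : z + α • Δ ∈ closure (P.nbhd b) := by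
  have hc : Continuous fun t : ℝ => z + t • Δ := by fun_prop
  have hmaps : Set.MapsTo (fun t : ℝ => z + t • Δ) (Set.Ico 0 α) (P.nbhd b) := h
  have := hmaps.closure hc
  rw [closure_Ico hα.ne] at this
  exact this ⟨hα.le, le_rfl⟩

lemma nonneg_of_mem_closure {b : ℝ} {z : State n} (h : z ∈ closure (P.nbhd b)) :
    (∀ i, 0 ≤ z.1 i) ∧ ∀ i, 0 ≤ z.2 i := by
  have hcl : IsClosed {z : State n | (∀ i, 0 ≤ z.1 i) ∧ ∀ i, 0 ≤ z.2 i} := by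
    have : {z : State n | (∀ i, 0 ≤ z.1 i) ∧ ∀ i, 0 ≤ z.2 i} =
        (⋂ i, {z : State n | 0 ≤ z.1 i}) ∩ ⋂ i, {z : State n | 0 ≤ z.2 i} := by
      ext
      simp
    rw [this]
    exact (isClosed_iInter fun i => isClosed_le continuous_const (by fun_prop)).inter
      (isClosed_iInter fun i => isClosed_le continuous_const (by fun_prop))
  refine closure_minimal (fun w hw => ?_) hcl h
  exact ⟨fun i => ((pos_of_mem_nbhd hw).1 i).le, fun i => ((pos_of_mem_nbhd hw).2 i).le⟩

lemma gap_nonneg_of_mem_closure {b : ℝ} {z : State n} (h : z ∈ closure (P.nbhd b)) :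
    0 ≤ gap z := by
  obtain ⟨h1, h2⟩ := nonneg_of_mem_closure h
  exact div_nonneg (Finset.sum_nonneg fun i _ => mul_nonneg (h1 i) (h2 i)) (by positivity)

/-- With the division by the gap cleared, the centrality inequality is a closed condition. At
positive gap it bounds all products away from zero, so no coordinate of a limit vanishes. -/
lemma mem_nbhd_of_mem_closure (hn : 0 < n) {b : ℝ} (hb : b < 1) {z : State n}
    (h : z ∈ closure (P.nbhd b)) (hg : 0 < gap z) : z ∈ P.nbhd b := by
  obtain ⟨z₀, hz₀⟩ : (P.nbhd b).Nonempty := closure_nonempty_iff.1 ⟨z, h⟩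
  have hcl : IsClosed {w : State n | w.1 - z₀.1 ∈ P.W ∧ w.2 - z₀.2 ∈ P.Wᗮ ∧
      ‖had w.1 w.2 - gap w • ones n‖ ≤ b * gap w} := by
    refine IsClosed.inter ?_ (IsClosed.inter ?_ ?_)
    · exact (Submodule.closed_of_finiteDimensional P.W).preimage
        (f := fun w : State n => w.1 - z₀.1) (by fun_prop)
    · exact (Submodule.closed_of_finiteDimensional P.Wᗮ).preimage
        (f := fun w : State n => w.2 - z₀.2) (by fun_prop)
    · exact isClosed_le ((continuous_had.sub (continuous_gap.smul continuous_const)).norm)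
        (continuous_const.mul continuous_gap)
  obtain ⟨h1, h2, h3⟩ := closure_minimal (fun w hw => by
    have hpos := pos_of_mem_nbhd hw
    exact ⟨((mem_primalInt_iff hz₀.1 _).1 hw.1).1, ((mem_dualInt_iff hz₀.2.1 _).1 hw.2.1).1,
      (norm_le_iff_of_gap_pos (gap_pos hn hpos.1 hpos.2)).1 hw.2.2⟩) hcl h
  obtain ⟨hx, hs⟩ := nonneg_of_mem_closure h
  have hprod : ∀ i, 0 < z.1 i * z.2 i := fun i => by
    have := (abs_le.1 (abs_mul_sub_gap_le h3 i)).1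
    nlinarith
  refine ⟨(mem_primalInt_iff hz₀.1 _).2 ⟨h1, fun i => ?_⟩,
    (mem_dualInt_iff hz₀.2.1 _).2 ⟨h2, fun i => ?_⟩, (norm_le_iff_of_gap_pos hg).2 h3⟩
  · exact pos_of_mul_pos_left (hprod i) (hs i)
  · exact pos_of_mul_pos_right (hprod i) (hx i)

end LP

/-! ## Local coordinates -/

section Local

variable {m n : ℕ} {P : LP m n} {z : State n}

lemma xi_pos (hx : ∀ i, 0 < z.1 i) (hs : ∀ i, 0 < z.2 i) (hg : 0 < gap z) (i : Fin n) :
    0 < xi z i :=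
  div_pos (mul_pos (Real.sqrt_pos.2 (hx i)) (Real.sqrt_pos.2 (hs i))) (Real.sqrt_pos.2 hg)

lemma xi_sq_mul_gap (hx : ∀ i, 0 < z.1 i) (hs : ∀ i, 0 < z.2 i) (hg : 0 < gap z) (i : Fin n) :
    xi z i ^ 2 * gap z = z.1 i * z.2 i := by
  show (√(z.1 i) * √(z.2 i) / √(gap z)) ^ 2 * gap z = _
  rw [div_pow, mul_pow, Real.sq_sqrt (hx i).le, Real.sq_sqrt (hs i).le, Real.sq_sqrt hg.le,
    div_mul_cancel₀ _ hg.ne']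

lemma xhat_pos (hx : ∀ i, 0 < z.1 i) (hs : ∀ i, 0 < z.2 i) (hg : 0 < gap z) (i : Fin n) :
    0 < xhat z i := mul_pos (hx i) (inv_pos.2 (xi_pos hx hs hg i))

lemma shat_pos (hx : ∀ i, 0 < z.1 i) (hs : ∀ i, 0 < z.2 i) (hg : 0 < gap z) (i : Fin n) :
    0 < shat z i := mul_pos (hs i) (inv_pos.2 (xi_pos hx hs hg i))

lemma xhat_mul_xi (hx : ∀ i, 0 < z.1 i) (hs : ∀ i, 0 < z.2 i) (hg : 0 < gap z) (i : Fin n) :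
    xhat z i * xi z i = z.1 i := by
  rw [xhat, had_apply, vinv_apply, inv_mul_cancel_right₀ (xi_pos hx hs hg i).ne']

lemma shat_mul_xi (hx : ∀ i, 0 < z.1 i) (hs : ∀ i, 0 < z.2 i) (hg : 0 < gap z) (i : Fin n) :
    shat z i * xi z i = z.2 i := by
  rw [shat, had_apply, vinv_apply, inv_mul_cancel_right₀ (xi_pos hx hs hg i).ne']

lemma xhat_mul_shat (hx : ∀ i, 0 < z.1 i) (hs : ∀ i, 0 < z.2 i) (hg : 0 < gap z) (i : Fin n) :
    xhat z i * shat z i = gap z := by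
  have h1 := xhat_mul_xi hx hs hg i
  have h2 := shat_mul_xi hx hs hg i
  have h3 := xi_sq_mul_gap hx hs hg i
  have h4 := pow_pos (xi_pos hx hs hg i) 2
  rw [← h1, ← h2] at h3
  apply mul_left_cancel₀ h4.ne'
  rw [h3]
  ring

lemma norm_xi (hn : 0 < n) (hx : ∀ i, 0 < z.1 i) (hs : ∀ i, 0 < z.2 i) (hg : 0 < gap z) :
    ‖xi z‖ = √n := by
  rw [EuclideanSpace.norm_eq]
  congr 1
  apply mul_right_cancel₀ hg.ne'
  rw [gap_mul hn, Finset.sum_mul]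
  refine Finset.sum_congr rfl fun i _ => ?_
  rw [Real.norm_eq_abs, sq_abs, xi_sq_mul_gap hx hs hg]

lemma mem_scaled_vinv {a : Vec n} (ha : ∀ i, 0 < a i) (W : Submodule ℝ (Vec n)) (v : Vec n) :
    v ∈ scaled (vinv a) W ↔ had a v ∈ W := by
  constructor
  · rintro ⟨w, hw, rfl⟩
    have : had a (scale (vinv a) w) = w := by
      ext i
      rw [had_apply, scale_apply, vinv_apply, mul_inv_cancel_left₀ (ha i).ne']
    rwa [this]
  · intro h
    refine ⟨_, h, ?_⟩
    ext i
    rw [scale_apply, had_apply, vinv_apply, inv_mul_cancel_left₀ (ha i).ne']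

/-- Since the two scalings multiply coordinate-wise to the constant `gap z`, rescaling preserves
orthogonality up to that factor. -/
lemma dualLocal_eq_orthogonal (hx : ∀ i, 0 < z.1 i) (hs : ∀ i, 0 < z.2 i) (hg : 0 < gap z) :
    P.dualLocal z = (P.primalLocal z)ᗮ := by
  ext v
  unfold LP.dualLocal LP.primalLocal
  rw [mem_scaled_vinv (shat_pos hx hs hg), Submodule.mem_orthogonal, Submodule.mem_orthogonal]
  have key : ∀ w : Vec n, inner ℝ (had (xhat z) w) (had (shat z) v) = gap z * inner ℝ w v := by
    intro w
    rw [inner_eq_sum, inner_eq_sum, Finset.mul_sum]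
    refine Finset.sum_congr rfl fun i _ => ?_
    rw [had_apply, had_apply, ← xhat_mul_shat hx hs hg i]
    ring
  constructor
  · intro h u hu
    have := h _ ((mem_scaled_vinv (xhat_pos hx hs hg) _ _).1 hu)
    rw [key] at this
    exact (mul_eq_zero.1 this).resolve_left hg.ne'
  · intro h u hu
    have := h (scale (vinv (xhat z)) u) ⟨u, hu, rfl⟩
    have e : had (xhat z) (scale (vinv (xhat z)) u) = u := by
      ext i
      rw [had_apply, scale_apply, vinv_apply, mul_inv_cancel_left₀ (xhat_pos hx hs hg i).ne']
    rw [← e, key, this, mul_zero]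

/-- A Newton direction in local coordinates. -/
lemma LP.IsNewtonDir.local {ν : ℝ} {Δ : State n} (h : P.IsNewtonDir ν z Δ)
    (hx : ∀ i, 0 < z.1 i) (hs : ∀ i, 0 < z.2 i) (hg : 0 < gap z) :
    ∃ dx ∈ P.primalLocal z, ∃ ds ∈ (P.primalLocal z)ᗮ, Δ = (had (xhat z) dx, had (shat z) ds) ∧
      ∀ i, dx i + ds i = ν * (xi z i)⁻¹ - xi z i := by
  have hxh := xhat_pos hx hs hg
  have hsh := shat_pos hx hs hg
  obtain ⟨h1, h2, h3⟩ := h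
  refine ⟨scale (vinv (xhat z)) Δ.1, ⟨_, h1, rfl⟩, scale (vinv (shat z)) Δ.2, ?_, ?_, ?_⟩
  · rw [← dualLocal_eq_orthogonal hx hs hg]
    exact ⟨_, h2, rfl⟩
  · refine Prod.ext ?_ ?_
    · ext i
      rw [had_apply, scale_apply, vinv_apply, mul_inv_cancel_left₀ (hxh i).ne']
    · ext i
      rw [had_apply, scale_apply, vinv_apply, mul_inv_cancel_left₀ (hsh i).ne']
  · intro i
    have h3i := congrArg (fun v : Vec n => v i) h3
    simp only [PiLp.add_apply, PiLp.sub_apply, had_apply, PiLp.smul_apply, ones_apply,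
      smul_eq_mul, mul_one] at h3i
    rw [scale_apply, scale_apply, vinv_apply, vinv_apply]
    have e1 := xhat_mul_xi hx hs hg i
    have e2 := shat_mul_xi hx hs hg i
    have e3 := xhat_mul_shat hx hs hg i
    have hξ := xi_pos hx hs hg i
    have a1 := hxh i
    have a2 := hsh i
    rw [← e1, ← e2, ← e3] at h3i
    generalize xhat z i = a at *
    generalize shat z i = b at *
    generalize xi z i = c at *
    field_simp
    linear_combination h3i

lemma LP.exists_isNewtonDir (ν : ℝ) (hx : ∀ i, 0 < z.1 i) (hs : ∀ i, 0 < z.2 i)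
    (hg : 0 < gap z) : ∃ Δ, P.IsNewtonDir ν z Δ := by
  set h : Vec n := ν • vinv (xi z) - xi z with hh
  set dx := (P.primalLocal z).starProjection h with hdx
  have hdxm : dx ∈ P.primalLocal z := Submodule.starProjection_apply_mem _ _
  have hdsm : h - dx ∈ P.dualLocal z := by
    rw [dualLocal_eq_orthogonal hx hs hg]
    exact Submodule.sub_starProjection_mem_orthogonal _
  refine ⟨(had (xhat z) dx, had (shat z) (h - dx)),
    (mem_scaled_vinv (xhat_pos hx hs hg) _ _).1 hdxm,
    (mem_scaled_vinv (shat_pos hx hs hg) _ _).1 hdsm, ?_⟩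
  ext i
  have e1 := xhat_mul_xi hx hs hg i
  have e2 := shat_mul_xi hx hs hg i
  have e3 := xhat_mul_shat hx hs hg i
  have hξ := xi_pos hx hs hg i
  simp only [PiLp.add_apply, PiLp.sub_apply, had_apply, PiLp.smul_apply, ones_apply,
      smul_eq_mul, mul_one, hh, vinv_apply]
  rw [← e1, ← e2, ← e3]
  field_simp
  ring

lemma norm_sq_add_of_orthogonal {X : Submodule ℝ (Vec n)} {u v : Vec n} (hu : u ∈ X)
    (hv : v ∈ Xᗮ) : ‖u + v‖ ^ 2 = ‖u‖ ^ 2 + ‖v‖ ^ 2 := by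
  have h := norm_add_sq_real u v
  rw [(Submodule.mem_orthogonal _ v).1 hv u hu] at h
  linarith

lemma norm_had_le_of_orthogonal {X : Submodule ℝ (Vec n)} {u v : Vec n} (hu : u ∈ X)
    (hv : v ∈ Xᗮ) : ‖had u v‖ ≤ ‖u + v‖ ^ 2 / 2 := by
  have h1 := norm_sq_add_of_orthogonal hu hv
  have h2 := norm_had_le u v
  nlinarith [sq_nonneg (‖u‖ - ‖v‖)]

lemma had_local (hx : ∀ i, 0 < z.1 i) (hs : ∀ i, 0 < z.2 i) (hg : 0 < gap z) (u v : Vec n) :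
    had (had (xhat z) u) (had (shat z) v) = gap z • had u v := by
  ext i
  simp only [had_apply, PiLp.smul_apply, smul_eq_mul]
  rw [← xhat_mul_shat hx hs hg i]
  ring

lemma xi_sq_bounds {b : ℝ} (hx : ∀ i, 0 < z.1 i) (hs : ∀ i, 0 < z.2 i) (hg : 0 < gap z)
    (h : ‖(gap z)⁻¹ • had z.1 z.2 - ones n‖ ≤ b) (i : Fin n) :
    1 - b ≤ xi z i ^ 2 ∧ xi z i ^ 2 ≤ 1 + b := by
  have h1 := LP.abs_mul_sub_gap_le ((LP.norm_le_iff_of_gap_pos hg).1 h) i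
  rw [← xi_sq_mul_gap hx hs hg i, abs_le] at h1
  constructor
  · by_contra hcon
    nlinarith
  · by_contra hcon
    nlinarith

/-- The corrector step brings a point of `𝒩²(2β)` back to `𝒩²(β)` and keeps the gap. -/
lemma LP.corrector_mem_nbhd (hn : 0 < n) {β : ℝ} (hβ0 : 0 < β) (hβ : β ≤ 1 / 6)
    (hz : z ∈ P.nbhd (2 * β)) {Δ : State n} (hΔ : P.IsNewtonDir 1 z Δ) :
    z + Δ ∈ P.nbhd β ∧ gap (z + Δ) = gap z := by
  obtain ⟨hx, hs⟩ := LP.pos_of_mem_nbhd hz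
  have hg := gap_pos hn hx hs
  have hprod : ∀ i, (z + Δ).1 i * (z + Δ).2 i = gap z + Δ.1 i * Δ.2 i := by
    intro i
    have h3i := congrArg (fun v : Vec n => v i) hΔ.2.2
    simp only [PiLp.add_apply, PiLp.sub_apply, had_apply, PiLp.smul_apply, ones_apply,
      smul_eq_mul, mul_one, one_mul] at h3i
    simp only [Prod.fst_add, Prod.snd_add, PiLp.add_apply]
    linear_combination h3i
  have horth := LP.inner_eq_zero_of_mem hΔ.1 hΔ.2.1
  have hgap : gap (z + Δ) = gap z := by
    have hn' : (n : ℝ) ≠ 0 := by exact_mod_cast hn.ne'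
    apply mul_left_cancel₀ hn'
    rw [gap_mul hn, Finset.sum_congr rfl fun i _ => hprod i, Finset.sum_add_distrib,
      ← inner_eq_sum, horth]
    simp
  obtain ⟨dx, hdx, ds, hds, rfl, hsum⟩ := hΔ.local hx hs hg
  have hξ := xi_sq_bounds hx hs hg hz.2.2
  have hξ0 := xi_pos hx hs hg
  -- On `𝒩²(2β)` one has `ξ ^ 2 ≥ 1 - 2 * β ≥ 2 / 3`, so dividing by `ξ` costs `3 / 2` in the
  -- square. The new centrality error is then at most `3 * β ^ 2 ≤ β`.
  have hnorm : ‖dx + ds‖ ^ 2 ≤ 6 * β ^ 2 := by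
    have h1 : ‖(gap z)⁻¹ • had z.1 z.2 - ones n‖ ^ 2 ≤ (2 * β) ^ 2 :=
      pow_le_pow_left₀ (norm_nonneg _) hz.2.2 2
    rw [EuclideanSpace.real_norm_sq_eq] at h1 ⊢
    have h2 : ∑ i, (dx + ds) i ^ 2 ≤
        ∑ i, (3 / 2) * (((gap z)⁻¹ • had z.1 z.2 - ones n) i) ^ 2 := by
      refine Finset.sum_le_sum fun i _ => ?_
      have e1 : ((gap z)⁻¹ • had z.1 z.2 - ones n) i = xi z i ^ 2 - 1 := by
        simp only [PiLp.sub_apply, PiLp.smul_apply, had_apply, ones_apply, smul_eq_mul]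
        rw [← xi_sq_mul_gap hx hs hg i]
        field_simp
      have e2 : (dx + ds) i = -((xi z i ^ 2 - 1) * (xi z i)⁻¹) := by
        rw [PiLp.add_apply, hsum i]
        have := (hξ0 i).ne'
        field_simp
        ring
      rw [e1, e2, neg_sq, mul_pow, mul_comm]
      gcongr
      rw [inv_pow]
      refine inv_le_of_inv_le₀ (by norm_num) ?_
      have := (hξ i).1
      norm_num
      linarith
    rw [← Finset.mul_sum] at h2
    linarith
  have hpyth := norm_sq_add_of_orthogonal hdx hds
  have hsmall : ∀ i, xi z i ^ 2 ≥ 2 / 3 := fun i => by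
    have := (hξ i).1
    linarith
  have hβ2 : β ^ 2 ≤ 1 / 36 := by nlinarith
  refine ⟨⟨?_, ?_, ?_⟩, hgap⟩
  · rw [mem_primalInt_iff hz.1]
    refine ⟨?_, fun i => ?_⟩
    · simpa using hΔ.1
    · have e : (z + (had (xhat z) dx, had (shat z) ds)).1 i = xhat z i * (xi z i + dx i) := by
        rw [mul_add, xhat_mul_xi hx hs hg]
        simp
      rw [e]
      refine mul_pos (xhat_pos hx hs hg i) ?_
      have h1 : dx i ^ 2 ≤ ‖dx‖ ^ 2 := by
        rw [← sq_abs]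
        exact pow_le_pow_left₀ (abs_nonneg _) (abs_apply_le_norm dx i) 2
      have := hsmall i
      have := hξ0 i
      by_contra hcon
      nlinarith [sq_nonneg ‖ds‖]
  · rw [mem_dualInt_iff hz.2.1]
    refine ⟨?_, fun i => ?_⟩
    · simpa using hΔ.2.1
    · have e : (z + (had (xhat z) dx, had (shat z) ds)).2 i = shat z i * (xi z i + ds i) := by
        rw [mul_add, shat_mul_xi hx hs hg]
        simp
      rw [e]
      refine mul_pos (shat_pos hx hs hg i) ?_
      have h1 : ds i ^ 2 ≤ ‖ds‖ ^ 2 := by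
        rw [← sq_abs]
        exact pow_le_pow_left₀ (abs_nonneg _) (abs_apply_le_norm ds i) 2
      have := hsmall i
      have := hξ0 i
      by_contra hcon
      nlinarith [sq_nonneg ‖dx‖]
  · rw [LP.norm_le_iff_of_gap_pos (by rwa [hgap]), hgap]
    have e : had (z + (had (xhat z) dx, had (shat z) ds)).1
        (z + (had (xhat z) dx, had (shat z) ds)).2 - gap z • ones n = gap z • had dx ds := by
      rw [← had_local hx hs hg]
      ext i
      have := hprod i
      simp only [PiLp.sub_apply, had_apply, PiLp.smul_apply, ones_apply, smul_eq_mul,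
        mul_one] at this ⊢
      rw [this]
      ring
    rw [e, norm_smul, Real.norm_eq_abs, abs_of_pos hg, mul_comm]
    gcongr
    refine (norm_had_le_of_orthogonal hdx hds).trans ?_
    nlinarith

end Local

namespace LP

variable {m n : ℕ} {P : LP m n} {z : State n} {β : ℝ}

/-! ## One iteration -/

lemma had_add_affine {Δ : State n} (h : P.IsNewtonDir 0 z Δ) :
    had (z + Δ).1 (z + Δ).2 = had Δ.1 Δ.2 := by
  ext i
  have h3i := congrArg (fun v : Vec n => v i) h.2.2
  simp only [PiLp.add_apply, PiLp.sub_apply, had_apply, PiLp.smul_apply, ones_apply,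
      smul_eq_mul, mul_one, zero_mul] at h3i
  simp only [Prod.fst_add, Prod.snd_add, PiLp.add_apply, had_apply]
  linear_combination h3i

lemma gap_add_affine (hn : 0 < n) {Δ : State n} (h : P.IsNewtonDir 0 z Δ) : gap (z + Δ) = 0 := by
  have hn' : (n : ℝ) ≠ 0 := by exact_mod_cast hn.ne'
  apply mul_left_cancel₀ hn'
  have h1 : ∀ i, (z + Δ).1 i * (z + Δ).2 i = Δ.1 i * Δ.2 i := fun i =>
    congrArg (fun v : Vec n => v i) (had_add_affine h)
  rw [gap_mul hn, Finset.sum_congr rfl fun i _ => h1 i, ← inner_eq_sum,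
    inner_eq_zero_of_mem h.1 h.2.1, mul_zero]

lemma gap_add_smul_affine (hn : 0 < n) {Δ : State n} (h : P.IsNewtonDir 0 z Δ) (α : ℝ) :
    gap (z + α • Δ) = (1 - α) * gap z := by
  rw [gap_add_smul hn (inner_eq_zero_of_mem h.1 h.2.1), gap_add_affine hn h, mul_zero, add_zero]

/-- In local coordinates the affine direction splits `-ξ` orthogonally, and `‖ξ‖ ^ 2 = n`. -/
lemma norm_had_affine_le (hn : 0 < n) {Δ : State n} (h : P.IsNewtonDir 0 z Δ)
    (hx : ∀ i, 0 < z.1 i) (hs : ∀ i, 0 < z.2 i) : ‖had Δ.1 Δ.2‖ ≤ gap z * (n / 2) := by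
  have hg := gap_pos hn hx hs
  obtain ⟨dx, hdx, ds, hds, rfl, hsum⟩ := h.local hx hs hg
  rw [had_local hx hs hg, norm_smul, Real.norm_eq_abs, abs_of_pos hg]
  refine mul_le_mul_of_nonneg_left ?_ hg.le
  refine (norm_had_le_of_orthogonal hdx hds).trans_eq ?_
  have : dx + ds = -xi z := by
    ext i
    simpa using hsum i
  rw [this, norm_neg, norm_xi hn hx hs hg, Real.sq_sqrt (by positivity)]

lemma one_le_sqrt_natCast (hn : 0 < n) : 1 ≤ √(n : ℝ) := by
  rw [Real.one_le_sqrt]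
  exact_mod_cast hn

lemma exists_isAffineStepLength (hn : 0 < n) (hβ0 : 0 < β) (hβ : β ≤ 1 / 6)
    (hz : z ∈ P.nbhd β) {Δ : State n} (h : P.IsNewtonDir 0 z Δ) :
    ∃ α, P.IsAffineStepLength β z Δ α := by
  obtain ⟨hx, hs⟩ := pos_of_mem_nbhd hz
  have hg := gap_pos hn hx hs
  have hsq := one_le_sqrt_natCast hn
  have hsq2 : √(n : ℝ) ^ 2 = n := Real.sq_sqrt (by positivity)
  set D := ‖had Δ.1 Δ.2‖ with hD
  have hD0 : 0 ≤ D := norm_nonneg _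
  have hDn := norm_had_affine_le hn h hx hs
  rw [← hD] at hDn
  have hβn : β / √n ≤ 1 / 6 := by
    rw [div_le_iff₀ (by positivity)]
    nlinarith
  have h1 : max (β / √n) (1 - D / (β * gap z)) ≤ 1 := by
    refine max_le (by linarith) ?_
    have : 0 ≤ D / (β * gap z) := by positivity
    linarith
  refine ⟨_, le_rfl, h1, ?_⟩
  refine segment_mem_nbhd (by linarith) hz h.1 h.2.1 fun α hα => ?_
  have hα1 : α < 1 := hα.2.trans_le h1
  rw [gap_add_smul_affine hn h]
  refine ⟨mul_pos (by linarith) hg, ?_⟩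
  have e : had (z + α • Δ).1 (z + α • Δ).2 - ((1 - α) * gap z) • ones n =
      (1 - α) • (had z.1 z.2 - gap z • ones n) + α ^ 2 • had Δ.1 Δ.2 := by
    rw [had_add_smul, had_add_affine h]
    module
  have hz' := (norm_le_iff_of_gap_pos hg).1 hz.2.2
  -- The second-order term may use up the `β` gained by enlarging the neighbourhood. Each of the two
  -- guaranteed lengths ensures this.
  have key : α ^ 2 * D ≤ β * ((1 - α) * gap z) := by
    rcases lt_max_iff.1 hα.2 with h2 | h2
    · have h3 : α * √n ≤ β := ((lt_div_iff₀ (by positivity)).1 h2).le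
      have h4 : α ^ 2 * n ≤ β ^ 2 := by
        rw [← hsq2, ← mul_pow]
        exact pow_le_pow_left₀ (by have := hα.1; positivity) h3 2
      calc α ^ 2 * D ≤ α ^ 2 * (gap z * (n / 2)) := by gcongr
        _ = (α ^ 2 * n) * gap z / 2 := by ring
        _ ≤ β ^ 2 * gap z / 2 := by gcongr
        _ = β * (β / 2 * gap z) := by ring
        _ ≤ _ := by
          gcongr
          linarith
    · have h3 : D / (β * gap z) < 1 - α := by linarith
      rw [div_lt_iff₀ (by positivity)] at h3
      calc α ^ 2 * D ≤ 1 * D := by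
            gcongr
            exact pow_le_one₀ hα.1 hα1.le
        _ ≤ (1 - α) * (β * gap z) := by linarith
        _ = _ := by ring
  rw [e]
  refine (norm_add_le _ _).trans ?_
  rw [norm_smul, norm_smul, Real.norm_eq_abs, Real.norm_eq_abs, abs_of_pos (by linarith : 0 < 1 - α),
    abs_of_nonneg (sq_nonneg α)]
  have := mul_le_mul_of_nonneg_left hz' (by linarith : 0 ≤ 1 - α)
  linarith

/-- The general step-length estimate. -/
lemma lls_segment (hn : 0 < n) (hβ0 : 0 < β) (hβ : β ≤ 1 / 6) (hz : z ∈ P.nbhd β)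
    {Δ : State n} (h1 : Δ.1 ∈ P.W) (h2 : Δ.2 ∈ P.Wᗮ) (hpos : 0 < llsStepLength β z Δ) :
    llsStepLength β z Δ ≤ 1 ∧
    (∀ α ∈ Set.Ico 0 (llsStepLength β z Δ), z + α • Δ ∈ P.nbhd (2 * β)) ∧
    gap (z + llsStepLength β z Δ • Δ) ≤
      (1 - llsStepLength β z Δ) * (1 + β / (4 * √n)) * gap z := by
  obtain ⟨hx, hs⟩ := pos_of_mem_nbhd hz
  have hg := gap_pos hn hx hs
  have hsq := one_le_sqrt_natCast hn
  have horth := inner_eq_zero_of_mem h1 h2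
  set E := ‖had (z + Δ).1 (z + Δ).2‖ with hE
  have hE0 : 0 ≤ E := norm_nonneg _
  -- A positive length excludes the branch with value `0` and the truncation at `0`, so the defining
  -- formula holds with equality.
  obtain ⟨hΔ, hα₀⟩ : ‖had Δ.1 Δ.2‖ ≤ β * gap z / 4 ∧
      4 * E = (1 - llsStepLength β z Δ) * β * gap z := by
    unfold llsStepLength at hpos ⊢
    split_ifs at hpos ⊢ with hc
    · refine ⟨hc, ?_⟩
      rcases lt_max_iff.1 hpos with h | h
      · exact absurd h (lt_irrefl _)
      · rw [max_eq_right h.le]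
        have : had (z.1 + Δ.1) (z.2 + Δ.2) = had (z + Δ).1 (z + Δ).2 := rfl
        rw [this, ← hE]
        field_simp
        ring
    · exact absurd hpos (lt_irrefl _)
  set α₀ := llsStepLength β z Δ
  have hα₁ : α₀ ≤ 1 := by
    by_contra hcon
    have : (1 - α₀) * β * gap z < 0 := by
      refine mul_neg_of_neg_of_pos (mul_neg_of_neg_of_pos (by linarith) hβ0) hg
    linarith
  have hgE : √n * |gap (z + Δ)| ≤ E := sqrt_mul_abs_gap_le hn _
  have hgE' : |gap (z + Δ)| ≤ E := by
    have := abs_nonneg (gap (z + Δ))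
    nlinarith
  have hz' := (norm_le_iff_of_gap_pos hg).1 hz.2.2
  refine ⟨hα₁, segment_mem_nbhd (by linarith) hz h1 h2 fun α hα => ?_, ?_⟩
  · have hα1 : 0 < 1 - α := by linarith [hα.2]
    have hE' : 4 * E ≤ (1 - α) * β * gap z := by
      rw [hα₀]
      gcongr
      exact hα.2.le
    have hαE : α * E ≤ E := by
      have := hα.2
      nlinarith
    have hgap : (1 - α) * gap z - E ≤ gap (z + α • Δ) := by
      rw [gap_add_smul hn horth]
      have h3 := (abs_le.1 hgE').1
      have h4 : α * -E ≤ α * gap (z + Δ) := mul_le_mul_of_nonneg_left h3 hα.1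
      linarith
    have hprod : 0 < (1 - α) * gap z := mul_pos hα1 hg
    have hβprod : β * ((1 - α) * gap z) ≤ 1 / 6 * ((1 - α) * gap z) := by gcongr
    refine ⟨by linarith, ?_⟩
    have e : had (z + α • Δ).1 (z + α • Δ).2 - gap (z + α • Δ) • ones n =
        (1 - α) • (had z.1 z.2 - gap z • ones n) +
          α • (had (z + Δ).1 (z + Δ).2 - gap (z + Δ) • ones n) -
          (α * (1 - α)) • had Δ.1 Δ.2 := by
      rw [had_add_smul, gap_add_smul hn horth]
      module
    rw [e]
    refine (norm_sub_le _ _).trans ((add_le_add_left (norm_add_le _ _) _).trans ?_)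
    rw [norm_smul, norm_smul, norm_smul, Real.norm_eq_abs, Real.norm_eq_abs, Real.norm_eq_abs,
      abs_of_pos hα1, abs_of_nonneg hα.1, abs_of_nonneg (mul_nonneg hα.1 hα1.le)]
    have h3 := mul_le_mul_of_nonneg_left hz' hα1.le
    have h4 := mul_le_mul_of_nonneg_left (norm_had_sub_gap_le hn (z + Δ)) hα.1
    rw [← hE] at h4
    have h5 : α * (1 - α) * ‖had Δ.1 Δ.2‖ ≤ 1 * (1 - α) * (β * gap z / 4) := by
      gcongr
      linarith
    have h6 : 2 * β * ((1 - α) * gap z - E) ≤ 2 * β * gap (z + α • Δ) := by gcongr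
    nlinarith
  · rw [gap_add_smul hn horth]
    have h3 : gap (z + Δ) ≤ E / √n := by
      rw [le_div_iff₀ (by positivity), mul_comm]
      exact (mul_le_mul_of_nonneg_left (le_abs_self _) (by positivity)).trans hgE
    have h4 : α₀ * gap (z + Δ) ≤ 1 * (E / √n) :=
      (mul_le_mul_of_nonneg_left h3 hpos.le).trans (by gcongr)
    have h5 : E / √n = (1 - α₀) * (β / (4 * √n)) * gap z := by
      have : E = (1 - α₀) * β * gap z / 4 := by linarith
      rw [this]
      field_simp
    rw [h5] at h4
    linarith

lemma llsDir_mem {Δa : State n} {ν : ℝ} (h : P.IsNewtonDir ν z Δa)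
    (hx : ∀ i, 0 < z.1 i) (hs : ∀ i, 0 < z.2 i) (hg : 0 < gap z) (N : Finset (Fin n))
    (V : Submodule ℝ (VecOn N)) (U : Submodule ℝ (VecOn Nᶜ)) :
    (P.llsDir z Δa N V U).1 ∈ P.W ∧ (P.llsDir z Δa N V U).2 ∈ P.Wᗮ := by
  unfold llsDir
  split_ifs
  · exact ⟨P.W.zero_mem, h.2.1⟩
  · exact ⟨h.1, P.Wᗮ.zero_mem⟩
  · exact ⟨(mem_scaled_vinv (xhat_pos hx hs hg) _ _).1 (liftFull_spec _ _ _).1,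
      (mem_scaled_vinv (shat_pos hx hs hg) _ _).1 (liftFull_spec _ _ _).1⟩

/-- The point reached by the longer of the two steps. -/
lemma longer_step_spec (hn : 0 < n) (hβ0 : 0 < β) (hβ : β ≤ 1 / 6) (hz : z ∈ P.nbhd β)
    {Δa Δl : State n} {α : ℝ} (hΔa : P.IsNewtonDir 0 z Δa) (hα : P.IsAffineStepLength β z Δa α)
    (h1 : Δl.1 ∈ P.W) (h2 : Δl.2 ∈ P.Wᗮ) {zp : State n}
    (hzp : zp = if llsStepLength β z Δl < α then z + α • Δa
      else z + llsStepLength β z Δl • Δl) :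
    zp ∈ closure (P.nbhd (2 * β)) ∧ gap zp ≤ (1 - 3 * β / (4 * √n)) * gap z ∧
      gap zp ≤ 2 * (1 - llsStepLength β z Δl) * gap z := by
  obtain ⟨hx, hs⟩ := pos_of_mem_nbhd hz
  have hg := gap_pos hn hx hs
  have hsq := one_le_sqrt_natCast hn
  have hβn0 : 0 < β / √n := by positivity
  have hβn : β / √n ≤ 1 / 6 := by
    rw [div_le_iff₀ (by positivity)]
    nlinarith
  have hβα : β / √n ≤ α := (le_max_left _ _).trans hα.1
  have h0 : 0 < α := hβn0.trans_le hβα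
  have e1 : 3 * β / (4 * √n) = 3 / 4 * (β / √n) := by
    field_simp
  have e2 : β / (4 * √n) = 1 / 4 * (β / √n) := by
    field_simp
  split_ifs at hzp with hc
  · subst hzp
    refine ⟨mem_closure_of_segment h0 hα.2.2, ?_, ?_⟩
    · rw [gap_add_smul_affine hn hΔa, e1]
      gcongr
      linarith
    · rw [gap_add_smul_affine hn hΔa]
      gcongr
      have := hα.2.1
      linarith
  · subst hzp
    have hle := not_lt.1 hc
    obtain ⟨h3, h4, h5⟩ := lls_segment hn hβ0 hβ hz h1 h2 (h0.trans_le hle)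
    refine ⟨mem_closure_of_segment (h0.trans_le hle) h4, h5.trans ?_, h5.trans ?_⟩
    · rw [e1, e2]
      gcongr
      -- The LLS step is chosen only when it is at least as long as the affine one, hence at least
      -- `t = β / √n`, and `(1 - t) * (1 + t / 4) ≤ 1 - 3 * t / 4`.
      have h6 : (1 - llsStepLength β z Δl) * (1 + 1 / 4 * (β / √n)) ≤
          (1 - β / √n) * (1 + 1 / 4 * (β / √n)) := by
        gcongr
        linarith
      nlinarith
    · rw [e2]
      have h6 : (1 - llsStepLength β z Δl) * (1 + 1 / 4 * (β / √n)) ≤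
          (1 - llsStepLength β z Δl) * 2 := by
        refine mul_le_mul_of_nonneg_left ?_ (by linarith)
        linarith
      nlinarith

/-- `z` is an optimal point in the closure of the larger neighbourhood. -/
def IsOptimalLimit (P : LP m n) (β : ℝ) (z : State n) : Prop :=
  gap z = 0 ∧ z ∈ closure (P.nbhd (2 * β))

lemma corrected_spec (hn : 0 < n) (hβ0 : 0 < β) (hβ : β ≤ 1 / 6) {zp z' : State n}
    (hzp : zp ∈ closure (P.nbhd (2 * β)))
    (h : (0 < gap zp ∧ ∃ Δc, P.IsNewtonDir 1 zp Δc ∧ z' = zp + Δc) ∨ (¬ 0 < gap zp ∧ z' = zp)) :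
    (z' ∈ P.nbhd β ∨ P.IsOptimalLimit β z') ∧ gap z' = gap zp := by
  rcases h with ⟨hg, Δc, hΔ, rfl⟩ | ⟨hg, rfl⟩
  · have := corrector_mem_nbhd hn hβ0 hβ (mem_nbhd_of_mem_closure hn (by linarith) hzp hg) hΔ
    exact ⟨Or.inl this.1, this.2⟩
  · exact ⟨Or.inr ⟨le_antisymm (not_lt.1 hg) (gap_nonneg_of_mem_closure hzp), hzp⟩, rfl⟩

lemma step_spec (hn : 0 < n) (hβ0 : 0 < β) (hβ : β ≤ 1 / 6) (hz : z ∈ P.nbhd β) {z' : State n}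
    (h : P.Step β z z') :
    (z' ∈ P.nbhd β ∨ P.IsOptimalLimit β z') ∧ gap z' ≤ (1 - 3 * β / (4 * √n)) * gap z := by
  obtain ⟨hg, Δa, α, hΔa, hα, V, U, hV, hU, Δl, hΔl, zp, hzp, hz'⟩ := h
  obtain ⟨hx, hs⟩ := pos_of_mem_nbhd hz
  obtain ⟨h1, h2⟩ := llsDir_mem hΔa hx hs hg (assocN z Δa)
    (cheapSub β (P.primalLocal z) (assocN z Δa) V) (cheapSub β (P.dualLocal z) (assocN z Δa)ᶜ U)
  rw [← hΔl] at h1 h2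
  obtain ⟨h3, h4, -⟩ := longer_step_spec hn hβ0 hβ hz hΔa hα h1 h2 hzp
  obtain ⟨h5, h6⟩ := corrected_spec hn hβ0 hβ h3 hz'
  exact ⟨h5, h6 ▸ h4⟩

lemma exists_step (hn : 0 < n) (hβ0 : 0 < β) (hβ : β ≤ 1 / 6) (hz : z ∈ P.nbhd β) :
    ∃ z', P.Step β z z' := by
  obtain ⟨hx, hs⟩ := pos_of_mem_nbhd hz
  have hg := gap_pos hn hx hs
  obtain ⟨Δa, hΔa⟩ := exists_isNewtonDir (P := P) 0 hx hs hg
  obtain ⟨α, hα⟩ := exists_isAffineStepLength hn hβ0 hβ hz hΔa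
  obtain ⟨V, hV⟩ := exists_isApproxSVD (P.primalLocal z) (assocN z Δa)
  obtain ⟨U, hU⟩ := exists_isApproxSVD (P.dualLocal z) (assocN z Δa)ᶜ
  obtain ⟨h1, h2⟩ := llsDir_mem hΔa hx hs hg (assocN z Δa)
    (cheapSub β (P.primalLocal z) (assocN z Δa) V) (cheapSub β (P.dualLocal z) (assocN z Δa)ᶜ U)
  set Δl := P.llsDir z Δa (assocN z Δa)
    (cheapSub β (P.primalLocal z) (assocN z Δa) V) (cheapSub β (P.dualLocal z) (assocN z Δa)ᶜ U)
    with hΔl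
  obtain ⟨zp, hzp⟩ : ∃ zp, zp = if llsStepLength β z Δl < α then z + α • Δa
      else z + llsStepLength β z Δl • Δl := ⟨_, rfl⟩
  obtain ⟨h3, -, -⟩ := longer_step_spec hn hβ0 hβ hz hΔa hα h1 h2 hzp
  by_cases hgp : 0 < gap zp
  · have hpos := pos_of_mem_nbhd (mem_nbhd_of_mem_closure hn (by linarith) h3 hgp)
    obtain ⟨Δc, hΔc⟩ := exists_isNewtonDir (P := P) 1 hpos.1 hpos.2 hgp
    exact ⟨_, hg, Δa, α, hΔa, hα, V, U, hV, hU, Δl, hΔl, zp, hzp, Or.inl ⟨hgp, Δc, hΔc, rfl⟩⟩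
  · exact ⟨_, hg, Δa, α, hΔa, hα, V, U, hV, hU, Δl, hΔl, zp, hzp, Or.inr ⟨hgp, rfl⟩⟩

/-! ## The central path -/

/-- The central path exists as soon as there are strictly feasible points. -/
lemma exists_isCentral {x₀ s₀ : Vec n} (hx₀ : x₀ ∈ P.primalInt) (hs₀ : s₀ ∈ P.dualInt) {μ : ℝ}
    (hμ : 0 < μ) : ∃ z, P.IsCentral μ z := by
  have hs := hs₀.2
  -- The central point minimizes the logarithmic barrier function `f` over the strictly feasible
  -- primal points. The dual objective is represented by the fixed slack `s₀`.
  set h : Fin n → ℝ → ℝ := fun i t => s₀ i * t - μ * Real.log t with hh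
  set f : Vec n → ℝ := fun x => ∑ i, h i (x i) with hf
  -- Half of the linear term dominates the logarithm by `log y ≤ y - 1`, which makes `f` coercive.
  have hlow : ∀ i, ∀ t, 0 < t → s₀ i * t / 2 + (μ - μ * Real.log (2 * μ / s₀ i)) ≤ h i t := by
    intro i t ht
    have e : Real.log t = Real.log (s₀ i * t / (2 * μ)) + Real.log (2 * μ / s₀ i) := by
      have := hs i
      rw [← Real.log_mul (by positivity) (by positivity)]
      congr 1
      field_simp
    have h1 := Real.log_le_sub_one_of_pos (x := s₀ i * t / (2 * μ)) (by have := hs i; positivity)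
    have h2 := mul_le_mul_of_nonneg_left h1 hμ.le
    have e2 : μ * (s₀ i * t / (2 * μ) - 1) = s₀ i * t / 2 - μ := by
      field_simp
    simp only [hh]
    rw [e, mul_add]
    linarith
  set M : ℝ := ∑ i, |μ - μ * Real.log (2 * μ / s₀ i)| with hM
  set c : ℝ := f x₀ + M with hc
  have hbound : ∀ x : Vec n, (∀ i, 0 < x i) → f x ≤ f x₀ → ∀ i, h i (x i) ≤ c := by
    intro x hx hfx i
    have h1 : f x = h i (x i) + ∑ j ∈ Finset.univ.erase i, h j (x j) :=
      (Finset.add_sum_erase _ _ (Finset.mem_univ i)).symm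
    have h2 : -M ≤ ∑ j ∈ Finset.univ.erase i, h j (x j) := by
      calc -M ≤ -∑ j ∈ Finset.univ.erase i, |μ - μ * Real.log (2 * μ / s₀ j)| := by
            rw [neg_le_neg_iff]
            exact Finset.sum_le_sum_of_subset_of_nonneg (Finset.erase_subset _ _)
              fun _ _ _ => abs_nonneg _
        _ = ∑ j ∈ Finset.univ.erase i, -|μ - μ * Real.log (2 * μ / s₀ j)| := by
            rw [Finset.sum_neg_distrib]
        _ ≤ _ := by
            refine Finset.sum_le_sum fun j _ => ?_
            have h3 := hlow j (x j) (hx j)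
            have h4 := neg_abs_le (μ - μ * Real.log (2 * μ / s₀ j))
            have h5 : 0 < s₀ j * x j := mul_pos (hs j) (hx j)
            linarith
    linarith
  -- The sublevel set of `x₀` lies in a box away from zero, so a minimum over a compact set is a
  -- minimum over all strictly feasible points.
  have hbox : ∀ x : Vec n, (∀ i, 0 < x i) → f x ≤ f x₀ →
      ∀ i, Real.exp (-c / μ) ≤ x i ∧ x i ≤ 2 * (c + M) / s₀ i := by
    intro x hx hfx i
    have h1 := hbound x hx hfx i
    have hsi := hs i
    constructor
    · rw [← Real.le_log_iff_exp_le (hx i), div_le_iff₀ hμ]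
      have h2 : 0 < s₀ i * x i := mul_pos hsi (hx i)
      simp only [hh] at h1
      linarith
    · rw [le_div_iff₀ hsi]
      have h2 := hlow i (x i) (hx i)
      have h3 : |μ - μ * Real.log (2 * μ / s₀ i)| ≤ M :=
        Finset.single_le_sum (f := fun i => |μ - μ * Real.log (2 * μ / s₀ i)|)
          (fun _ _ => abs_nonneg _) (Finset.mem_univ i)
      have h4 := neg_abs_le (μ - μ * Real.log (2 * μ / s₀ i))
      linarith
  set K : Set (Vec n) := {x | x - x₀ ∈ P.W ∧
    ∀ i, x i ∈ Set.Icc (Real.exp (-c / μ)) (2 * (c + M) / s₀ i)} with hK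
  have hKc : IsCompact K := by
    have h1 : IsClosed {x : Vec n | x - x₀ ∈ P.W} :=
      (Submodule.closed_of_finiteDimensional P.W).preimage (f := fun x : Vec n => x - x₀)
        (by fun_prop)
    have h2 : IsCompact {x : Vec n | ∀ i, x i ∈ Set.Icc (Real.exp (-c / μ)) (2 * (c + M) / s₀ i)} := by
      have h3 := isCompact_univ_pi fun i =>
        isCompact_Icc (a := Real.exp (-c / μ)) (b := 2 * (c + M) / s₀ i)
      have h4 := h3.image (PiLp.continuous_toLp 2 fun _ : Fin n => ℝ)
      convert h4 using 1
      ext x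
      simp only [Set.mem_image, Set.mem_pi, Set.mem_univ, true_imp_iff]
      constructor
      · exact fun h => ⟨x.ofLp, h, rfl⟩
      · rintro ⟨y, hy, rfl⟩
        exact hy
    exact h2.inter_left h1
  have hx₀K : x₀ ∈ K := ⟨by simp, hbox x₀ hx₀.2 le_rfl⟩
  have hKpos : ∀ x ∈ K, ∀ i, 0 < x i := fun x hx i => (Real.exp_pos _).trans_le (hx.2 i).1
  have hfc : ContinuousOn f K := by
    refine continuousOn_finsetSum _ fun i _ => ?_
    have hxi : ContinuousOn (fun x : Vec n => x i) K := by fun_prop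
    exact (continuousOn_const.mul hxi).sub
      (continuousOn_const.mul (hxi.log fun x hx => (hKpos x hx i).ne'))
  obtain ⟨x, hxK, hmin⟩ := hKc.exists_isMinOn ⟨x₀, hx₀K⟩ hfc
  have hxpos := hKpos x hxK
  have hglob : ∀ y : Vec n, y - x₀ ∈ P.W → (∀ i, 0 < y i) → f x ≤ f y := by
    intro y hy hypos
    rcases le_or_gt (f y) (f x₀) with hle | hgt
    · exact hmin ⟨hy, hbox y hypos hle⟩
    · exact (hmin hx₀K).trans hgt.le
  have hxP : x ∈ P.primalInt := (mem_primalInt_iff hx₀ x).2 ⟨hxK.1, hxpos⟩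
  -- Stationarity of `f` along `W` says exactly that `s₀ - s` is orthogonal to `W`, that is, `s` is
  -- dual feasible.
  set s : Vec n := WithLp.toLp 2 fun i => μ / x i with hsdef
  refine ⟨(x, s), hxP, (mem_dualInt_iff hs₀ s).2 ⟨?_, fun i => div_pos hμ (hxpos i)⟩,
    fun i => mul_div_cancel₀ μ (hxpos i).ne'⟩
  rw [Submodule.mem_orthogonal]
  intro w hw
  have hder : HasDerivAt (fun t : ℝ => f (x + t • w)) (∑ i, (s₀ i - μ / x i) * w i) 0 := by
    simp only [hf]
    refine HasDerivAt.fun_sum fun i _ => ?_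
    have h1 : HasDerivAt (fun t : ℝ => (x + t • w) i) (w i) 0 := by
      have : HasDerivAt (fun t : ℝ => x i + t * w i) (1 * w i) 0 :=
        ((hasDerivAt_id (0 : ℝ)).mul_const (w i)).const_add _
      simpa using this
    have h2 : (x + (0 : ℝ) • w) i ≠ 0 := by
      simpa using (hxpos i).ne'
    have h3 := (h1.const_mul (s₀ i)).sub ((h1.log h2).const_mul μ)
    refine h3.congr_deriv ?_
    simp
    ring
  have hloc : IsLocalMin (fun t : ℝ => f (x + t • w)) 0 := by
    have hev : ∀ᶠ t : ℝ in 𝓝 0, ∀ i, 0 < (x + t • w) i := by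
      rw [Filter.eventually_all]
      intro i
      have hcont : Continuous fun t : ℝ => (x + t • w) i := by
        simp only [PiLp.add_apply, PiLp.smul_apply]
        fun_prop
      refine hcont.continuousAt.eventually (lt_mem_nhds ?_)
      simpa using hxpos i
    filter_upwards [hev] with t ht
    have hW : x + t • w - x₀ ∈ P.W := by
      have : x + t • w - x₀ = (x - x₀) + t • w := by abel
      rw [this]
      exact P.W.add_mem hxK.1 (P.W.smul_mem _ hw)
    simpa using hglob _ hW ht
  have h0 := hloc.hasDerivAt_eq_zero hder
  rw [inner_eq_sum, ← neg_eq_zero, ← h0, ← Finset.sum_neg_distrib]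
  refine Finset.sum_congr rfl fun i _ => ?_
  simp only [hsdef, PiLp.sub_apply]
  ring

lemma isCentral_cp {z₀ : State n} {b : ℝ} (hz₀ : z₀ ∈ P.nbhd b) {μ : ℝ} (hμ : 0 < μ) :
    P.IsCentral μ (P.cp μ) := by
  unfold cp
  rw [if_pos hμ]
  exact Classical.epsilon_spec (exists_isCentral hz₀.1 hz₀.2.1 hμ)

lemma IsCentral.gap_eq (hn : 0 < n) {μ : ℝ} (h : P.IsCentral μ z) : gap z = μ := by
  have hn' : (n : ℝ) ≠ 0 := by exact_mod_cast hn.ne'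
  apply mul_left_cancel₀ hn'
  rw [gap_mul hn, Finset.sum_congr rfl fun i _ => h.2.2 i]
  simp

lemma IsCentral.mem_nbhd (hn : 0 < n) {μ : ℝ} (hμ : 0 < μ) (h : P.IsCentral μ z) {b : ℝ}
    (hb : 0 ≤ b) : z ∈ P.nbhd b := by
  refine ⟨h.1, h.2.1, ?_⟩
  rw [h.gap_eq hn]
  have : μ⁻¹ • had z.1 z.2 - ones n = 0 := by
    ext i
    simp [h.2.2 i, hμ.ne']
  rw [this, norm_zero]
  exact hb

/-- Near monotonicity of strictly feasible pairs. -/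
lemma mul_le_gap_add_gap (hn : 0 < n) {z' : State n} {b b' : ℝ} (hz : z ∈ P.nbhd b)
    (hz' : z' ∈ P.nbhd b') (i : Fin n) : z.1 i * z'.2 i ≤ n * (gap z + gap z') := by
  have h1 : inner ℝ (z.1 - z'.1) (z.2 - z'.2) = 0 :=
    inner_eq_zero_of_mem (Δ := (z.1 - z'.1, z.2 - z'.2)) ((mem_primalInt_iff hz'.1 _).1 hz.1).1
      ((mem_dualInt_iff hz'.2.1 _).1 hz.2.1).1
  rw [inner_sub_left, inner_sub_right, inner_sub_right, ← gap_mul_eq_inner hn,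
    ← gap_mul_eq_inner hn, inner_eq_sum, inner_eq_sum] at h1
  obtain ⟨hx, hs⟩ := pos_of_mem_nbhd hz
  obtain ⟨hx', hs'⟩ := pos_of_mem_nbhd hz'
  have h2 : z.1 i * z'.2 i ≤ ∑ j, z.1 j * z'.2 j :=
    Finset.single_le_sum (f := fun j => z.1 j * z'.2 j)
      (fun j _ => (mul_pos (hx j) (hs' j)).le) (Finset.mem_univ i)
  have h3 : 0 ≤ ∑ j, z'.1 j * z.2 j := Finset.sum_nonneg fun j _ => (mul_pos (hx' j) (hs j)).le
  linarith

end LP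

/-! ## Polarized segments -/

/-- A bound for the distortion of the local scalings along a `γ`-polarized segment. -/
def distortion (n : ℕ) (γ : ℝ) : ℝ := 9 * n ^ 2 / γ

/-- The number of expensive directions at `z`, primal and dual, for the partition `(Nᶜ, N)`. -/
def LP.expensive {m n : ℕ} (P : LP m n) (z : State n) (N : Finset (Fin n)) (t : ℝ) : ℕ :=
  eCount (P.primalLocal z) N t + eCount (P.dualLocal z) Nᶜ t

/-- The standing assumptions on a polarized segment of the central path. -/
structure LP.PolarizedSegment {m n : ℕ} (P : LP m n) (β γ μ₁ μ₀ : ℝ) (N : Finset (Fin n)) :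
    Prop where
  dim_pos : 0 < n
  β_pos : 0 < β
  β_le : β ≤ 1 / 6
  γ_pos : 0 < γ
  γ_le : γ ≤ 1
  nonneg : 0 ≤ μ₁
  lt : μ₁ < μ₀
  central : ∀ μ, 0 < μ → P.IsCentral μ (P.cp μ)
  polarized : P.IsPolarized γ μ₁ μ₀ N

namespace LP

variable {m n : ℕ} {P : LP m n} {z z' : State n} {β γ μ₁ μ₀ : ℝ} {N : Finset (Fin n)}

lemma expensive_antitone (z : State n) (N : Finset (Fin n)) {t t' : ℝ} (h : t ≤ t') :
    P.expensive z N t' ≤ P.expensive z N t :=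
  add_le_add (eCount_antitone _ _ h) (eCount_antitone _ _ h)

lemma expensive_empty (z : State n) {t : ℝ} (ht : 0 ≤ t) : P.expensive z ∅ t = 0 := by
  unfold expensive
  rw [eCount_empty, Finset.compl_empty, eCount_univ _ ht]

lemma expensive_le_add_card_symmDiff (z : State n) (I J : Finset (Fin n)) {t : ℝ} (ht : 0 ≤ t) :
    P.expensive z J t ≤ P.expensive z I t + 2 * (symmDiff J I).card := by
  unfold expensive
  have h1 := eCount_le_add_card_symmDiff (P.primalLocal z) I J ht
  have h2 := eCount_le_add_card_symmDiff (P.dualLocal z) Iᶜ Jᶜ ht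
  rw [compl_symmDiff_compl] at h2
  omega

lemma xi_bounds (hn : 0 < n) (hβ : β ≤ 1 / 6) (hz : z ∈ P.nbhd β) (i : Fin n) :
    9 / 10 ≤ xi z i ∧ xi z i ≤ 11 / 10 := by
  obtain ⟨hx, hs⟩ := pos_of_mem_nbhd hz
  have hg := gap_pos hn hx hs
  obtain ⟨h1, h2⟩ := xi_sq_bounds hx hs hg hz.2.2 i
  have := xi_pos hx hs hg i
  constructor <;> nlinarith

/-- The common computation for the primal and the dual side: `c` is the coordinate of the central
point with the same gap, and `2 / (9 / 10) ≤ 3` accounts for the constant. -/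
lemma scaling_bounds_aux {xh sh ξ μ μ₀ x₀ s₀ c k γ : ℝ} (hxh : 0 < xh) (hsh : 0 < sh)
    (hξ : 9 / 10 ≤ ξ) (hμ : xh * sh = μ) (hx₀ : 0 < x₀) (hs₀ : 0 < s₀) (hμ₀ : x₀ * s₀ = μ₀)
    (hk : 0 < k) (hγ : 0 < γ) (h1 : xh * ξ * s₀ ≤ 2 * k * μ₀) (h2 : γ * x₀ ≤ c)
    (h3 : c * (sh * ξ) ≤ 2 * k * μ) : γ * x₀ ≤ 3 * k * xh ∧ xh ≤ 3 * k * x₀ := by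
  constructor
  · have h4 : γ * x₀ * ξ * sh ≤ 2 * k * xh * sh := by
      calc γ * x₀ * ξ * sh = γ * x₀ * (sh * ξ) := by ring
        _ ≤ c * (sh * ξ) := by gcongr
        _ ≤ 2 * k * μ := h3
        _ = _ := by rw [← hμ]; ring
    have h5 := le_of_mul_le_mul_right h4 hsh
    have h6 : γ * x₀ * (9 / 10) ≤ γ * x₀ * ξ := by gcongr
    have : 0 < k * xh := by positivity
    nlinarith
  · have h4 : xh * ξ * s₀ ≤ 2 * k * x₀ * s₀ := by
      rw [← hμ₀] at h1
      linarith
    have h5 := le_of_mul_le_mul_right h4 hs₀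
    have h6 : xh * (9 / 10) ≤ xh * ξ := by gcongr
    have : 0 < k * x₀ := by positivity
    nlinarith

lemma recip_le {a b a' b' μ μ' g : ℝ} (hb : 0 < b) (hb' : 0 < b') (hμ : 0 < μ)
    (hab : a * b = μ) (hab' : a' * b' = μ') (hμ' : 0 < μ') (h : b ≤ g * b') :
    a' ≤ g * (μ' / μ) * a := by
  have ha : a = μ / b := by
    rw [← hab]
    field_simp
  have ha' : a' = μ' / b' := by
    rw [← hab']
    field_simp
  rw [ha, ha']
  have e : g * (μ' / μ) * (μ / b) = g * μ' / b := by
    field_simp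
  rw [e, div_le_div_iff₀ hb' hb]
  nlinarith

namespace PolarizedSegment

variable (S : P.PolarizedSegment β γ μ₁ μ₀ N)

include S

lemma start_pos : 0 < μ₀ := S.nonneg.trans_lt S.lt

lemma natCast_pos : (0 : ℝ) < n := by exact_mod_cast S.dim_pos

lemma one_le_natCast : (1 : ℝ) ≤ n := by exact_mod_cast S.dim_pos

lemma nine_le_distortion : 9 ≤ distortion n γ := by
  unfold distortion
  have h1 := S.one_le_natCast
  have h2 := S.γ_le
  rw [le_div_iff₀ S.γ_pos]
  nlinarith

lemma distortion_pos : 0 < distortion n γ := lt_of_lt_of_le (by norm_num) S.nine_le_distortion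

lemma pos (hz : z ∈ P.nbhd β) : (∀ i, 0 < z.1 i) ∧ (∀ i, 0 < z.2 i) ∧ 0 < gap z :=
  have h := pos_of_mem_nbhd hz
  ⟨h.1, h.2, gap_pos S.dim_pos h.1 h.2⟩

lemma cp_mem_nbhd {μ : ℝ} (hμ : 0 < μ) : P.cp μ ∈ P.nbhd β :=
  (S.central μ hμ).mem_nbhd S.dim_pos hμ S.β_pos.le

lemma gap_cp {μ : ℝ} (hμ : 0 < μ) : gap (P.cp μ) = μ := (S.central μ hμ).gap_eq S.dim_pos

/-- The upper bound compares `z` with the start of the segment by near monotonicity. The lower bound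
compares it with the central point of equal gap, where polarization applies. The quotient of the two
bounds is `distortion`. -/
lemma primal_scaling_bounds (hz : z ∈ P.nbhd β) (h₁ : μ₁ ≤ gap z) (h₀ : gap z ≤ μ₀) {i : Fin n}
    (hi : i ∈ Nᶜ) : γ * (P.cp μ₀).1 i ≤ 3 * n * xhat z i ∧ xhat z i ≤ 3 * n * (P.cp μ₀).1 i := by
  obtain ⟨hx, hs, hg⟩ := S.pos hz
  have hc₀ := S.cp_mem_nbhd S.start_pos
  have hc := S.cp_mem_nbhd hg
  obtain ⟨hx₀, hs₀, -⟩ := S.pos hc₀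
  have a1 := mul_le_gap_add_gap S.dim_pos hz hc₀ i
  have a2 := mul_le_gap_add_gap S.dim_pos hc hz i
  rw [S.gap_cp S.start_pos, ← xhat_mul_xi hx hs hg i] at a1
  rw [S.gap_cp hg, ← shat_mul_xi hx hs hg i] at a2
  have hn := S.natCast_pos
  refine scaling_bounds_aux (xhat_pos hx hs hg i) (shat_pos hx hs hg i)
    (xi_bounds S.dim_pos S.β_le hz i).1 (xhat_mul_shat hx hs hg i) (hx₀ i) (hs₀ i)
    ((S.central μ₀ S.start_pos).2.2 i) hn S.γ_pos (a1.trans ?_)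
    ((S.polarized (gap z) ⟨h₁, h₀⟩).1 i hi) (a2.trans_eq (by ring))
  nlinarith

lemma dual_scaling_bounds (hz : z ∈ P.nbhd β) (h₁ : μ₁ ≤ gap z) (h₀ : gap z ≤ μ₀) {i : Fin n}
    (hi : i ∈ N) : γ * (P.cp μ₀).2 i ≤ 3 * n * shat z i ∧ shat z i ≤ 3 * n * (P.cp μ₀).2 i := by
  obtain ⟨hx, hs, hg⟩ := S.pos hz
  have hc₀ := S.cp_mem_nbhd S.start_pos
  have hc := S.cp_mem_nbhd hg
  obtain ⟨hx₀, hs₀, -⟩ := S.pos hc₀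
  have a1 := mul_le_gap_add_gap S.dim_pos hc₀ hz i
  have a2 := mul_le_gap_add_gap S.dim_pos hz hc i
  rw [S.gap_cp S.start_pos, ← shat_mul_xi hx hs hg i] at a1
  rw [S.gap_cp hg, ← xhat_mul_xi hx hs hg i] at a2
  have hn := S.natCast_pos
  refine scaling_bounds_aux (μ₀ := μ₀) (shat_pos hx hs hg i) (xhat_pos hx hs hg i)
    (xi_bounds S.dim_pos S.β_le hz i).1 (by rw [mul_comm, xhat_mul_shat hx hs hg i])
    (hs₀ i) (hx₀ i) (by rw [mul_comm]; exact (S.central μ₀ S.start_pos).2.2 i) hn S.γ_pos ?_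
    ((S.polarized (gap z) ⟨h₁, h₀⟩).2 i hi) ?_
  · rw [mul_comm]
    refine a1.trans ?_
    nlinarith
  · rw [mul_comm]
    exact a2.trans_eq (by ring)

lemma le_distortion_mul {a b c : ℝ} (h1 : a ≤ 3 * n * c) (h2 : γ * c ≤ 3 * n * b) :
    a ≤ distortion n γ * b := by
  have hγ := S.γ_pos
  have hn := S.natCast_pos
  calc a ≤ 3 * n * c := h1
    _ = 3 * n / γ * (γ * c) := by field_simp
    _ ≤ 3 * n / γ * (3 * n * b) := by gcongr
    _ = _ := by unfold distortion; ring

lemma xhat_le (hz : z ∈ P.nbhd β) (h₁ : μ₁ ≤ gap z) (h₀ : gap z ≤ μ₀) (hz' : z' ∈ P.nbhd β)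
    (h₁' : μ₁ ≤ gap z') (h₀' : gap z' ≤ μ₀) {i : Fin n} (hi : i ∈ Nᶜ) :
    xhat z i ≤ distortion n γ * xhat z' i :=
  S.le_distortion_mul (S.primal_scaling_bounds hz h₁ h₀ hi).2
    (S.primal_scaling_bounds hz' h₁' h₀' hi).1

lemma shat_le (hz : z ∈ P.nbhd β) (h₁ : μ₁ ≤ gap z) (h₀ : gap z ≤ μ₀) (hz' : z' ∈ P.nbhd β)
    (h₁' : μ₁ ≤ gap z') (h₀' : gap z' ≤ μ₀) {i : Fin n} (hi : i ∈ N) :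
    shat z i ≤ distortion n γ * shat z' i :=
  S.le_distortion_mul (S.dual_scaling_bounds hz h₁ h₀ hi).2
    (S.dual_scaling_bounds hz' h₁' h₀' hi).1

/-- On `N` the dual scaling is almost constant, so its reciprocal times the gap follows the gap. -/
lemma xhat_le' (hz : z ∈ P.nbhd β) (h₁ : μ₁ ≤ gap z) (h₀ : gap z ≤ μ₀) (hz' : z' ∈ P.nbhd β)
    (h₁' : μ₁ ≤ gap z') (h₀' : gap z' ≤ μ₀) {i : Fin n} (hi : i ∈ N) :
    xhat z' i ≤ distortion n γ * (gap z' / gap z) * xhat z i := by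
  obtain ⟨hx, hs, hg⟩ := S.pos hz
  obtain ⟨hx', hs', hg'⟩ := S.pos hz'
  exact recip_le (shat_pos hx hs hg i) (shat_pos hx' hs' hg' i) hg (xhat_mul_shat hx hs hg i)
    (xhat_mul_shat hx' hs' hg' i) hg' (S.shat_le hz h₁ h₀ hz' h₁' h₀' hi)

lemma shat_le' (hz : z ∈ P.nbhd β) (h₁ : μ₁ ≤ gap z) (h₀ : gap z ≤ μ₀) (hz' : z' ∈ P.nbhd β)
    (h₁' : μ₁ ≤ gap z') (h₀' : gap z' ≤ μ₀) {i : Fin n} (hi : i ∈ Nᶜ) :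
    shat z' i ≤ distortion n γ * (gap z' / gap z) * shat z i := by
  obtain ⟨hx, hs, hg⟩ := S.pos hz
  obtain ⟨hx', hs', hg'⟩ := S.pos hz'
  exact recip_le (xhat_pos hx hs hg i) (xhat_pos hx' hs' hg' i) hg
    (by rw [mul_comm, xhat_mul_shat hx hs hg i]) (by rw [mul_comm, xhat_mul_shat hx' hs' hg' i])
    hg' (S.xhat_le hz h₁ h₀ hz' h₁' h₀' hi)

/-- Along the segment the expensive thresholds scale with the gap, up to the distortion. -/
lemma expensive_le (hz : z ∈ P.nbhd β) (h₁ : μ₁ ≤ gap z) (h₀ : gap z ≤ μ₀) (hz' : z' ∈ P.nbhd β)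
    (h₁' : μ₁ ≤ gap z') (h₀' : gap z' ≤ μ₀) {t t' : ℝ} (ht : 0 ≤ t)
    (h : distortion n γ ^ 2 * (gap z' / gap z) * t ≤ t') :
    P.expensive z' N t' ≤ P.expensive z N t := by
  obtain ⟨hx, hs, hg⟩ := S.pos hz
  obtain ⟨hx', hs', hg'⟩ := S.pos hz'
  have hd := S.distortion_pos
  have h' : distortion n γ * (gap z' / gap z) * distortion n γ * t ≤ t' := by
    refine le_trans (le_of_eq ?_) h
    ring
  refine add_le_add ?_ ?_
  · exact eCount_scaled_le (xhat_pos hx hs hg) (xhat_pos hx' hs' hg') P.W N (by positivity) hd.le ht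
      (fun i hi => S.xhat_le' hz h₁ h₀ hz' h₁' h₀' hi)
      (fun i hi => S.xhat_le hz h₁ h₀ hz' h₁' h₀' hi) h'
  · refine eCount_scaled_le (shat_pos hx hs hg) (shat_pos hx' hs' hg') P.Wᗮ Nᶜ (by positivity)
      hd.le ht (fun i hi => S.shat_le' hz h₁ h₀ hz' h₁' h₀' hi) (fun i hi => ?_) h'
    rw [compl_compl] at hi
    exact S.shat_le hz h₁ h₀ hz' h₁' h₀' hi

lemma xi_cp {μ : ℝ} (hμ : 0 < μ) (i : Fin n) : xi (P.cp μ) i = 1 := by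
  obtain ⟨hx, hs, hg⟩ := S.pos (S.cp_mem_nbhd hμ)
  have h1 := xi_sq_mul_gap hx hs hg i
  rw [(S.central μ hμ).2.2 i, S.gap_cp hμ] at h1
  have h2 : xi (P.cp μ) i ^ 2 = 1 := by
    apply mul_right_cancel₀ hμ.ne'
    rw [h1, one_mul]
  exact (pow_eq_one_iff_of_nonneg (xi_pos hx hs hg i).le two_ne_zero).1 h2

lemma xhat_cp {μ : ℝ} (hμ : 0 < μ) (i : Fin n) : xhat (P.cp μ) i = (P.cp μ).1 i := by
  simp [xhat, S.xi_cp hμ]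

lemma shat_cp {μ : ℝ} (hμ : 0 < μ) (i : Fin n) : shat (P.cp μ) i = (P.cp μ).2 i := by
  simp [shat, S.xi_cp hμ]

lemma abs_sub_le_distortion {a ξ : ℝ} (ha : 0 ≤ a) (ha' : a ≤ distortion n γ) (hξ : 9 / 10 ≤ ξ)
    (hξ' : ξ ≤ 11 / 10) : |a - ξ| ≤ distortion n γ := by
  have := S.nine_le_distortion
  rw [abs_le]
  constructor <;> linarith

/-- The primal target vector: the step to the central path point with a smaller parameter. -/
lemma exists_primal_target (hz : z ∈ P.nbhd β) (h₀ : gap z ≤ μ₀) {μ : ℝ}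
    (hμ : 0 < μ) (h₁ : μ₁ ≤ μ) (hle : μ ≤ gap z) :
    ∃ v ∈ P.primalLocal z, ‖proj N (xi z + v)‖ ≤ √n * (distortion n γ * (μ / gap z)) ∧
      ‖proj Nᶜ v‖ ≤ √n * distortion n γ := by
  obtain ⟨hx, hs, hg⟩ := S.pos hz
  have hc := S.cp_mem_nbhd hμ
  have hgc := S.gap_cp hμ
  obtain ⟨hxc, hsc, -⟩ := S.pos hc
  have hxh := xhat_pos hx hs hg
  have hd := S.distortion_pos
  refine ⟨scale (vinv (xhat z)) ((P.cp μ).1 - z.1),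
    ⟨_, ((mem_primalInt_iff hz.1 _).1 hc.1).1, rfl⟩, ?_, ?_⟩
  · refine norm_proj_le_sqrt (by positivity) fun i hi => ?_
    -- The target residual is the quotient of the central coordinate and the scaling at `z`: of
    -- order `μ / gap z` on `N`, and bounded off `N`.
    have e : (xi z + scale (vinv (xhat z)) ((P.cp μ).1 - z.1)) i = (P.cp μ).1 i / xhat z i := by
      rw [PiLp.add_apply, scale_apply, vinv_apply, PiLp.sub_apply, ← xhat_mul_xi hx hs hg i]
      have := (hxh i).ne'
      field_simp
      ring
    rw [e, abs_of_pos (div_pos (hxc i) (hxh i)), div_le_iff₀ (hxh i)]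
    have := S.xhat_le' hz (h₁.trans hle) h₀ hc (by rwa [hgc]) (by rw [hgc]; linarith) hi
    rwa [S.xhat_cp hμ, hgc] at this
  · refine norm_proj_le_sqrt hd.le fun i hi => ?_
    have e : (scale (vinv (xhat z)) ((P.cp μ).1 - z.1)) i = (P.cp μ).1 i / xhat z i - xi z i := by
      rw [scale_apply, vinv_apply, PiLp.sub_apply, ← xhat_mul_xi hx hs hg i]
      have := (hxh i).ne'
      field_simp
    obtain ⟨h3, h4⟩ := xi_bounds S.dim_pos S.β_le hz i
    rw [e]
    refine S.abs_sub_le_distortion (div_pos (hxc i) (hxh i)).le ?_ h3 h4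
    rw [div_le_iff₀ (hxh i)]
    have := S.xhat_le hc (by rwa [hgc]) (by rw [hgc]; linarith) hz (h₁.trans hle) h₀ hi
    rwa [S.xhat_cp hμ] at this

/-- The dual target vector. -/
lemma exists_dual_target (hz : z ∈ P.nbhd β) (h₀ : gap z ≤ μ₀) {μ : ℝ}
    (hμ : 0 < μ) (h₁ : μ₁ ≤ μ) (hle : μ ≤ gap z) :
    ∃ v ∈ P.dualLocal z, ‖proj Nᶜ (xi z + v)‖ ≤ √n * (distortion n γ * (μ / gap z)) ∧
      ‖proj Nᶜᶜ v‖ ≤ √n * distortion n γ := by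
  obtain ⟨hx, hs, hg⟩ := S.pos hz
  have hc := S.cp_mem_nbhd hμ
  have hgc := S.gap_cp hμ
  obtain ⟨hxc, hsc, -⟩ := S.pos hc
  have hsh := shat_pos hx hs hg
  have hd := S.distortion_pos
  refine ⟨scale (vinv (shat z)) ((P.cp μ).2 - z.2),
    ⟨_, ((mem_dualInt_iff hz.2.1 _).1 hc.2.1).1, rfl⟩, ?_, ?_⟩
  · refine norm_proj_le_sqrt (by positivity) fun i hi => ?_
    have e : (xi z + scale (vinv (shat z)) ((P.cp μ).2 - z.2)) i = (P.cp μ).2 i / shat z i := by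
      rw [PiLp.add_apply, scale_apply, vinv_apply, PiLp.sub_apply, ← shat_mul_xi hx hs hg i]
      have := (hsh i).ne'
      field_simp
      ring
    rw [e, abs_of_pos (div_pos (hsc i) (hsh i)), div_le_iff₀ (hsh i)]
    have := S.shat_le' hz (h₁.trans hle) h₀ hc (by rwa [hgc]) (by rw [hgc]; linarith) hi
    rwa [S.shat_cp hμ, hgc] at this
  · rw [norm_proj_compl_compl]
    refine norm_proj_le_sqrt hd.le fun i hi => ?_
    have e : (scale (vinv (shat z)) ((P.cp μ).2 - z.2)) i = (P.cp μ).2 i / shat z i - xi z i := by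
      rw [scale_apply, vinv_apply, PiLp.sub_apply, ← shat_mul_xi hx hs hg i]
      have := (hsh i).ne'
      field_simp
    obtain ⟨h3, h4⟩ := xi_bounds S.dim_pos S.β_le hz i
    rw [e]
    refine S.abs_sub_le_distortion (div_pos (hsc i) (hsh i)).le ?_ h3 h4
    rw [div_le_iff₀ (hsh i)]
    have := S.shat_le hc (by rwa [hgc]) (by rw [hgc]; linarith) hz (h₁.trans hle) h₀ hi
    rwa [S.shat_cp hμ] at this

end PolarizedSegment

end LP

/-! ## Layered directions -/

/-- A pair of local directions that is close to `-ξ` on its own part and small on the other. -/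
structure IsLayered {n : ℕ} (X : Submodule ℝ (Vec n)) (N : Finset (Fin n)) (ξ : Vec n) (β η : ℝ)
    (u v : Vec n) : Prop where
  fst_mem : u ∈ X
  snd_mem : v ∈ Xᗮ
  fst_small : ‖proj Nᶜ u‖ ≤ β / 16
  snd_small : ‖proj N v‖ ≤ β / 16
  fst_close : ‖proj N (ξ + u)‖ ≤ η
  snd_close : ‖proj Nᶜ (ξ + v)‖ ≤ η

section Layered

variable {n : ℕ}

/-- One side of the layered direction. -/
lemma llsDelta_bounds (hn : 0 < n) {β : ℝ} (hβ0 : 0 < β) (hβ : β ≤ 1 / 6)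
    {X : Submodule ℝ (Vec n)} {I : Finset (Fin n)}
    {V : Fin I.card → VecOn I} (h : IsApproxSVD (lift X I) V) {ξ : Vec n} (hξ : ‖ξ‖ ≤ √n)
    {v : Vec n} {ε g r : ℝ} (hv : v ∈ X) (hg : 1 ≤ g) (hr : 0 < r)
    (hε : ‖proj I (ξ + v)‖ ≤ ε) (hε1 : ε ≤ 1) (hΓ : ‖proj Iᶜ v‖ ≤ √n * g)
    (hcase : cheapSpan (lift X I) V (tau β n / n) = ⊤ ∨
      ∀ v ∈ (cheapSpan (lift X I) V (tau β n / n))ᗮ, r * ‖v‖ ≤ √(I.card) * ‖liftLin X I v‖) :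
    llsDelta X I (cheapSub β X I V) ξ ∈ X ∧
    ‖proj Iᶜ (llsDelta X I (cheapSub β X I V) ξ)‖ ≤ β / 16 ∧
    ‖proj I (ξ + llsDelta X I (cheapSub β X I V) ξ)‖ ≤ ε + 2 * n * g / r := by
  have hn' : (0 : ℝ) < n := by exact_mod_cast hn
  have hsq := LP.one_le_sqrt_natCast hn
  have hsq2 : √(n : ℝ) * √n = n := Real.mul_self_sqrt hn'.le
  have hτ : 0 < tau β n := by
    unfold tau
    positivity
  have hτn : tau β n * √n = β / 16 := by
    unfold tau
    field_simp
  have hτ1 : tau β n ≤ β / 16 := by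
    rw [← hτn]
    nlinarith
  have hcard : (I.card : ℝ) ≤ n := by
    have := I.card_le_univ
    simp only [Fintype.card_fin] at this
    exact_mod_cast this
  have hct : I.card * (tau β n / n) ≤ tau β n := by
    rw [← mul_div_assoc, div_le_iff₀ hn', mul_comm]
    gcongr
  have hIξ : ‖proj I ξ‖ ≤ √n := (norm_proj_le I ξ).trans hξ
  have hε0 : 0 ≤ ε := (norm_nonneg _).trans hε
  obtain ⟨h1, h2, h3⟩ := llsDelta_spec h (t := tau β n / n) (by positivity) ξ
  refine ⟨h1, ?_, ?_⟩
  · refine h2.trans ?_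
    rw [← hτn]
    gcongr
  · refine (h3 v ε (√n * g) r hv hε hΓ hr hcase).trans ?_
    suffices H : √(I.card) * (√n * g + I.card * (tau β n / n) * (‖proj I ξ‖ + ε)) ≤ 2 * n * g by
      have := div_le_div_of_nonneg_right H hr.le
      linarith
    calc √(I.card) * (√n * g + I.card * (tau β n / n) * (‖proj I ξ‖ + ε))
        ≤ √n * (√n * g + tau β n * (√n + 1)) := by gcongr
      _ = (√n * √n) * g + √n * (tau β n * √n + tau β n) := by ring
      _ ≤ n * g + √n * (√n * g) := by
          rw [hsq2, hτn]
          gcongr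
          nlinarith
      _ = (n + √n * √n) * g := by ring
      _ = 2 * n * g := by rw [hsq2]; ring

variable {X : Submodule ℝ (Vec n)} {N : Finset (Fin n)} {ξ u v : Vec n} {β η : ℝ}

lemma norm_le_of_proj_le {w : Vec n} {c d : ℝ} (hd : 0 ≤ d) (h1 : ‖proj N w‖ ≤ c)
    (h2 : ‖proj Nᶜ w‖ ≤ c) (h : 2 * c ^ 2 ≤ d ^ 2) : ‖w‖ ≤ d := by
  refine le_of_sq_le_sq ?_ hd
  rw [norm_sq_eq_proj N w]
  have e1 := pow_le_pow_left₀ (norm_nonneg _) h1 2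
  have e2 := pow_le_pow_left₀ (norm_nonneg _) h2 2
  linarith

lemma IsLayered.η_nonneg (h : IsLayered X N ξ β η u v) : 0 ≤ η :=
  (norm_nonneg _).trans h.fst_close

/-- On each part one factor is at most `11 / 10 + 1 / 20 = 23 / 20`, and the other has norm at most
`β / 16` there. -/
lemma IsLayered.norm_had_le (h : IsLayered X N ξ β η u v) (hβ0 : 0 < β) (hη : η ≤ 1 / 20)
    (hξ : ∀ i, 9 / 10 ≤ ξ i ∧ ξ i ≤ 11 / 10) : ‖had u v‖ ≤ β / 4 := by
  refine norm_le_of_proj_le (N := N) (c := 23 / 20 * (β / 16)) (by positivity)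
    ?_ ?_ (by nlinarith)
  · refine (norm_proj_le_of_abs_le (w' := v) (by norm_num) fun i hi => ?_).trans
      (mul_le_mul_of_nonneg_left h.snd_small (by norm_num))
    rw [had_apply, abs_mul]
    gcongr
    have h1 := (abs_apply_le_norm_proj hi (ξ + u)).trans h.fst_close
    rw [PiLp.add_apply, abs_le] at h1
    rw [abs_le]
    obtain ⟨h2, h3⟩ := hξ i
    constructor <;> linarith
  · refine (norm_proj_le_of_abs_le (w' := u) (by norm_num) fun i hi => ?_).trans
      (mul_le_mul_of_nonneg_left h.fst_small (by norm_num))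
    rw [had_apply, abs_mul, mul_comm]
    gcongr
    have h1 := (abs_apply_le_norm_proj hi (ξ + v)).trans h.snd_close
    rw [PiLp.add_apply, abs_le] at h1
    rw [abs_le]
    obtain ⟨h2, h3⟩ := hξ i
    constructor <;> linarith

lemma IsLayered.norm_had_add_le (h : IsLayered X N ξ β η u v) (hβ : β ≤ 1 / 6)
    (hξ : ∀ i, 9 / 10 ≤ ξ i ∧ ξ i ≤ 11 / 10) : ‖had (ξ + u) (ξ + v)‖ ≤ 2 * η := by
  have hη := h.η_nonneg
  refine norm_le_of_proj_le (N := N) (c := 6 / 5 * η) (by positivity)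
    ?_ ?_ (by nlinarith)
  · refine (norm_proj_le_of_abs_le (w' := ξ + u) (by norm_num) fun i hi => ?_).trans
      (mul_le_mul_of_nonneg_left h.fst_close (by norm_num))
    rw [had_apply, abs_mul, mul_comm]
    gcongr
    have h1 := (abs_apply_le_norm_proj hi v).trans h.snd_small
    rw [abs_le] at h1
    rw [PiLp.add_apply, abs_le]
    obtain ⟨h2, h3⟩ := hξ i
    constructor <;> linarith
  · refine (norm_proj_le_of_abs_le (w' := ξ + v) (by norm_num) fun i hi => ?_).trans
      (mul_le_mul_of_nonneg_left h.snd_close (by norm_num))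
    rw [had_apply, abs_mul]
    gcongr
    have h1 := (abs_apply_le_norm_proj hi u).trans h.fst_small
    rw [abs_le] at h1
    rw [PiLp.add_apply, abs_le]
    obtain ⟨h2, h3⟩ := hξ i
    constructor <;> linarith

/-- A layered direction is close to the affine scaling direction. -/
lemma IsLayered.affine_small (h : IsLayered X N ξ β η u v) (hβ : β ≤ 1 / 6) (hη : η ≤ 1 / 20)
    {dx ds : Vec n} (hdx : dx ∈ X) (hds : ds ∈ Xᗮ) (hsum : ∀ i, dx i + ds i = -ξ i) :
    (∀ i ∈ N, |ds i| ≤ 11 / 100) ∧ ∀ i ∈ Nᶜ, |dx i| ≤ 11 / 100 := by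
  have hη0 := h.η_nonneg
  have hβ0 : 0 ≤ β / 16 := (norm_nonneg _).trans h.fst_small
  have hbound : ‖ξ + u + v‖ ≤ 9 / 100 := by
    refine norm_le_of_proj_le (N := N) (c := η + β / 16) (by norm_num)
      ?_ ?_ (by nlinarith)
    · rw [map_add]
      exact (norm_add_le _ _).trans (add_le_add h.fst_close h.snd_small)
    · have e : ξ + u + v = (ξ + v) + u := by abel
      rw [e, map_add]
      exact (norm_add_le _ _).trans (add_le_add h.snd_close h.fst_small)
  -- The two differences are orthogonal and sum to a short vector, so each of them is short.
  have e : (dx - u) + (ds - v) = -(ξ + u + v) := by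
    ext i
    have := hsum i
    simp only [PiLp.add_apply, PiLp.sub_apply, PiLp.neg_apply]
    linarith
  have hpyth := norm_sq_add_of_orthogonal (X.sub_mem hdx h.fst_mem) (Xᗮ.sub_mem hds h.snd_mem)
  rw [e, norm_neg] at hpyth
  have hb2 : ‖ξ + u + v‖ ^ 2 ≤ (9 / 100) ^ 2 := pow_le_pow_left₀ (norm_nonneg _) hbound 2
  have h1 : ‖dx - u‖ ≤ 9 / 100 := by
    refine le_of_sq_le_sq ?_ (by norm_num)
    nlinarith [sq_nonneg ‖ds - v‖]
  have h2 : ‖ds - v‖ ≤ 9 / 100 := by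
    refine le_of_sq_le_sq ?_ (by norm_num)
    nlinarith [sq_nonneg ‖dx - u‖]
  constructor
  · intro i hi
    have h3 := (abs_apply_le_norm (ds - v) i).trans h2
    have h4 := (abs_apply_le_norm_proj hi v).trans h.snd_small
    rw [PiLp.sub_apply, abs_le] at h3
    rw [abs_le] at h4 ⊢
    constructor <;> linarith
  · intro i hi
    have h3 := (abs_apply_le_norm (dx - u) i).trans h1
    have h4 := (abs_apply_le_norm_proj hi u).trans h.fst_small
    rw [PiLp.sub_apply, abs_le] at h3
    rw [abs_le] at h4 ⊢
    constructor <;> linarith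

end Layered

section Layered

variable {n : ℕ} {N : Finset (Fin n)}

lemma norm_proj_of_eq_empty {I : Finset (Fin n)} (h : I = ∅) (w : Vec n) : ‖proj I w‖ = 0 := by
  subst h
  rw [← pow_eq_zero_iff two_ne_zero, norm_proj_sq, Finset.sum_empty]

lemma norm_eq_norm_proj {I : Finset (Fin n)} (h : Iᶜ = ∅) (w : Vec n) : ‖w‖ = ‖proj I w‖ := by
  have h1 := norm_sq_eq_proj I w
  rw [norm_proj_of_eq_empty h] at h1
  have h2 : ‖w‖ ^ 2 = ‖proj I w‖ ^ 2 := by linarith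
  exact (pow_left_inj₀ (norm_nonneg _) (norm_nonneg _) two_ne_zero).1 h2

/-- The part of `-ξ` in one of two complementary subspaces is the best approximation. -/
lemma norm_add_le_of_decomposition {X : Submodule ℝ (Vec n)} {ξ p q w : Vec n} (hp : p ∈ X)
    (hq : q ∈ Xᗮ) (hsum : ξ + p + q = 0) (hw : w ∈ Xᗮ) : ‖ξ + q‖ ≤ ‖ξ + w‖ := by
  have e1 : ξ + q = -p := by
    rw [eq_neg_iff_add_eq_zero, ← hsum]
    abel
  have e2 : ξ + w = -p + (w - q) := by
    rw [← e1]
    abel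
  rw [e1, e2]
  refine le_of_sq_le_sq ?_ (norm_nonneg _)
  rw [norm_sq_add_of_orthogonal (X.neg_mem hp) (Xᗮ.sub_mem hw hq)]
  have := sq_nonneg ‖w - q‖
  linarith

end Layered

/-! ### Progress of one iteration on a polarized segment. -/

namespace LP.PolarizedSegment

variable {m n : ℕ} {P : LP m n} {z z' : State n} {β γ μ₁ μ₀ : ℝ} {N : Finset (Fin n)}
  (S : P.PolarizedSegment β γ μ₁ μ₀ N)

include S

/-- The exact form of the residual bound for the layered directions. -/
lemma isLayered_llsDelta (hz : z ∈ P.nbhd β) (h₀ : gap z ≤ μ₀) {μ r : ℝ}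
    (hμ : 0 < μ) (h₁ : μ₁ ≤ μ) (hle : μ ≤ gap z) (hr : 0 < r)
    (hε : √n * (distortion n γ * (μ / gap z)) ≤ 1)
    {V : Fin N.card → VecOn N} {U : Fin Nᶜ.card → VecOn Nᶜ}
    (hV : IsApproxSVD (lift (P.primalLocal z) N) V) (hU : IsApproxSVD (lift (P.dualLocal z) Nᶜ) U)
    (hVr : cheapSpan (lift (P.primalLocal z) N) V (tau β n / n) = ⊤ ∨
      ∀ v ∈ (cheapSpan (lift (P.primalLocal z) N) V (tau β n / n))ᗮ,
        r * ‖v‖ ≤ √(N.card) * ‖liftLin (P.primalLocal z) N v‖)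
    (hUr : cheapSpan (lift (P.dualLocal z) Nᶜ) U (tau β n / n) = ⊤ ∨
      ∀ v ∈ (cheapSpan (lift (P.dualLocal z) Nᶜ) U (tau β n / n))ᗮ,
        r * ‖v‖ ≤ √(Nᶜ.card) * ‖liftLin (P.dualLocal z) Nᶜ v‖) :
    IsLayered (P.primalLocal z) N (xi z) β
      (√n * (distortion n γ * (μ / gap z)) + 2 * n * distortion n γ / r)
      (llsDelta (P.primalLocal z) N (cheapSub β (P.primalLocal z) N V) (xi z))
      (llsDelta (P.dualLocal z) Nᶜ (cheapSub β (P.dualLocal z) Nᶜ U) (xi z)) := by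
  obtain ⟨hx, hs, hg⟩ := S.pos hz
  have hd : 1 ≤ distortion n γ := by linarith [S.nine_le_distortion]
  have hξ := (norm_xi S.dim_pos hx hs hg).le
  obtain ⟨v, hv, hv1, hv2⟩ := S.exists_primal_target hz h₀ hμ h₁ hle
  obtain ⟨w, hw, hw1, hw2⟩ := S.exists_dual_target hz h₀ hμ h₁ hle
  obtain ⟨a1, a2, a3⟩ := llsDelta_bounds S.dim_pos S.β_pos S.β_le hV hξ hv hd hr hv1 hε hv2 hVr
  obtain ⟨b1, b2, b3⟩ := llsDelta_bounds S.dim_pos S.β_pos S.β_le hU hξ hw hd hr hw1 hε hw2 hUr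
  rw [norm_proj_compl_compl] at b2
  exact ⟨a1, dualLocal_eq_orthogonal (P := P) hx hs hg ▸ b1, a2, b2, a3, b3⟩

/-- The direction used by the algorithm is layered, also when one part is empty. -/
lemma isLayered_llsDir (hz : z ∈ P.nbhd β) (h₀ : gap z ≤ μ₀) {μ r : ℝ}
    (hμ : 0 < μ) (h₁ : μ₁ ≤ μ) (hle : μ ≤ gap z) (hr : 0 < r)
    (hε : √n * (distortion n γ * (μ / gap z)) ≤ 1)
    {V : Fin N.card → VecOn N} {U : Fin Nᶜ.card → VecOn Nᶜ}
    (hV : IsApproxSVD (lift (P.primalLocal z) N) V) (hU : IsApproxSVD (lift (P.dualLocal z) Nᶜ) U)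
    (hVr : cheapSpan (lift (P.primalLocal z) N) V (tau β n / n) = ⊤ ∨
      ∀ v ∈ (cheapSpan (lift (P.primalLocal z) N) V (tau β n / n))ᗮ,
        r * ‖v‖ ≤ √(N.card) * ‖liftLin (P.primalLocal z) N v‖)
    (hUr : cheapSpan (lift (P.dualLocal z) Nᶜ) U (tau β n / n) = ⊤ ∨
      ∀ v ∈ (cheapSpan (lift (P.dualLocal z) Nᶜ) U (tau β n / n))ᗮ,
        r * ‖v‖ ≤ √(Nᶜ.card) * ‖liftLin (P.dualLocal z) Nᶜ v‖)
    {Δa : State n} (hΔ : P.IsNewtonDir 0 z Δa) :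
    ∃ u v, P.llsDir z Δa N (cheapSub β (P.primalLocal z) N V) (cheapSub β (P.dualLocal z) Nᶜ U) =
        (had (xhat z) u, had (shat z) v) ∧
      IsLayered (P.primalLocal z) N (xi z) β
        (√n * (distortion n γ * (μ / gap z)) + 2 * n * distortion n γ / r) u v := by
  obtain ⟨hx, hs, hg⟩ := S.pos hz
  have hd := S.distortion_pos
  have hβ := S.β_pos
  obtain ⟨dx, hdx, ds, hds, rfl, hsum⟩ := hΔ.local hx hs hg
  have hsum0 : xi z + dx + ds = 0 := by
    ext i
    have := hsum i
    simp only [PiLp.add_apply, PiLp.zero_apply]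
    linarith
  have hzero : ∀ a : Vec n, had a 0 = 0 := fun a => by
    ext i
    simp
  have hη0 : 0 ≤ 2 * n * distortion n γ / r := by positivity
  have hε0 : 0 ≤ √n * (distortion n γ * (μ / gap z)) := by positivity
  unfold llsDir
  split_ifs with hN hN'
  · obtain ⟨w, hw, hw1, -⟩ := S.exists_dual_target hz h₀ hμ h₁ hle
    rw [dualLocal_eq_orthogonal hx hs hg] at hw
    refine ⟨0, ds, by rw [hzero], Submodule.zero_mem _, hds, ?_, ?_, ?_, ?_⟩
    · rw [map_zero, norm_zero]
      positivity
    · rw [norm_proj_of_eq_empty hN]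
      positivity
    · rw [norm_proj_of_eq_empty hN]
      positivity
    · have h2 := norm_add_le_of_decomposition hdx hds hsum0 hw
      rw [norm_eq_norm_proj (I := Nᶜ) (by rw [compl_compl, hN]) (xi z + w)] at h2
      exact ((norm_proj_le _ _).trans (h2.trans hw1)).trans (by linarith)
  · obtain ⟨w, hw, hw1, -⟩ := S.exists_primal_target hz h₀ hμ h₁ hle
    refine ⟨dx, 0, by rw [hzero], hdx, Submodule.zero_mem _, ?_, ?_, ?_, ?_⟩
    · rw [norm_proj_of_eq_empty hN']
      positivity
    · rw [map_zero, norm_zero]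
      positivity
    · have hsum1 : xi z + ds + dx = 0 := by
        rw [← hsum0]
        abel
      have h2 := norm_add_le_of_decomposition (X := (P.primalLocal z)ᗮ) hds
        (by rwa [Submodule.orthogonal_orthogonal]) hsum1
        (by rwa [Submodule.orthogonal_orthogonal])
      rw [norm_eq_norm_proj hN' (xi z + w)] at h2
      exact ((norm_proj_le _ _).trans (h2.trans hw1)).trans (by linarith)
    · rw [norm_proj_of_eq_empty hN']
      positivity
  · exact ⟨_, _, rfl, S.isLayered_llsDelta hz h₀ hμ h₁ hle hr hε hV hU hVr hUr⟩

/-- The associated partition is the polarizing partition. -/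
lemma assocN_eq (hz : z ∈ P.nbhd β) {η : ℝ} (hη : η ≤ 1 / 20) {u v : Vec n}
    (h : IsLayered (P.primalLocal z) N (xi z) β η u v)
    {Δa : State n} (hΔ : P.IsNewtonDir 0 z Δa) : assocN z Δa = N := by
  obtain ⟨hx, hs, hg⟩ := S.pos hz
  obtain ⟨dx, hdx, ds, hds, rfl, hsum⟩ := hΔ.local hx hs hg
  have hsum' : ∀ i, dx i + ds i = -xi z i := fun i => by
    rw [hsum i]
    ring
  obtain ⟨h1, h2⟩ := h.affine_small S.β_le hη hdx hds hsum'
  ext i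
  have hξ := xi_pos hx hs hg i
  obtain ⟨hξ1, hξ2⟩ := xi_bounds S.dim_pos S.β_le hz i
  have e1 : had (xhat z) dx i / z.1 i = dx i / xi z i := by
    rw [had_apply, ← xhat_mul_xi hx hs hg i, mul_div_mul_left _ _ (xhat_pos hx hs hg i).ne']
  have e2 : had (shat z) ds i / z.2 i = ds i / xi z i := by
    rw [had_apply, ← shat_mul_xi hx hs hg i, mul_div_mul_left _ _ (shat_pos hx hs hg i).ne']
  simp only [assocN, Finset.mem_filter, Finset.mem_univ, true_and]
  rw [e1, e2, abs_div, abs_div, div_lt_div_iff_of_pos_right (abs_pos.2 hξ.ne'), not_lt]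
  have hs' := hsum' i
  constructor
  · intro hle
    by_contra hcon
    have h3 := h2 i (Finset.mem_compl.2 hcon)
    have h4 := abs_le.1 (hle.trans h3)
    have h5 := abs_le.1 h3
    linarith
  · intro hi
    have h3 := h1 i hi
    refine h3.trans ?_
    have h4 := abs_le.1 h3
    have h5 := neg_abs_le (dx i)
    linarith

/-- The step length along a layered direction. -/
lemma one_sub_llsStepLength_le (hz : z ∈ P.nbhd β) {η : ℝ} (hη : η ≤ 1 / 20) {u v : Vec n}
    (h : IsLayered (P.primalLocal z) N (xi z) β η u v) :
    1 - llsStepLength β z (had (xhat z) u, had (shat z) v) ≤ 8 * η / β := by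
  obtain ⟨hx, hs, hg⟩ := S.pos hz
  have hβ := S.β_pos
  have hξ := xi_bounds S.dim_pos S.β_le hz
  have h1 := h.norm_had_le S.β_pos hη hξ
  have h2 := h.norm_had_add_le S.β_le hξ
  have e1 : had (had (xhat z) u) (had (shat z) v) = gap z • had u v := had_local hx hs hg u v
  have e2 : had (z.1 + had (xhat z) u) (z.2 + had (shat z) v) =
      gap z • had (xi z + u) (xi z + v) := by
    rw [← had_local hx hs hg]
    congr 1
    · ext i
      simp only [PiLp.add_apply, had_apply, mul_add, xhat_mul_xi hx hs hg]
    · ext i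
      simp only [PiLp.add_apply, had_apply, mul_add, shat_mul_xi hx hs hg]
  unfold llsStepLength
  rw [e1, e2, norm_smul, norm_smul, Real.norm_eq_abs, abs_of_pos hg,
    mul_div_cancel_left₀ _ hg.ne', if_pos (by nlinarith)]
  have h3 : 4 * ‖had (xi z + u) (xi z + v)‖ / β ≤ 8 * η / β := by
    refine div_le_div_of_nonneg_right ?_ hβ.le
    linarith
  have := le_max_right 0 (1 - 4 * ‖had (xi z + u) (xi z + v)‖ / β)
  linarith

/-- The gap after an iteration, if all directions off the cheap subspaces have cost at least `r`. -/
lemma gap_le_of_step (hz : z ∈ P.nbhd β) (h₀ : gap z ≤ μ₀) {μ r : ℝ}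
    (hμ : 0 < μ) (h₁ : μ₁ ≤ μ) (hle : μ ≤ gap z) (hr : 0 < r)
    (hε : √n * (distortion n γ * (μ / gap z)) ≤ 1 / 40)
    (hεr : 2 * n * distortion n γ / r ≤ 1 / 40)
    (hVr : ∀ V, IsApproxSVD (lift (P.primalLocal z) N) V →
      cheapSpan (lift (P.primalLocal z) N) V (tau β n / n) = ⊤ ∨
      ∀ v ∈ (cheapSpan (lift (P.primalLocal z) N) V (tau β n / n))ᗮ,
        r * ‖v‖ ≤ √(N.card) * ‖liftLin (P.primalLocal z) N v‖)
    (hUr : ∀ U, IsApproxSVD (lift (P.dualLocal z) Nᶜ) U →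
      cheapSpan (lift (P.dualLocal z) Nᶜ) U (tau β n / n) = ⊤ ∨
      ∀ v ∈ (cheapSpan (lift (P.dualLocal z) Nᶜ) U (tau β n / n))ᗮ,
        r * ‖v‖ ≤ √(Nᶜ.card) * ‖liftLin (P.dualLocal z) Nᶜ v‖)
    (hstep : P.Step β z z') :
    gap z' ≤ 16 / β * (√n * distortion n γ * μ + 2 * n * distortion n γ * gap z / r) := by
  obtain ⟨hx, hs, hg⟩ := S.pos hz
  have hβ := S.β_pos
  obtain ⟨-, Δa, α, hΔa, hα, V, U, hV, hU, Δl, hΔl, zp, hzp, hz'⟩ := hstep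
  -- The algorithm runs Approx-SVD on its own partition. An auxiliary decomposition for the
  -- polarizing partition first yields a layered pair, and this pair shows that the two partitions
  -- agree.
  have hassoc : assocN z Δa = N := by
    obtain ⟨V', hV'⟩ := exists_isApproxSVD (P.primalLocal z) N
    obtain ⟨U', hU'⟩ := exists_isApproxSVD (P.dualLocal z) Nᶜ
    exact S.assocN_eq hz (by linarith) (S.isLayered_llsDelta hz h₀ hμ h₁ hle hr (by linarith)
      hV' hU' (hVr _ hV') (hUr _ hU')) hΔa
  generalize assocN z Δa = N' at *
  subst hassoc
  obtain ⟨u, v, huv, hlay⟩ := S.isLayered_llsDir hz h₀ hμ h₁ hle hr (by linarith) hV hU (hVr _ hV)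
    (hUr _ hU) hΔa
  obtain ⟨hm1, hm2⟩ := llsDir_mem hΔa hx hs hg N'
    (cheapSub β (P.primalLocal z) N' V) (cheapSub β (P.dualLocal z) N'ᶜ U)
  rw [← hΔl] at huv hm1 hm2
  obtain ⟨h3, -, h5⟩ := longer_step_spec S.dim_pos S.β_pos S.β_le hz hΔa hα hm1 hm2 hzp
  obtain ⟨-, h6⟩ := corrected_spec S.dim_pos S.β_pos S.β_le h3 hz'
  have h7 := S.one_sub_llsStepLength_le hz (by linarith) hlay
  rw [← huv] at h7
  rw [h6]
  refine h5.trans ?_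
  calc 2 * (1 - llsStepLength β z Δl) * gap z
      ≤ 2 * (8 * (√n * (distortion n γ * (μ / gap z)) + 2 * n * distortion n γ / r) / β) *
        gap z := by gcongr
    _ = _ := by
      field_simp
      ring

/-- The threshold at which expensive directions are counted. -/
lemma sqrt_card_mul_threshold_le (I : Finset (Fin n)) :
    √(I.card) * (tau β n / n ^ 2) ≤ tau β n / n := by
  have hn := S.natCast_pos
  have hn1 := S.one_le_natCast
  have hβ := S.β_pos
  have hτ : 0 < tau β n := by
    unfold tau
    positivity
  have h1 : √(I.card) ≤ n := by
    have : (I.card : ℝ) ≤ n := by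
      have := I.card_le_univ
      simp only [Fintype.card_fin] at this
      exact_mod_cast this
    refine Real.sqrt_le_iff.2 ⟨hn.le, ?_⟩
    nlinarith
  calc √(I.card) * (tau β n / n ^ 2) ≤ n * (tau β n / n ^ 2) := by gcongr
    _ = _ := by field_simp

/-- If the number of expensive directions does not drop between the two thresholds, then all
directions off the cheap subspace have cost at least `r`. -/
lemma expensive_of_not_drop {X : Submodule ℝ (Vec n)} {I : Finset (Fin n)} {r : ℝ}
    (h : ¬ eCount X I (n * r) + 1 ≤ eCount X I (tau β n / n ^ 2)) (V : Fin I.card → VecOn I)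
    (hV : IsApproxSVD (lift X I) V) :
    cheapSpan (lift X I) V (tau β n / n) = ⊤ ∨
      ∀ v ∈ (cheapSpan (lift X I) V (tau β n / n))ᗮ,
        r * ‖v‖ ≤ √(I.card) * ‖liftLin X I v‖ := by
  have hn := S.natCast_pos
  have hβ := S.β_pos
  have hτ : 0 < tau β n := by
    unfold tau
    positivity
  rcases eCount_drop hV (t₀ := tau β n / n ^ 2) (by positivity)
    (S.sqrt_card_mul_threshold_le I) with h1 | ⟨ρ, hρ, hdrop, hC⟩
  · exact Or.inl h1
  · right
    have hρ0 : 0 < ρ := lt_of_le_of_lt (by positivity) hρ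
    -- If the separating ratio `ρ` were below `r`, the drop of the count at `I.card * ρ` would
    -- persist at `n * r`.
    have hr : r ≤ ρ := by
      by_contra hcon
      push Not at hcon
      refine h (le_trans ?_ hdrop)
      gcongr
      refine eCount_antitone _ _ ?_
      have : (I.card : ℝ) ≤ n := by
        have := I.card_le_univ
        simp only [Fintype.card_fin] at this
        exact_mod_cast this
      gcongr
    exact fun v hv => (mul_le_mul_of_nonneg_right hr (norm_nonneg _)).trans (hC v hv)

lemma tau_div_le {r : ℝ} (hr : 1 ≤ r) : tau β n / n ^ 2 ≤ n * r := by
  have hn := S.natCast_pos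
  have hn1 := S.one_le_natCast
  have hβ := S.β_pos
  have hβ' := S.β_le
  have hsq := one_le_sqrt_natCast S.dim_pos
  have h1 : tau β n ≤ 1 := by
    unfold tau
    rw [div_le_one (by positivity)]
    linarith
  have h2 : tau β n / n ^ 2 ≤ 1 := by
    rw [div_le_one (by positivity)]
    nlinarith
  nlinarith

/-- The gap after an iteration at a threshold across which the count is stable. -/
lemma gap_le_of_stable (hz : z ∈ P.nbhd β) (h₀ : gap z ≤ μ₀) {r : ℝ}
    (hr : 80 * n * distortion n γ ≤ r) (hfar : 96 * n * distortion n γ / β * μ₁ < gap z)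
    (h : ¬ P.expensive z N (n * r) + 1 ≤ P.expensive z N (tau β n / n ^ 2))
    (hstep : P.Step β z z') :
    gap z' ≤ 48 * n * distortion n γ / β * max μ₁ (gap z / r) := by
  obtain ⟨hx, hs, hg⟩ := S.pos hz
  have hn := S.natCast_pos
  have hn1 := S.one_le_natCast
  have hβ := S.β_pos
  have hβ' := S.β_le
  have hd := S.nine_le_distortion
  have hd0 := S.distortion_pos
  have hnd : 0 < n * distortion n γ := by positivity
  have hnd1 : 9 ≤ n * distortion n γ := by nlinarith
  have hr1 : 1 ≤ r := by linarith
  have hr0 : 0 < r := by linarith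
  have hsqn : √(n : ℝ) ≤ n := by
    refine Real.sqrt_le_iff.2 ⟨hn.le, ?_⟩
    nlinarith
  -- The target parameter balances the two residual terms and stays inside the segment. The lower
  -- bounds on `gap z` and `r` make each residual at most `1 / 40`, so that together they are at
  -- most `1 / 20`.
  have hμpos : 0 < max μ₁ (gap z / r) := lt_max_of_lt_right (by positivity)
  have hμle : max μ₁ (gap z / r) ≤ gap z / (40 * n * distortion n γ) := by
    refine max_le ?_ ?_
    · rw [le_div_iff₀ (by positivity)]
      refine le_trans ?_ hfar.le
      rw [mul_comm]
      have h1 : 96 * n * distortion n γ ≤ 96 * n * distortion n γ / β := by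
        rw [le_div_iff₀ hβ]
        nlinarith
      have h2 := S.nonneg
      have h3 : 40 * n * distortion n γ ≤ 96 * n * distortion n γ / β := by nlinarith
      gcongr
    · gcongr
      linarith
  -- By antitonicity of the other summand, a drop on one side would be a drop of the total.
  have hc1 : ¬ eCount (P.primalLocal z) N (n * r) + 1 ≤
      eCount (P.primalLocal z) N (tau β n / n ^ 2) := by
    intro hcon
    refine h ?_
    have := eCount_antitone (P.dualLocal z) Nᶜ (S.tau_div_le hr1)
    unfold expensive
    omega
  have hc2 : ¬ eCount (P.dualLocal z) Nᶜ (n * r) + 1 ≤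
      eCount (P.dualLocal z) Nᶜ (tau β n / n ^ 2) := by
    intro hcon
    refine h ?_
    have := eCount_antitone (P.primalLocal z) N (S.tau_div_le hr1)
    unfold expensive
    omega
  refine (S.gap_le_of_step hz h₀ hμpos (le_max_left _ _) (hμle.trans ?_) hr0 ?_ ?_
    (S.expensive_of_not_drop hc1) (S.expensive_of_not_drop hc2) hstep).trans ?_
  · exact div_le_self hg.le (by linarith)
  · rw [le_div_iff₀ (by positivity)] at hμle
    rw [← mul_div_assoc, ← mul_div_assoc, div_le_iff₀ hg]
    have : √n * (distortion n γ * max μ₁ (gap z / r)) ≤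
        n * (distortion n γ * max μ₁ (gap z / r)) := by gcongr
    linarith
  · rw [div_le_iff₀ hr0]
    linarith
  · calc 16 / β * (√n * distortion n γ * max μ₁ (gap z / r) + 2 * n * distortion n γ * gap z / r)
        ≤ 16 / β * (n * distortion n γ * max μ₁ (gap z / r) +
          2 * n * distortion n γ * max μ₁ (gap z / r)) := by
          rw [mul_div_assoc (2 * n * distortion n γ)]
          gcongr
          exact le_max_right _ _
      _ = _ := by ring

/-- One iteration far from the end of the segment either comes close to the end, or makes enough
progress that an expensive direction is about to become cheap. -/
lemma progress (hz : z ∈ P.nbhd β) (h₀ : gap z ≤ μ₀)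
    (hfar : 96 * n * distortion n γ / β * μ₁ < gap z) (hstep : P.Step β z z') :
    gap z' ≤ 96 * n * distortion n γ / β * μ₁ ∨
    ∃ r, 0 < r ∧ gap z' ≤ 96 * n * distortion n γ / β * (gap z / r) ∧
      P.expensive z N (n * r) + 1 ≤ P.expensive z N (tau β n / n ^ 2) := by
  obtain ⟨hx, hs, hg⟩ := S.pos hz
  have hn := S.natCast_pos
  have hn1 := S.one_le_natCast
  have hβ := S.β_pos
  have hβ' := S.β_le
  have hd := S.nine_le_distortion
  have hd0 := S.distortion_pos
  set Q := 48 * n * distortion n γ / β with hQ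
  have hQ0 : 0 < Q := by positivity
  have hQ2 : 96 * n * distortion n γ / β = 2 * Q := by
    rw [hQ]
    ring
  rw [hQ2] at hfar ⊢
  set r₀ := 80 * n * distortion n γ with hr₀
  have hr₀0 : 0 < r₀ := by positivity
  have hstable := fun r (hr : r₀ ≤ r) h => S.gap_le_of_stable hz h₀ hr (by rwa [hQ2]) h hstep
  -- Search for the first dyadic threshold at which the count has dropped.
  by_cases hex : ∃ k : ℕ, P.expensive z N (n * (r₀ * 2 ^ k)) + 1 ≤
      P.expensive z N (tau β n / n ^ 2)
  · classical
    set k := Nat.find hex with hk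
    have hk1 := Nat.find_spec hex
    rcases Nat.eq_zero_or_pos k with h0 | h0
    · rw [← hk, h0] at hk1
      -- At the smallest threshold the claimed bound is weaker than monotonicity of the gap, because
      -- `96 / β ≥ 80`.
      refine Or.inr ⟨r₀ * 2 ^ 0, by positivity, ?_, hk1⟩
      obtain ⟨-, h2⟩ := step_spec S.dim_pos hβ hβ' hz hstep
      have h3 : gap z' ≤ gap z := by
        refine h2.trans ?_
        have : 0 ≤ 3 * β / (4 * √n) * gap z := by positivity
        linarith
      refine h3.trans ?_
      rw [pow_zero, mul_one, ← mul_div_assoc, le_div_iff₀ hr₀0, mul_comm]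
      gcongr
      rw [← hQ2, hr₀, le_div_iff₀ hβ]
      have : 0 < n * distortion n γ := by positivity
      nlinarith
    · have hk2 := Nat.find_min hex (m := k - 1) (by omega)
      have hrk : r₀ ≤ r₀ * 2 ^ (k - 1) := le_mul_of_one_le_right hr₀0.le (one_le_pow₀ (by norm_num))
      have h1 := hstable _ hrk hk2
      have e : r₀ * 2 ^ k = 2 * (r₀ * 2 ^ (k - 1)) := by
        obtain ⟨k', hk'⟩ : ∃ k', k = k' + 1 := ⟨k - 1, by omega⟩
        rw [hk', Nat.add_sub_cancel]
        ring
      rcases max_cases μ₁ (gap z / (r₀ * 2 ^ (k - 1))) with ⟨h2, -⟩ | ⟨h2, -⟩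
      · rw [h2] at h1
        left
        have := S.nonneg
        refine h1.trans ?_
        gcongr
        linarith
      · rw [h2] at h1
        refine Or.inr ⟨r₀ * 2 ^ k, by positivity, ?_, hk1⟩
        rw [e]
        refine h1.trans (le_of_eq ?_)
        rw [← hQ]
        field_simp
  · push Not at hex
    left
    -- Without any drop, the estimate holds for arbitrarily large `r`. The limit leaves only the
    -- term with `μ₁`; this also covers a segment ending at parameter `0`.
    have hlim : Filter.Tendsto (fun k : ℕ => Q * max μ₁ (gap z / (r₀ * 2 ^ k))) Filter.atTop
        (𝓝 (Q * max μ₁ 0)) := by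
      refine Filter.Tendsto.const_mul _ (Filter.Tendsto.max tendsto_const_nhds ?_)
      refine Filter.Tendsto.div_atTop tendsto_const_nhds ?_
      exact Filter.Tendsto.const_mul_atTop hr₀0
        (tendsto_pow_atTop_atTop_of_one_lt (by norm_num))
    have h1 : gap z' ≤ Q * max μ₁ 0 := by
      refine ge_of_tendsto' hlim fun k => hstable _ ?_ (not_le.2 (hex k))
      exact le_mul_of_one_le_right hr₀0.le (one_le_pow₀ (by norm_num))
    rw [max_eq_left S.nonneg] at h1
    have := mul_nonneg hQ0.le S.nonneg
    linarith

end LP.PolarizedSegment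

/-! ## Executions -/

section Reaches

variable {α : Type*} {step : α → α → Prop} {goal goal' : α → Prop}

lemma reachesWithin_of_goal {z : α} (h : goal z) : ∀ K, ReachesWithin step goal K z
  | 0 => h
  | _ + 1 => Or.inl h

lemma ReachesWithin.succ : ∀ {K : ℕ} {z : α}, ReachesWithin step goal K z →
    ReachesWithin step goal (K + 1) z
  | 0, _, h => Or.inl h
  | _ + 1, _, h => h.imp_right fun ⟨h1, h2⟩ => ⟨h1, fun z' hz' => (h2 z' hz').succ⟩

lemma ReachesWithin.mono {K K' : ℕ} {z : α} (h : ReachesWithin step goal K z) (hK : K ≤ K') :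
    ReachesWithin step goal K' z := by
  induction K', hK using Nat.le_induction with
  | base => exact h
  | succ _ _ ih => exact ih.succ

lemma ReachesWithin.trans {K' : ℕ} (hgoal : ∀ z, goal z → ReachesWithin step goal' K' z) :
    ∀ {K : ℕ} {z : α}, ReachesWithin step goal K z → ReachesWithin step goal' (K + K') z
  | 0, z, h => by
    rw [zero_add]
    exact hgoal z h
  | K + 1, z, h => by
    rcases h with h | ⟨h1, h2⟩
    · exact (hgoal z h).mono (by omega)
    · rw [Nat.add_right_comm]
      exact Or.inr ⟨h1, fun z' hz' => (h2 z' hz').trans hgoal⟩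

end Reaches

/-! ### The potential and the total number of iterations. -/

namespace LP

variable {m n : ℕ} {P : LP m n} {β γ : ℝ}

/-- The guaranteed factor by which an iteration decreases the gap. -/
def decrease (β : ℝ) (n : ℕ) : ℝ := 1 - 3 * β / (4 * √n)

lemma decrease_nonneg (hn : 0 < n) (hβ : β ≤ 1 / 6) : 0 ≤ decrease β n := by
  have hsq := one_le_sqrt_natCast hn
  unfold decrease
  rw [sub_nonneg, div_le_one (by positivity)]
  linarith

lemma decrease_le_one (hβ0 : 0 < β) : decrease β n ≤ 1 := by
  unfold decrease
  have : 0 ≤ 3 * β / (4 * √n) := by positivity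
  linarith

/-- After `R` iterations the gap has decreased by the `R`-th power of the guaranteed factor. -/
lemma reachesWithin_decrease (hn : 0 < n) (hβ0 : 0 < β) (hβ : β ≤ 1 / 6) (R : ℕ) {z : State n}
    (hz : z ∈ P.nbhd β) :
    ReachesWithin (P.Step β) (fun z' => P.IsOptimalLimit β z' ∨
      (z' ∈ P.nbhd β ∧ gap z' ≤ decrease β n ^ R * gap z)) R z := by
  induction R generalizing z with
  | zero => exact Or.inr ⟨hz, by simp⟩
  | succ R ih =>
    refine Or.inr ⟨exists_step hn hβ0 hβ hz, fun z' hz' => ?_⟩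
    obtain ⟨h1, h2⟩ := step_spec hn hβ0 hβ hz hz'
    rcases h1 with h1 | h1
    · have h3 := (ih h1).trans (K' := 0) (goal' := fun z'' => P.IsOptimalLimit β z'' ∨
        (z'' ∈ P.nbhd β ∧ gap z'' ≤ decrease β n ^ (R + 1) * gap z)) ?_
      · exact h3
      · rintro z'' (h4 | ⟨h4, h5⟩)
        · exact Or.inl h4
        · refine Or.inr ⟨h4, h5.trans ?_⟩
          rw [pow_succ, mul_assoc]
          exact mul_le_mul_of_nonneg_left h2 (pow_nonneg (decrease_nonneg hn hβ) R)
    · refine reachesWithin_of_goal ?_ _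
      exact Or.inl h1

/-- The goal of the algorithm for the final gap `μ`. -/
def Goal (P : LP m n) (β μ : ℝ) (z : State n) : Prop :=
  gap z ≤ μ ∧ (z ∈ closure (P.nbhd β) ∨ (gap z = 0 ∧ z ∈ closure (P.nbhd (2 * β))))

lemma IsOptimalLimit.goal {μ : ℝ} (hμ : 0 ≤ μ) {z : State n} (h : P.IsOptimalLimit β z) :
    P.Goal β μ z := ⟨h.1.trans_le hμ, Or.inr h⟩

lemma goal_of_mem_nbhd {μ : ℝ} {z : State n} (hz : z ∈ P.nbhd β) (h : gap z ≤ μ) :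
    P.Goal β μ z := ⟨h, Or.inl (subset_closure hz)⟩

/-- The number of directions that are still expensive at gap `M`, measured at the start of the
segment. -/
def remaining (P : LP m n) (β γ : ℝ) (μ₀ : ℝ) (N : Finset (Fin n)) (M : ℝ) : ℕ :=
  P.expensive (P.cp μ₀) N (tau β n / n ^ 2 / distortion n γ ^ 2 * μ₀ / M)

namespace PolarizedSegment

variable {μ₁ μ₀ : ℝ} {N : Finset (Fin n)} {z : State n}

lemma tau_pos (S : P.PolarizedSegment β γ μ₁ μ₀ N) : 0 < tau β n := by
  have hβ := S.β_pos
  have hn := S.natCast_pos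
  unfold tau
  positivity

/-- A smaller gap means a higher threshold at the fixed starting point, hence fewer directions. -/
lemma remaining_mono (S : P.PolarizedSegment β γ μ₁ μ₀ N) {M M' : ℝ} (hM : 0 < M)
    (h : M ≤ M') : P.remaining β γ μ₀ N M ≤ P.remaining β γ μ₀ N M' := by
  have h1 := S.tau_pos
  have h2 := S.start_pos
  refine expensive_antitone _ _ ?_
  gcongr

/-- The count at an iterate is bounded by the count at the start of the segment. -/
lemma expensive_le_remaining (S : P.PolarizedSegment β γ μ₁ μ₀ N) (hz : z ∈ P.nbhd β)
    (h₁ : μ₁ ≤ gap z) (h₀ : gap z ≤ μ₀) :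
    P.expensive z N (tau β n / n ^ 2) ≤ P.remaining β γ μ₀ N (gap z) := by
  have h1 := S.tau_pos
  have h2 := S.start_pos
  have h3 := S.distortion_pos
  have hn := S.natCast_pos
  obtain ⟨-, -, hg⟩ := S.pos hz
  refine S.expensive_le (S.cp_mem_nbhd h2) (by rw [S.gap_cp h2]; exact S.lt.le)
    (S.gap_cp h2).le hz h₁ h₀ (by positivity) (le_of_eq ?_)
  rw [S.gap_cp h2]
  field_simp

/-- The count at the start of the segment is bounded by the count at an iterate. -/
lemma remaining_le_expensive (S : P.PolarizedSegment β γ μ₁ μ₀ N) (hz : z ∈ P.nbhd β)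
    (h₁ : μ₁ ≤ gap z) (h₀ : gap z ≤ μ₀) {M t : ℝ} (hM : 0 < M) (ht : 0 ≤ t)
    (h : distortion n γ ^ 2 * t * M ≤ tau β n / n ^ 2 / distortion n γ ^ 2 * gap z) :
    P.remaining β γ μ₀ N M ≤ P.expensive z N t := by
  have h2 := S.start_pos
  obtain ⟨-, -, hg⟩ := S.pos hz
  refine S.expensive_le hz h₁ h₀ (S.cp_mem_nbhd h2) (by rw [S.gap_cp h2]; exact S.lt.le)
    (S.gap_cp h2).le ht ?_
  rw [S.gap_cp h2, le_div_iff₀ hM]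
  calc distortion n γ ^ 2 * (μ₀ / gap z) * t * M
      = distortion n γ ^ 2 * t * M * (μ₀ / gap z) := by ring
    _ ≤ tau β n / n ^ 2 / distortion n γ ^ 2 * gap z * (μ₀ / gap z) := by gcongr
    _ = _ := by field_simp

/-- Passing to the next segment. -/
lemma remaining_next_le (S : P.PolarizedSegment β γ μ₁ μ₀ N) (h₁ : 0 < μ₁) (N' : Finset (Fin n))
    {M : ℝ} (hM : 0 < M) : P.remaining β γ μ₁ N' (M / distortion n γ ^ 2) ≤
      P.remaining β γ μ₀ N M + 2 * (symmDiff N' N).card := by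
  have h2 := S.start_pos
  have h3 := S.distortion_pos
  have h4 := S.tau_pos
  have hn := S.natCast_pos
  refine (expensive_le_add_card_symmDiff _ N N' (by positivity)).trans ?_
  gcongr
  refine S.expensive_le (S.cp_mem_nbhd h2) (by rw [S.gap_cp h2]; exact S.lt.le)
    (S.gap_cp h2).le (S.cp_mem_nbhd h₁) (S.gap_cp h₁).ge (by rw [S.gap_cp h₁]; exact S.lt.le)
    (by positivity) (le_of_eq ?_)
  rw [S.gap_cp h2, S.gap_cp h₁]
  field_simp

end PolarizedSegment

/-- The potential argument: the iterations of the whole execution are charged to the expensive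
directions that become cheap and to the changes of the partition. -/
lemma reachesWithin_goal {T : ℕ} {μ : ℕ → ℝ} {N : ℕ → Finset (Fin n)}
    (S : ∀ i < T, P.PolarizedSegment β γ (μ (i + 1)) (μ i) (N (i + 1))) {F : ℝ} {R : ℕ}
    (hF1 : distortion n γ ^ 2 ≤ F) (hF2 : 96 * n * distortion n γ / β ≤ F)
    (hF3 : distortion n γ ^ 2 * n * (96 * n * distortion n γ / β) ≤
      tau β n / n ^ 2 / distortion n γ ^ 2 * F)
    (hR : decrease β n ^ R * F ≤ 1) :
    ∀ (w i : ℕ), i < T → ∀ z ∈ P.nbhd β, ∀ (M : ℝ) (d p : ℕ), 0 < M → gap z ≤ μ i →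
      gap z ≤ M * (distortion n γ ^ 2) ^ d → P.remaining β γ (μ i) (N (i + 1)) M ≤ p →
      p + d + ∑ k ∈ Finset.Ico (i + 1) T, (2 * (symmDiff (N (k + 1)) (N k)).card + 3) + 1 ≤ w →
      ReachesWithin (P.Step β) (P.Goal β (μ T)) ((R + 1) * w) z := by
  -- Here `w` counts blocks of `R + 1` iterations. `M` is a reference gap at which at most `p`
  -- directions remain, and `d` is the number of factors `distortion n γ ^ 2` by which the current
  -- gap may exceed `M`. The summand `3` for each later segment covers the increase of `d` and the
  -- block used to finish the current segment.
  intro w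
  induction w with
  | zero =>
    intro i _ z _ M d p _ _ _ _ hw
    omega
  | succ w ih =>
    intro i hi z hz M d p hM hzi hzM hp hw
    have Si := S i hi
    have hn := Si.dim_pos
    have hβ := Si.β_pos
    have hβ' := Si.β_le
    have hd := Si.distortion_pos
    have hn' := Si.natCast_pos
    obtain ⟨hx, hs, hg⟩ := Si.pos hz
    have hF0 : 0 < F := lt_of_lt_of_le (by positivity) hF1
    have hμT : 0 ≤ μ T := by
      obtain ⟨T', rfl⟩ : ∃ T', T = T' + 1 := ⟨T - 1, by omega⟩
      exact (S T' (by omega)).nonneg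
    have hθ0 := decrease_nonneg (n := n) hn hβ'
    have hθ1 := decrease_le_one (n := n) hβ
    have hdec : ∀ {a b : ℝ}, 0 ≤ b → a ≤ decrease β n ^ R * b → a * F ≤ b := by
      intro a b hb h
      calc a * F ≤ decrease β n ^ R * b * F := by gcongr
        _ = decrease β n ^ R * F * b := by ring
        _ ≤ 1 * b := by gcongr
        _ = b := one_mul b
    have htrans : ∀ z' ∈ P.nbhd β, gap z' ≤ gap z → gap z' ≤ μ (i + 1) →
        ReachesWithin (P.Step β) (P.Goal β (μ T)) ((R + 1) * w) z' := by
      intro z' hz' hle hz'i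
      rcases Nat.lt_or_ge (i + 1) T with hlt | hge
      · have hsum : ∑ k ∈ Finset.Ico (i + 1) T, (2 * (symmDiff (N (k + 1)) (N k)).card + 3) =
            2 * (symmDiff (N (i + 1 + 1)) (N (i + 1))).card + 3 +
              ∑ k ∈ Finset.Ico (i + 1 + 1) T, (2 * (symmDiff (N (k + 1)) (N k)).card + 3) :=
          Finset.sum_eq_sum_Ico_succ_bot hlt _
        -- Re-basing the count at the new starting point lowers the reference gap by `distortion n γ
        -- ^ 2`, and the changed partition adds new directions.
        refine ih (i + 1) hlt z' hz' (M / distortion n γ ^ 2) (d + 1)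
          (p + 2 * (symmDiff (N (i + 1 + 1)) (N (i + 1))).card) (by positivity) hz'i ?_ ?_ ?_
        · refine (hle.trans hzM).trans (le_of_eq ?_)
          field_simp
          ring
        · have := Si.remaining_next_le (S (i + 1) hlt).start_pos (N (i + 1 + 1)) hM
          omega
        · omega
      · have hT : i + 1 = T := by omega
        rw [hT] at hz'i
        exact reachesWithin_of_goal (goal_of_mem_nbhd hz' hz'i) _
    rcases le_or_gt (gap z) (μ (i + 1)) with hcase | hcase
    · exact (htrans z hz le_rfl hcase).mono (by gcongr; omega)
    have hrun := reachesWithin_decrease (P := P) hn hβ hβ' (R + 1) hz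
    have hgoalK : ∀ K z', P.IsOptimalLimit β z' →
        ReachesWithin (P.Step β) (P.Goal β (μ T)) K z' := fun K z' h =>
      reachesWithin_of_goal (h.goal hμT) K
    have hK : (R + 1) * (w + 1) = (R + 1) + (R + 1) * w := by ring
    have hshort : ∀ z' : State n, gap z' ≤ decrease β n ^ (R + 1) * gap z → gap z' * F ≤ gap z ∧
        gap z' ≤ gap z := by
      intro z' h
      have h1 : gap z' ≤ decrease β n ^ R * gap z := by
        refine h.trans (mul_le_mul_of_nonneg_right ?_ hg.le)
        exact pow_le_pow_of_le_one hθ0 hθ1 (Nat.le_succ R)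
      refine ⟨hdec hg.le h1, h1.trans ?_⟩
      exact mul_le_of_le_one_left hg.le (pow_le_one₀ hθ0 hθ1)
    rcases Nat.eq_zero_or_pos d with rfl | hdpos
    · rw [pow_zero, mul_one] at hzM
      -- Close to the end, one block finishes the segment since `F` exceeds the remaining factor.
      rcases le_or_gt (gap z) (96 * n * distortion n γ / β * μ (i + 1)) with hnear | hfar
      · rw [hK]
        refine hrun.trans ?_
        rintro z' (h | ⟨h, h'⟩)
        · exact hgoalK _ z' h
        · obtain ⟨h1, h2⟩ := hshort z' h'
          refine htrans z' h h2 ?_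
          refine le_of_mul_le_mul_right ?_ hF0
          calc gap z' * F ≤ gap z := h1
            _ ≤ _ := hnear
            _ ≤ F * μ (i + 1) := mul_le_mul_of_nonneg_right hF2 Si.nonneg
            _ = _ := mul_comm _ _
      · have hK' : (R + 1) * (w + 1) = (R + (R + 1) * w) + 1 := by ring
        rw [hK']
        -- The first iteration of the block is analysed by `progress`; the other `R` supply the
        -- factor `F` that makes its polynomial losses harmless.
        refine Or.inr ⟨exists_step hn hβ hβ' hz, fun z' hz' => ?_⟩
        obtain ⟨h1, h2⟩ := step_spec hn hβ hβ' hz hz'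
        rcases h1 with h1 | h1
        swap
        · exact hgoalK _ z' h1
        have hle' : gap z' ≤ gap z := h2.trans (mul_le_of_le_one_left hg.le hθ1)
        obtain ⟨-, -, hg'⟩ := Si.pos h1
        refine (reachesWithin_decrease hn hβ hβ' R h1).trans ?_
        rintro z'' (h3 | ⟨h3, h4⟩)
        · exact hgoalK _ z'' h3
        have h5 := hdec hg'.le h4
        obtain ⟨-, -, hg''⟩ := Si.pos h3
        have hle'' : gap z'' ≤ gap z := by
          refine (h4.trans ?_).trans hle'
          exact mul_le_of_le_one_left hg'.le (pow_le_one₀ hθ0 hθ1)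
        rcases le_or_gt (gap z'') (μ (i + 1)) with hend | hend
        · exact htrans z'' h3 hle'' hend
        rcases Si.progress hz hzi hfar hz' with h6 | ⟨r, hr, h6, h7⟩
        · refine htrans z'' h3 hle'' ?_
          refine le_of_mul_le_mul_right ?_ hF0
          calc gap z'' * F ≤ gap z' := h5
            _ ≤ _ := h6
            _ ≤ F * μ (i + 1) := mul_le_mul_of_nonneg_right hF2 Si.nonneg
            _ = _ := mul_comm _ _
        · have h8 : P.remaining β γ (μ i) (N (i + 1)) (gap z'') ≤
              P.expensive z (N (i + 1)) (n * r) := by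
            refine Si.remaining_le_expensive hz hcase.le hzi hg'' (by positivity) ?_
            refine le_of_mul_le_mul_right ?_ hF0
            calc distortion n γ ^ 2 * (n * r) * gap z'' * F
                = distortion n γ ^ 2 * (n * r) * (gap z'' * F) := by ring
              _ ≤ distortion n γ ^ 2 * (n * r) *
                  (96 * n * distortion n γ / β * (gap z / r)) := by
                  exact mul_le_mul_of_nonneg_left (h5.trans h6) (by positivity)
              _ = distortion n γ ^ 2 * n * (96 * n * distortion n γ / β) * gap z := by
                  field_simp
              _ ≤ tau β n / n ^ 2 / distortion n γ ^ 2 * F * gap z := by gcongr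
              _ = _ := by ring
          have h9 := Si.expensive_le_remaining hz hcase.le hzi
          have h10 := Si.remaining_mono hg hzM
          refine ih i hi z'' h3 (gap z'') 0 (p - 1) hg'' (hle''.trans hzi) (by simp) ?_ ?_ <;>
          omega
    · rw [hK]
      refine hrun.trans ?_
      rintro z' (h | ⟨h, h'⟩)
      · exact hgoalK _ z' h
      · obtain ⟨h1, h2⟩ := hshort z' h'
        -- A block spent only on catching up with the reference gap; it removes one factor
        -- `distortion n γ ^ 2`, which is at most `F`.
        refine ih i hi z' h M (d - 1) p hM (h2.trans hzi) ?_ hp (by omega)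
        refine le_of_mul_le_mul_right ?_ hF0
        calc gap z' * F ≤ gap z := h1
          _ ≤ M * (distortion n γ ^ 2) ^ d := hzM
          _ = M * (distortion n γ ^ 2) ^ (d - 1) * distortion n γ ^ 2 := by
              rw [mul_assoc, ← pow_succ, Nat.sub_add_cancel hdpos]
          _ ≤ _ := by gcongr

/-- A number of iterations after which the gap has decreased by the factor `F`. -/
lemma decrease_pow_mul_le (hn : 0 < n) (hβ0 : 0 < β) (hβ : β ≤ 1 / 6) {F : ℝ} (hF : 0 < F)
    {R : ℕ} (hR : 4 * √n / (3 * β) * Real.log F ≤ R) : decrease β n ^ R * F ≤ 1 := by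
  have hsq := one_le_sqrt_natCast hn
  have h1 : decrease β n ≤ Real.exp (-(3 * β / (4 * √n))) := by
    have := Real.add_one_le_exp (-(3 * β / (4 * √n)))
    unfold decrease
    linarith
  have h2 : decrease β n ^ R ≤ Real.exp (-(3 * β / (4 * √n))) ^ R :=
    pow_le_pow_left₀ (decrease_nonneg hn hβ) h1 R
  rw [← Real.exp_nat_mul] at h2
  have h3 : R * -(3 * β / (4 * √n)) ≤ -Real.log F := by
    have h4 : Real.log F = 4 * √n / (3 * β) * Real.log F * (3 * β / (4 * √n)) := by
      field_simp
    have h5 : 4 * √n / (3 * β) * Real.log F * (3 * β / (4 * √n)) ≤ R * (3 * β / (4 * √n)) := by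
      gcongr
    linarith
  calc decrease β n ^ R * F ≤ Real.exp (-Real.log F) * F := by
        gcongr
        exact h2.trans (Real.exp_le_exp.2 h3)
    _ = 1 := by rw [Real.exp_neg, Real.exp_log hF, inv_mul_cancel₀ hF.ne']

/-- All factors that occur in the potential argument are bounded polynomially in `n / γ`. -/
lemma factor_bounds (hn : 0 < n) (hβ0 : 0 < β) (hβ : β ≤ 1 / 6) (hγ : 0 < γ) (hγ1 : γ ≤ 1) :
    distortion n γ ^ 2 ≤ 10 ^ 8 / β ^ 2 * (n / γ) ^ 15 ∧
    96 * n * distortion n γ / β ≤ 10 ^ 8 / β ^ 2 * (n / γ) ^ 15 ∧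
    distortion n γ ^ 2 * n * (96 * n * distortion n γ / β) ≤
      tau β n / n ^ 2 / distortion n γ ^ 2 * (10 ^ 8 / β ^ 2 * (n / γ) ^ 15) := by
  have hn1 : (1 : ℝ) ≤ n := by exact_mod_cast hn
  have hn0 : (0 : ℝ) < n := by linarith
  have hsq := one_le_sqrt_natCast hn
  set q : ℝ := n / γ with hq
  have hnq : (n : ℝ) ≤ q := by
    rw [hq, le_div_iff₀ hγ]
    nlinarith
  have hq1 : 1 ≤ q := hn1.trans hnq
  have hd : distortion n γ ≤ 9 * q ^ 2 := by
    unfold distortion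
    have e : 9 * (n : ℝ) ^ 2 / γ = 9 * (n * q) := by
      rw [hq]
      field_simp
    rw [e]
    nlinarith
  have hd0 : 0 < distortion n γ := by
    unfold distortion
    positivity
  have hβ1 : 1 ≤ 1 / β := by
    rw [le_div_iff₀ hβ0]
    linarith
  have hβ2 : 1 / β ≤ 1 / β ^ 2 := by
    have e : 1 / β ^ 2 = (1 / β) * (1 / β) := by
      field_simp
    rw [e]
    nlinarith
  have hQ : 96 * n * distortion n γ / β ≤ 864 * q ^ 3 * (1 / β) := by
    rw [mul_one_div]
    refine div_le_div_of_nonneg_right ?_ hβ0.le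
    calc 96 * n * distortion n γ ≤ 96 * q * (9 * q ^ 2) := by gcongr
      _ = _ := by ring
  have hp3 : q ^ 3 ≤ q ^ 15 := pow_le_pow_right₀ hq1 (by norm_num)
  have hp4 : q ^ 4 ≤ q ^ 15 := pow_le_pow_right₀ hq1 (by norm_num)
  have hF : (10 : ℝ) ^ 8 / β ^ 2 * q ^ 15 = 10 ^ 8 * q ^ 15 * (1 / β ^ 2) := by ring
  refine ⟨?_, ?_, ?_⟩
  · calc distortion n γ ^ 2 ≤ (9 * q ^ 2) ^ 2 := by gcongr
      _ = 81 * q ^ 4 * 1 := by ring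
      _ ≤ 10 ^ 8 * q ^ 15 * (1 / β ^ 2) := by
          gcongr
          · norm_num
          · exact hβ1.trans hβ2
      _ = _ := hF.symm
  · calc 96 * n * distortion n γ / β ≤ 864 * q ^ 3 * (1 / β) := hQ
      _ ≤ 10 ^ 8 * q ^ 15 * (1 / β ^ 2) := by
          gcongr
          norm_num
      _ = _ := hF.symm
  · have hτ : β / (16 * q ^ 3) ≤ tau β n / n ^ 2 := by
      unfold tau
      rw [div_div]
      have hsqn : √(n : ℝ) ≤ q := by
        refine le_trans (Real.sqrt_le_iff.2 ⟨hn0.le, ?_⟩) hnq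
        nlinarith
      refine div_le_div_of_nonneg_left hβ0.le (by positivity) ?_
      calc 16 * √n * n ^ 2 ≤ 16 * q * q ^ 2 := by gcongr
        _ = _ := by ring
    rw [div_mul_eq_mul_div, le_div_iff₀ (by positivity)]
    calc distortion n γ ^ 2 * n * (96 * n * distortion n γ / β) * distortion n γ ^ 2
        ≤ (9 * q ^ 2) ^ 2 * q * (864 * q ^ 3 * (1 / β)) * (9 * q ^ 2) ^ 2 := by gcongr
      _ = 6561 * 864 * q ^ 12 * (1 / β) := by ring
      -- Since `6561 * 864 = 5668704 ≤ 10 ^ 8 / 16`, this step fixes the constant in `F`; the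
      -- exponent `15` is `12` plus the `3` lost in the bound for `tau β n / n ^ 2`.
      _ ≤ 10 ^ 8 / 16 * q ^ 12 * (1 / β) := by
          gcongr
          norm_num
      _ = β / (16 * q ^ 3) * (10 ^ 8 / β ^ 2 * q ^ 15) := by
          field_simp
      _ ≤ _ := by gcongr

end LP

end SubspaceIPM
end

/-! ### Choice of the constants and the start of the induction. -/

theorem mainTheorem6 (β : ℝ) (hβ0 : 0 < β) (hβ : β ≤ 1 / 6) :
    ∃ C : ℝ, 0 < C ∧
      ∀ (m n : ℕ) (P : LP m n), P.A.rank = m →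
      ∀ γ : ℝ, 0 < γ → γ ≤ 1 → 2 * γ ≤ (n : ℝ) →
      ∀ (T : ℕ) (μ : ℕ → ℝ) (N : ℕ → Finset (Fin n)),
        0 ≤ μ T → (∀ i < T, μ (i + 1) < μ i) →
        N 0 = ∅ → (∀ i < T, N (i + 1) ≠ N i) →
        (∀ i < T, P.IsPolarized γ (μ (i + 1)) (μ i) (N (i + 1))) →
      ∀ z₀ ∈ P.nbhd β, gap z₀ ≤ μ 0 →
        ∃ K : ℕ,
          (K : ℝ) ≤ C * (√n * Real.log (n / γ) *
            ∑ i ∈ Finset.range T, ((symmDiff (N (i + 1)) (N i)).card : ℝ)) ∧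
          ReachesWithin (P.Step β)
            (fun z => gap z ≤ μ T ∧
              (z ∈ closure (P.nbhd β) ∨ (gap z = 0 ∧ z ∈ closure (P.nbhd (2 * β)))))
            K z₀ := by
  set A : ℝ := 10 ^ 8 / β ^ 2 with hA
  have hA1 : 1 ≤ A := by
    rw [hA, le_div_iff₀ (by positivity)]
    nlinarith
  have hlogA : 0 ≤ Real.log A := Real.log_nonneg hA1
  refine ⟨5 * (4 / (3 * β) * (2 * Real.log A + 15) + 4), by positivity, ?_⟩
  intro m n P _ γ hγ hγ1 hγn T μ N hμT hμ hN0 hN hpol z₀ hz₀ hgap₀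
  have hn0 : (0 : ℝ) < n := by linarith
  have hn : 0 < n := by exact_mod_cast hn0
  have hsq := LP.one_le_sqrt_natCast hn
  rcases Nat.eq_zero_or_pos T with rfl | hT
  · exact ⟨0, by simp, hgap₀, Or.inl (subset_closure hz₀)⟩
  have hnonneg : ∀ j ≤ T, 0 ≤ μ (T - j) := by
    intro j
    induction j with
    | zero => exact fun _ => hμT
    | succ j ih =>
      intro hj
      have h1 := hμ (T - (j + 1)) (by omega)
      have h2 : T - (j + 1) + 1 = T - j := by omega
      rw [h2] at h1
      exact (ih (by omega)).trans h1.le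
  have S : ∀ i < T, P.PolarizedSegment β γ (μ (i + 1)) (μ i) (N (i + 1)) := by
    intro i hi
    refine ⟨hn, hβ0, hβ, hγ, hγ1, ?_, hμ i hi, fun ν hν => LP.isCentral_cp hz₀ hν, hpol i hi⟩
    have := hnonneg (T - (i + 1)) (by omega)
    rwa [Nat.sub_sub_self hi] at this
  set q : ℝ := n / γ with hq
  have hq2 : 2 ≤ q := by
    rw [hq, le_div_iff₀ hγ]
    exact hγn
  -- The assumption `n / γ ≥ 2` enters here: the constant `log A` and the two units from rounding
  -- and from the extra iteration are absorbed into multiples of `√n * log q`.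
  have hlogq : 1 / 2 ≤ Real.log q := by
    have h1 := Real.log_two_gt_d9
    have h2 := Real.log_le_log (by norm_num) hq2
    linarith
  set F : ℝ := A * q ^ 15 with hF
  have hF0 : 0 < F := by positivity
  obtain ⟨hF1, hF2, hF3⟩ := LP.factor_bounds hn hβ0 hβ hγ hγ1
  set R : ℕ := ⌈4 * √n / (3 * β) * Real.log F⌉₊ with hR
  have hlogF : Real.log F = Real.log A + 15 * Real.log q := by
    rw [hF, Real.log_mul (by positivity) (by positivity), Real.log_pow]
    norm_num
  have hRF := LP.decrease_pow_mul_le hn hβ0 hβ hF0 (Nat.le_ceil (4 * √n / (3 * β) * Real.log F))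
  rw [← hR] at hRF
  have hRle : (R : ℝ) + 1 ≤ (4 / (3 * β) * (2 * Real.log A + 15) + 4) * (√n * Real.log q) := by
    have h1 : (R : ℝ) < 4 * √n / (3 * β) * Real.log F + 1 :=
      Nat.ceil_lt_add_one (by rw [hlogF]; positivity)
    have h2 : Real.log F ≤ (2 * Real.log A + 15) * Real.log q := by
      rw [hlogF]
      nlinarith
    have h3 : 4 * √n / (3 * β) * Real.log F ≤
        4 * √n / (3 * β) * ((2 * Real.log A + 15) * Real.log q) := by gcongr
    have h4 : 4 * √n / (3 * β) * ((2 * Real.log A + 15) * Real.log q) =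
        4 / (3 * β) * (2 * Real.log A + 15) * (√n * Real.log q) := by ring
    have h5 : 1 / 2 ≤ √n * Real.log q := by nlinarith
    linarith
  set D : ℕ := ∑ i ∈ Finset.range T, (symmDiff (N (i + 1)) (N i)).card with hD
  have hDc : (∑ i ∈ Finset.range T, ((symmDiff (N (i + 1)) (N i)).card : ℝ)) = D := by
    rw [hD]
    push_cast
    rfl
  -- Consecutive partitions differ, so each additive `3` is at most three times the size of the
  -- symmetric difference.
  have hsum : 2 * (symmDiff (N 1) (N 0)).card + 0 +
      ∑ k ∈ Finset.Ico (0 + 1) T, (2 * (symmDiff (N (k + 1)) (N k)).card + 3) + 1 ≤ 5 * D := by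
    have h1 : ∑ k ∈ Finset.range T, (2 * (symmDiff (N (k + 1)) (N k)).card + 3) ≤ 5 * D := by
      rw [hD, Finset.mul_sum]
      refine Finset.sum_le_sum fun k hk => ?_
      have h2 : 0 < (symmDiff (N (k + 1)) (N k)).card := by
        rw [Finset.card_pos, Finset.nonempty_iff_ne_empty]
        intro h
        exact hN k (Finset.mem_range.1 hk) (symmDiff_eq_bot.1 h)
      omega
    have h3 : ∑ k ∈ Finset.range T, (2 * (symmDiff (N (k + 1)) (N k)).card + 3) =
        2 * (symmDiff (N (0 + 1)) (N 0)).card + 3 +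
          ∑ k ∈ Finset.Ico (0 + 1) T, (2 * (symmDiff (N (k + 1)) (N k)).card + 3) := by
      rw [Finset.range_eq_Ico]
      exact Finset.sum_eq_sum_Ico_succ_bot hT _
    simp only [zero_add] at h3 ⊢
    omega
  clear_value R D
  have hpos := LP.pos_of_mem_nbhd hz₀
  have hg := gap_pos hn hpos.1 hpos.2
  refine ⟨(R + 1) * (5 * D), ?_, ?_⟩
  · rw [hDc]
    push_cast
    calc ((R : ℝ) + 1) * (5 * D)
        ≤ (4 / (3 * β) * (2 * Real.log A + 15) + 4) * (√n * Real.log q) * (5 * D) := by gcongr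
      _ = _ := by ring
  · change ReachesWithin (P.Step β) (P.Goal β (μ T)) _ z₀
    -- The reference gap is initially the gap of `z₀` itself. Since nothing is expensive for `N 0 =
    -- ∅`, the initial count is bounded by the first change of the partition alone.
    refine LP.reachesWithin_goal S hF1 hF2 hF3 hRF (5 * D) 0 hT z₀ hz₀ (gap z₀) 0
      (2 * (symmDiff (N 1) (N 0)).card) hg hgap₀ (by rw [pow_zero, mul_one]) ?_ hsum
    have S0 := S 0 hT
    have hτ := S0.tau_pos
    have hd := S0.distortion_pos
    have hμ0 := S0.start_pos
    have h1 := LP.expensive_le_add_card_symmDiff (P := P) (P.cp (μ 0)) (N 0) (N 1)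
      (t := tau β n / n ^ 2 / distortion n γ ^ 2 * μ 0 / gap z₀) (by positivity)
    rw [hN0, LP.expensive_empty _ (by positivity), zero_add] at h1
    rw [hN0]
    exact h1
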